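/- Let $R$ be a commutative ring with unity. **Diagrams.** Planar diagrams are composed of the corollas $T_n$ ($n\ge 2$; $n$ thin leaves and a thin root), $M_{j,k}$ ($j+k\ge 1$; a thick root, a thick leaf, $j$ thin leaves to its left and $k$ thin leaves to its right) and $I_{k,l}$ ($k,l\ge 0$; an empty root drawn as a thick vertex, two horizontal thick leaves, $k$ thin leaves above and $l$ thin leaves below), by attaching roots to leaves of the same color. Let $\mathcal L(D)$ be the set of leaves and $\mathcal E(D)$ the set of internal edges of $D$. The degree of $D$ is $\#\mathcal L(D)-\#\mathcal E(D)-2$; diagrams of degree $0$ are called binary. An orientation of $D$ is a formal skew-commutative product $\omega=\pm e_1\wedge\dots\wedge e_r$ of its edges; a labeling is a bijection $f:\{1,\dots,\#\mathcal L(D)\}\to\mathcal L(D)$, and $f_\circlearrowright$ denotes the clockwise one (from left to right for trees; starting at the left thick leaf for inner product diagrams). Let $C=C_*\hat{\mathcal A}$ be the operad generated by the $(D,f,\omega)$ modulo $(D,f,-\omega)=-(D,f,\omega)$, with $\sigma\cdot(D,f,\omega)=\operatorname{sgn}(\sigma)(D,f\circ\sigma,\omega)$ and $(D,f,\omega)\circ_i(E,f',\omega')=(-1)^{i(l+1)+k|E|}(D\circ_{f(i)}E,f_{D\circ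 E},\omega\wedge\omega'\wedge e)$, where $D$, $E$ have $k$, $l$ leaves and $e$ is the new edge. Let $Q=Q_*\hat{\mathcal A}$ be the operad generated by the $(D,f,g,\omega)$ modulo $(D,f,g,-\omega)=-(D,f,g,\omega)$, where $g$ marks each edge as metric or non-metric and $\omega$ is an orientation of the set of metric edges, with $\sigma\cdot(D,f,g,\omega)=(D,f\circ\sigma,g,\omega)$ and $(D,f,g,\omega)\circ_i(E,f',g',\omega')=(D\circ_{f(i)}E,f_{D\circ E},g_{D\circ E},\omega\wedge\omega')$, the new edge being non-metric. **Order.** The binary diagrams that contract to a given corolla are partially ordered by the relation $\le$ generated by the following local moves from a smaller to a greater diagram: (1) $(XY)Z<X(YZ)$ at thin vertices; (2) at a thick line of a module tree, a branch attached on the left below a branch attached on the right is less than the same branches with the right one below; (3) two branches attached to the left of the thick line by a common edge is less than the two attached separately; (4) two branches attached separately to the right of the thick line is less than the two attached by a common edge; (5) an upper branch next to the thick vertex of an inner product diagram moves from the left to the right of the vertex; (6) a lower branch next to the thick vertex moves from the right to the left of the vertex. For a diagram $D$, let $D_{\min}$ and $D_{\max}$ be the minimum and the maximum of the set of binary diagrams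 obtained from $D$ by inserting edges. **Signs.** The standard orientation $\omega^{\rm std}_B$ of binary diagrams $B$ is determined as follows: each local move replaces one edge and changes the sign, and the right comb (the diagram whose edges cut off the final intervals of the clockwise order of leaves) has the orientation $e_1\wedge\dots\wedge e_r$ with its edges numbered outward. Put $\xi_B=(-1)^{(n-2)(n-3)/2}\omega^{\rm std}_B$ if $B$ has $n$ leaves. An edge of $B$ is positive if it is the edge on the greater side of one of the local moves. If $D$ has $k$ edges, $S$ has degree $k$, and $S_{\max}\le D_{\min}$, then the $k$ edges of $D$ are the positive edges of $D_{\min}$, the positive edges of $S_{\max}$ are those not in $S$, and both sets are identified along a path of local moves from $D_{\min}$ down to $S_{\max}$ (at each move the positive edge that disappears corresponds to the one that appears). For an orientation $\omega_D$ of $D$, let $\omega(S,D)=\omega_D\rfloor\xi_{S_{\max}}$, where $(e_1\wedge\dots\wedge e_r)\rfloor(e_1\wedge\dots\wedge e_s)=(-1)^{r(r-1)/2}e_{r+1}\wedge\dots\wedge e_s$. **Maps.** Let $q:C\to Q$ be the map that is the identity on units, is equivariant and multiplicative with respect to the compositions $\circ_i$, and on a corolla is $q(c,f_\circlearrowright,+1)=\sum_B(B,f_\circlearrowright,m,\omega_B^{\rm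 std})$, the sum over all binary diagrams $B$ that contract to $c$, with all edges metric. Let $p:Q\to C$ be the map that is the identity on units, equivariant and multiplicative, and on a diagram $D$ with all edges metric is $p(D,f_\circlearrowright,m,\omega_D)=\sum_S(S,f_\circlearrowright,\omega(S,D))$, the sum over all $S$ that contract to the same corolla as $D$, have degree $\#\mathcal E(D)$, and satisfy $S_{\max}\le D_{\min}$. Let $\Delta_Q:Q\to Q\otimes Q$ be induced by the Serre diagonal of cubes, $$\Delta_Q(D,f,g,\omega)=\sum_{X}(-1)^{\rho(X)}(D/X,f,g_{D/X},\omega_{D/X})\otimes(D_{\bar X},f,g_{D_{\bar X}},\omega_{D_{\bar X}}),$$ where $X$ runs through the subsets of the set $\{e_1,\dots,e_r\}$ of metric edges, $\omega=e_1\wedge\dots\wedge e_r$, $\bar X$ is the complement of $X$, $\rho(X)=\#\{i<j: e_i\in X,\ e_j\in\bar X\}$, $D/X$ is obtained by contracting $X$, $D_{\bar X}$ by making the edges in $\bar X$ non-metric, and the factors of $\omega$ in $X$, respectively in $\bar X$, are deleted. Finally let $\Delta_C=(p\otimes p)\circ\Delta_Q\circ q:C\to C\otimes C$. **Proposition.**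 Let $c$ be a corolla of degree $k$, let $f$ be a labeling of its leaves, and choose an orientation $\omega_D$ of each diagram $D$ that contracts to $c$. Then, for suitable signs $\pm$, $$\Delta_C(c,f,+1)=\sum_{\substack{|S|+|T|=k\\ S_{\max}\le T_{\min}}}\pm\,(S,f,\omega_S)\otimes(T,f,\omega_T),$$ where the sum runs over all pairs $(S,T)$ of diagrams that contract to $c$, whose degrees $|S|$ and $|T|$ add up to $k$ and for which $S_{\max}\le T_{\min}$. -/

import Mathlib

open scoped TensorProduct

/-!
 # Planar diagrams, the three-colored operads of pairahedra and the diagonal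

 The leaves of a planar diagram are numbered clockwise, starting with `0`: from left to right for
 planar trees and module trees, and starting with the left thick leaf for inner product diagrams.
 An (internal) edge is recorded by the set of the leaves that it separates from the root (for
 inner product diagrams: from the thick vertex), and a diagram by the set of its edges. So
 inserting or contracting an edge is inserting or erasing an element of a finite set.
-/

noncomputable section

namespace Pairahedra

/-- The three colors. -/
inductive Color
  | empty
  | thin
  | thick
  deriving DecidableEq

/-- The corollas `T_n`, `M_{j,k}`, `I_{k,l}`. -/
inductive Corolla
  | T (n : ℕ)
  | M (j k : ℕ)
  | I (k l : ℕ)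
  deriving DecidableEq

namespace Corolla

/-- The admissible parameters: every corolla has at least two leaves. -/
def Valid : Corolla → Prop
  | T n => 2 ≤ n
  | M j k => 1 ≤ j + k
  | I _ _ => True

/-- The number of leaves. -/
def leaves : Corolla → ℕ
  | T n => n
  | M j k => j + 1 + k
  | I k l => k + l + 2

/-- The positions of the thick leaves. The thin leaves of `I_{k,l}` in the upper half-plane are
at the positions `1, …, k`, those in the lower half-plane at `k + 2, …, k + l + 1`. -/
def thickLeaves : Corolla → Finset ℕ
  | T _ => ∅
  | M j _ => {j}
  | I k _ => {0, k + 1}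

/-- The color of the root. -/
def rootColor : Corolla → Color
  | T _ => .thin
  | M _ _ => .thick
  | I _ _ => .empty

/-- The color of the leaf at position `a`. -/
def leafColor (c : Corolla) (a : ℕ) : Color :=
  if a ∈ c.thickLeaves then .thick else .thin

end Corolla

/-- The clockwise interval of `l` leaves starting at position `s`, for `n` leaves in total. -/
def arc (n s l : ℕ) : Finset ℕ := (Finset.range l).image fun i => (s + i) % n

/-- `e` is an edge that can be inserted into the corolla `c`: it cuts off at least two, but not
all, of the leaves; these are consecutive (in the linear order for trees and module trees, in the
cyclic order for inner product diagrams), and an edge of an inner product diagram does not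
separate both thick leaves from the thick vertex. -/
def IsEdge (c : Corolla) (e : Finset ℕ) : Prop :=
  ∃ s l : ℕ, s < c.leaves ∧ 2 ≤ l ∧ l < c.leaves ∧ e = arc c.leaves s l ∧
    match c with
    | .T _ => s + l ≤ c.leaves
    | .M _ _ => s + l ≤ c.leaves
    | .I k _ => ¬ (0 ∈ e ∧ k + 1 ∈ e)

/-- `D` is (the set of edges of) a planar diagram that contracts to the corolla `c`: its edges
are pairwise nested or disjoint. -/
def IsDiagram (c : Corolla) (D : Finset (Finset ℕ)) : Prop :=
  (∀ e ∈ D, IsEdge c e) ∧ ∀ e ∈ D, ∀ e' ∈ D, e ⊆ e' ∨ e' ⊆ e ∨ Disjoint e e'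

open Classical in
/-- The finite set of all planar diagrams that contract to the corolla `c`. -/
def diagrams (c : Corolla) : Finset (Finset (Finset ℕ)) :=
  (Finset.range c.leaves).powerset.powerset.filter (IsDiagram c)

/-- The degree `#leaves - #edges - 2` of a diagram. -/
def degree (c : Corolla) (D : Finset (Finset ℕ)) : ℤ := (c.leaves : ℤ) - D.card - 2

/-- Binary diagrams are the diagrams of degree `0`. -/
def IsBinary (c : Corolla) (B : Finset (Finset ℕ)) : Prop := IsDiagram c B ∧ degree c B = 0

/-! ## The order on binary diagrams -/

/-- The six local moves. The branches `X`, `Y`, `Z` are consecutive in the clockwise order; one of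
the two diagrams joins `X` to `Y`, the other one joins `Y` to `Z`. The diagram with `X ∪ Y` is the
smaller one, except when the thick line passes through the middle branch `Y`.
* `X`, `Y`, `Z` thin: associativity, `(XY)Z < X(YZ)`.
* `Y` thick: `X` is left and `Z` is right of the thick line of a module tree; the diagram in which
  `X` is attached below `Z` is smaller than the one in which `Z` is attached below `X`.
* `Z` thick (module tree): `X`, `Y` attached by a common edge to the left of the thick line is
  smaller than `X`, `Y` attached separately.
* `X` thick (module tree): `Y`, `Z` attached separately to the right of the thick line is smaller
  than `Y`, `Z` attached by a common edge.
* `X`, `Z` thick (inner product diagram): `Y` moves past the thick vertex, from left to right in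
  the upper half-plane and from right to left in the lower half-plane. -/
def LocalMove (c : Corolla) (e e' : Finset ℕ) : Prop :=
  ∃ s x y z : ℕ, 0 < x ∧ 0 < y ∧ 0 < z ∧ s < c.leaves ∧ x + y + z ≤ c.leaves ∧
    let X := arc c.leaves s x
    let Y := arc c.leaves (s + x) y
    let Z := arc c.leaves (s + x + y) z
    (Disjoint Y c.thickLeaves ∧ e = X ∪ Y ∧ e' = Y ∪ Z) ∨
      (¬ Disjoint Y c.thickLeaves ∧ e = Y ∪ Z ∧ e' = X ∪ Y)

/-- The binary diagram `B` with edge `e` and the binary diagram `B'` with edge `e'` differ by a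
local move that replaces `e` by `e'`, and `B` is the smaller one. -/
def Move (c : Corolla) (B : Finset (Finset ℕ)) (e : Finset ℕ)
    (B' : Finset (Finset ℕ)) (e' : Finset ℕ) : Prop :=
  IsBinary c B ∧ IsBinary c B' ∧ e ∈ B ∧ e' ∈ B' ∧ B.erase e = B'.erase e' ∧ LocalMove c e e'

/-- `(B, B')` is an edge-pair. -/
def EdgePair (c : Corolla) (B B' : Finset (Finset ℕ)) : Prop :=
  ∃ e e' : Finset ℕ, Move c B e B' e'

/-- The partial order on binary diagrams that is generated by the edge-pairs. -/
def Le (c : Corolla) : Finset (Finset ℕ) → Finset (Finset ℕ) → Prop :=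
  Relation.ReflTransGen (EdgePair c)

/-- The binary diagrams obtained from `D` by edge insertions. -/
def refinements (c : Corolla) (D : Finset (Finset ℕ)) : Set (Finset (Finset ℕ)) :=
  {B | IsBinary c B ∧ D ⊆ B}

open Classical in
/-- The maximum `D_max` of the binary diagrams obtained from `D` by edge insertions. -/
def maxOf (c : Corolla) (D : Finset (Finset ℕ)) : Finset (Finset ℕ) :=
  if h : ∃ B ∈ refinements c D, ∀ B' ∈ refinements c D, Le c B' B then h.choose else ∅

open Classical in
/-- The minimum `D_min` of the binary diagrams obtained from `D` by edge insertions. -/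
def minOf (c : Corolla) (D : Finset (Finset ℕ)) : Finset (Finset ℕ) :=
  if h : ∃ B ∈ refinements c D, ∀ B' ∈ refinements c D, Le c B B' then h.choose else ∅

/-! ## Orientations -/

/-- The sign `(-1)^(number of inversions)` of a list with respect to a numbering `key`. -/
def inversionSign {α : Type*} (key : α → ℕ) : List α → ℤˣ
  | [] => 1
  | x :: l => (-1) ^ (l.countP fun y => key y < key x) * inversionSign key l

/-- An injective numbering of the possible edges, used as a reference order. -/
def code (e : Finset ℕ) : ℕ := ∑ i ∈ e, 2 ^ i

/-- The formal product `± e₁ ∧ … ∧ eₖ` of edges. -/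
abbrev Orientation := ℤˣ × List (Finset ℕ)

namespace Orientation

/-- `ω` is an orientation of the set of edges `D`. -/
def IsOrientationOf (ω : Orientation) (D : Finset (Finset ℕ)) : Prop :=
  ω.2.Nodup ∧ ω.2.toFinset = D

/-- The skew-commutative product. -/
def wedge (ω ω' : Orientation) : Orientation := (ω.1 * ω'.1, ω.2 ++ ω'.2)

/-- The sign of `ω` relative to the product of the same edges in the reference order. -/
def sign (ω : Orientation) : ℤˣ := ω.1 * inversionSign code ω.2

/-- Renaming of edges. -/
def rename (φ : Finset ℕ → Finset ℕ) (ω : Orientation) : Orientation := (ω.1, ω.2.map φ)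

end Orientation

/-- The orientation of `D` by the product of its edges in the reference order. -/
def refOrientation (D : Finset (Finset ℕ)) : Orientation :=
  (inversionSign code D.toList, D.toList)

/-- The diagrams with standard orientation `e₁ ∧ … ∧ eₖ`: the right comb with its edges numbered
outward, all edges being final intervals in the clockwise order of the leaves. -/
def baseOrientation (c : Corolla) : Orientation :=
  (1, (List.range (c.leaves - 2)).map fun i => Finset.Ico (i + 1) c.leaves)

/-- A local move in either direction transfers an orientation by replacing the moved edge and
changing the sign. -/
def TransferStep (c : Corolla) (p p' : Finset (Finset ℕ) × Orientation) : Prop :=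
  ∃ e e' : Finset ℕ, (Move c p.1 e p'.1 e' ∨ Move c p'.1 e' p.1 e) ∧
    p'.2 = (-p.2.1, p.2.2.map fun d => if d = e then e' else d)

open Classical in
/-- The standard orientation of a binary diagram, transferred along a path of local moves. -/
def stdOrientation (c : Corolla) (B : Finset (Finset ℕ)) : Orientation :=
  if h : ∃ ω : Orientation, Relation.ReflTransGen (TransferStep c)
      ((baseOrientation c).2.toFinset, baseOrientation c) (B, ω)
  then h.choose else refOrientation B

/-- The orientation `ξ_B = (-1)^((n-2)(n-3)/2) ω_B^std` of a binary diagram with `n` leaves. -/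
def xiOrientation (c : Corolla) (B : Finset (Finset ℕ)) : Orientation :=
  ((-1) ^ ((c.leaves - 2) * (c.leaves - 3) / 2) * (stdOrientation c B).1, (stdOrientation c B).2)

/-- The contraction `ω' ⌋ ω`, as an orientation of the set `S` of those factors of `ω` that do
not occur in `ω'`: if `ω = e₁ ∧ … ∧ eₖ` and `ω' = e₁ ∧ … ∧ eᵣ`, then
`ω' ⌋ ω = (-1)^(r(r-1)/2) e_{r+1} ∧ … ∧ eₖ`. -/
def contract (ω' ω : Orientation) (S : Finset (Finset ℕ)) : Orientation :=
  ((-1) ^ (ω'.2.length * (ω'.2.length - 1) / 2) * ω.sign * (ω'.wedge (1, S.toList)).sign,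
    S.toList)

open Classical in
/-- The positive edges of a binary diagram: those on the greater side of one of the
six local moves. -/
def posEdges (c : Corolla) (B : Finset (Finset ℕ)) : Finset (Finset ℕ) :=
  B.filter fun e => ∃ B₀ e₀, Move c B₀ e₀ B e

/-- Keeping track of the positive edges along a local move from `p.1` down to `p'.1`: the positive
edge that disappears is renamed into the one that appears. -/
def TrackStep (c : Corolla) (p p' : Finset (Finset ℕ) × Orientation) : Prop :=
  EdgePair c p'.1 p.1 ∧ ∃ e e' : Finset ℕ,
    posEdges c p.1 \ posEdges c p'.1 = {e} ∧ posEdges c p'.1 \ posEdges c p.1 = {e'} ∧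
    p'.2 = p.2.rename fun d => if d = e then e' else d

open Classical in
/-- The orientation `ω` of the set of positive edges of `D_min`, read on the positive edges of
`S_max` by means of a path from `D_min` down to `S_max`. -/
def trackedOrientation (c : Corolla) (S D : Finset (Finset ℕ)) (ω : Orientation) : Orientation :=
  if h : ∃ ω' : Orientation,
      Relation.ReflTransGen (TrackStep c) (minOf c D, ω) (maxOf c S, ω')
  then h.choose else ω

/-- The induced orientation `ω(S, D)` on `S`, where `S_max ≤ D_min` and `D` is oriented by `ω`. -/
def inducedOrientation (c : Corolla) (S D : Finset (Finset ℕ)) (ω : Orientation) : Orientation :=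
  contract (trackedOrientation c S D ω) (xiOrientation c (maxOf c S)) S

/-! ## Grafting and cutting

Grafting `c'` to the leaf `a` of `c` replaces the leaf `a` by the leaves of `c'`. If `a` is the left
thick leaf of an inner product diagram, then the numbering is rotated, so that it starts again
with the left thick leaf. -/

/-- The rotation of the numbering. -/
def rotation : Corolla → ℕ → Corolla → ℕ
  | .I _ _, 0, .M j _ => j
  | _, _, _ => 0

/-- The new position of the leaf `p ≠ a` of `c`; `N` is the new number of leaves, `l` the number of
leaves of `c'`, and `r` the rotation. -/
def outerPos (N l a r p : ℕ) : ℕ := ((if p < a then p else p + l - 1) + N - r) % N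

/-- The new position of the leaf `b` of `c'`. -/
def innerPos (N a r b : ℕ) : ℕ := (a + b + N - r) % N

/-- The position in `c` of the leaf at the new position `x`, where all leaves of `c'` go to `a`. -/
def collapsePos (N l a r x : ℕ) : ℕ :=
  let y := (x + r) % N
  if y < a then y else if y < a + l then a else y - (l - 1)

namespace Corolla

/-- The thick leaf of a module tree, the right thick leaf of an inner product diagram. -/
def lastThick : Corolla → ℕ
  | T _ => 0
  | M j _ => j
  | I k _ => k + 1

/-- The corolla of the same kind as `c` with `N` leaves and with `lastThick` equal to `t`. -/
def resize : Corolla → ℕ → ℕ → Corolla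
  | T _, N, _ => T N
  | M _ _, N, t => M t (N - 1 - t)
  | I _ _, N, t => I (t - 1) (N - 1 - t)

/-- The corolla to which the diagram contracts that is obtained by grafting `c'` to the leaf `a`
of `c`. -/
def graft (c : Corolla) (a : ℕ) (c' : Corolla) : Corolla :=
  let N := c.leaves + c'.leaves - 1
  let r := rotation c a c'
  c.resize N (if a = c.lastThick then innerPos N a r c'.lastThick
    else outerPos N c'.leaves a r c.lastThick)

end Corolla

/-- An edge of `c`, as an edge after grafting `c'` to the leaf `a`. -/
def outerEdge (c : Corolla) (a : ℕ) (c' : Corolla) (d : Finset ℕ) : Finset ℕ :=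
  let N := c.leaves + c'.leaves - 1
  (Finset.range N).filter fun x => collapsePos N c'.leaves a (rotation c a c') x ∈ d

/-- An edge of `c'`, as an edge after grafting `c'` to the leaf `a` of `c`. -/
def innerEdge (c : Corolla) (a : ℕ) (c' : Corolla) (d : Finset ℕ) : Finset ℕ :=
  d.image (innerPos (c.leaves + c'.leaves - 1) a (rotation c a c'))

/-- The new edge that is created by grafting `c'` to the leaf `a` of `c`. -/
def newEdge (c : Corolla) (a : ℕ) (c' : Corolla) : Finset ℕ :=
  innerEdge c a c' (Finset.range c'.leaves)

/-- The edges of the graft of a diagram `E` over `c'` to the leaf `a` of a diagram `D` over `c`. -/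
def graftEdges (c : Corolla) (D : Finset (Finset ℕ)) (a : ℕ) (c' : Corolla)
    (E : Finset (Finset ℕ)) : Finset (Finset ℕ) :=
  insert (newEdge c a c') (D.image (outerEdge c a c') ∪ E.image (innerEdge c a c'))

/-- A labeling of the leaves is given by the list of the positions of the leaves with the
labels `1, 2, …` (so the entry with index `i` belongs to the label `i + 1`). This is the labeling
of a composition at the entry with index `i`. -/
def graftLabels (c : Corolla) (f : List ℕ) (i : ℕ) (c' : Corolla) (f' : List ℕ) : List ℕ :=
  let N := c.leaves + c'.leaves - 1
  let a := f.getD i 0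
  let r := rotation c a c'
  (f.take i).map (outerPos N c'.leaves a r) ++ f'.map (innerPos N a r) ++
    (f.drop (i + 1)).map (outerPos N c'.leaves a r)

/-- The first leaf, in the clockwise order, that is cut off by the edge `e`. -/
def firstLeaf (c : Corolla) (e : Finset ℕ) : ℕ :=
  (e.filter fun x => (x + c.leaves - 1) % c.leaves ∉ e).sup id

/-- `e` cuts off the left thick leaf of an inner product diagram. -/
def CutsLeft : Corolla → Finset ℕ → Prop
  | .I _ _, e => 0 ∈ e
  | _, _ => False

instance (c : Corolla) (e : Finset ℕ) : Decidable (CutsLeft c e) := by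
  cases c <;> unfold CutsLeft <;> infer_instance

/-- The rotation that belongs to cutting along `e`. -/
def cutRotation (c : Corolla) (e : Finset ℕ) : ℕ :=
  if CutsLeft c e then (c.leaves - firstLeaf c e) % c.leaves else 0

/-- The leaf of the outer part that is created by cutting along `e`. -/
def cutLeaf (c : Corolla) (e : Finset ℕ) : ℕ :=
  if CutsLeft c e then 0 else firstLeaf c e

/-- Positions of leaves, seen on the outer part. -/
def cutOuterPos (c : Corolla) (e : Finset ℕ) (x : ℕ) : ℕ :=
  collapsePos c.leaves e.card (cutLeaf c e) (cutRotation c e) x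

/-- Positions of leaves, seen on the inner part. -/
def cutInnerPos (c : Corolla) (e : Finset ℕ) (x : ℕ) : ℕ :=
  (x + c.leaves - firstLeaf c e) % c.leaves

/-- The corolla of the outer part. -/
def cutOuter (c : Corolla) (e : Finset ℕ) : Corolla :=
  c.resize (c.leaves + 1 - e.card) (cutOuterPos c e c.lastThick)

/-- The corolla of the inner part: a module tree if the edge `e` is thick, a tree otherwise. -/
def cutInner (c : Corolla) (e : Finset ℕ) : Corolla :=
  if c.thickLeaves ∩ e = ∅ then .T e.card
  else
    let t := cutInnerPos c e ((c.thickLeaves ∩ e).sup id)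
    .M t (e.card - 1 - t)

/-- The edges of the outer part of `D`. -/
def outerPart (c : Corolla) (D : Finset (Finset ℕ)) (e : Finset ℕ) : Finset (Finset ℕ) :=
  (D.filter fun d => ¬ d ⊆ e).image fun d => d.image (cutOuterPos c e)

/-- The edges of the inner part of `D`. -/
def innerPart (c : Corolla) (D : Finset (Finset ℕ)) (e : Finset ℕ) : Finset (Finset ℕ) :=
  (D.filter fun d => d ⊂ e).image fun d => d.image (cutInnerPos c e)

/-- An innermost edge of a nonempty set of edges. -/
def innermost (D : Finset (Finset ℕ)) (h : D.Nonempty) : Finset ℕ :=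
  (D.exists_min_image code h).choose

theorem innermost_mem (D : Finset (Finset ℕ)) (h : D.Nonempty) : innermost D h ∈ D :=
  (D.exists_min_image code h).choose_spec.1

theorem card_outerPart_lt (c : Corolla) (D : Finset (Finset ℕ)) (e : Finset ℕ) (he : e ∈ D) :
    (outerPart c D e).card < D.card := by
  refine lt_of_le_of_lt Finset.card_image_le (Finset.card_lt_card ?_)
  refine Finset.filter_ssubset.2 ⟨e, he, ?_⟩
  simp

/-- The canonical (clockwise) labeling. -/
def canonical (c : Corolla) : List ℕ := List.range c.leaves

/-- The labeling `f ∘ σ`. -/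
def composeLabels (f σ : List ℕ) : List ℕ := σ.map fun j => f.getD j 0

/-- The inverse of a permutation. -/
def inversePerm (f : List ℕ) : List ℕ := (List.range f.length).map fun x => f.idxOf x

/-- The sign of a permutation. -/
def permSign (σ : List ℕ) : ℤˣ := inversionSign id σ

/-! ## The operad `C` -/

/-- A diagram with labeled leaves. -/
structure CGen where
  c : Corolla
  valid : c.Valid
  D : Finset (Finset ℕ)
  isDiagram : IsDiagram c D
  f : List ℕ
  isLabeling : f.Perm (List.range c.leaves)

/-- The module underlying the operad `C`. It is generated by the units (one for each color) and by
the oriented labeled diagrams `(D, f, ω)` modulo `(D, f, -ω) = -(D, f, ω)`, so it is free, with one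
basis vector for each unit and each labeled diagram; the basis vector of a labeled diagram is
`(D, f, ω)` where `ω` is the product of the edges in the reference order. -/
abbrev CA (R : Type*) [CommRing R] := (Color ⊕ CGen) →₀ R

open Classical in
/-- The generator `(D, f, ω)` of `C`. -/
def mkC (R : Type*) [CommRing R] (c : Corolla) (D : Finset (Finset ℕ)) (f : List ℕ)
    (ω : Orientation) : CA R :=
  if h : c.Valid ∧ IsDiagram c D ∧ f.Perm (List.range c.leaves) then
    ω.sign • Finsupp.single (Sum.inr ⟨c, h.1, D, h.2.1, f, h.2.2⟩) 1
  else 0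

open Classical in
/-- The action `σ · (D, f, ω) = sgn(σ) (D, f ∘ σ, ω)`. It is zero on components whose number of
leaves is not the number of letters of `σ`. -/
def actC (R : Type*) [CommRing R] (σ : List ℕ) : CA R →ₗ[R] CA R :=
  Finsupp.linearCombination R fun
    | .inl y => if σ = [0] then Finsupp.single (.inl y) 1 else 0
    | .inr x =>
      if σ.Perm (List.range x.c.leaves) then
        permSign σ • mkC R x.c x.D (composeLabels x.f σ) (refOrientation x.D)
      else 0

open Classical in
/-- The operadic composition of generators at the input with index `i` (that is, at the input
`i + 1` when inputs are counted from `1`):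
`(D, f, ω) ∘ (E, f', ω') = (-1)^((i+1)(l+1) + k |E|) (D ∘ E, f_{D ∘ E}, ω ∧ ω' ∧ e)`, where `D` has
`k` leaves, `E` has `l` leaves, and `e` is the new edge. -/
def compGenC (R : Type*) [CommRing R] (i : ℕ) : Color ⊕ CGen → Color ⊕ CGen → CA R
  | .inl y, .inl y' => if i = 0 ∧ y = y' then Finsupp.single (.inl y) 1 else 0
  | .inl y, .inr x' => if i = 0 ∧ y = x'.c.rootColor then Finsupp.single (.inr x') 1 else 0
  | .inr x, .inl y' =>
    if i < x.c.leaves ∧ x.c.leafColor (x.f.getD i 0) = y' then Finsupp.single (.inr x) 1 else 0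
  | .inr x, .inr x' =>
    let a := x.f.getD i 0
    if i < x.c.leaves ∧ x.c.leafColor a = x'.c.rootColor then
      ((-1 : ℤˣ) ^ (((i : ℤ) + 1) * (x'.c.leaves + 1) + x.c.leaves * degree x'.c x'.D)) •
        mkC R (x.c.graft a x'.c) (graftEdges x.c x.D a x'.c x'.D)
          (graftLabels x.c x.f i x'.c x'.f)
          ((((refOrientation x.D).rename (outerEdge x.c a x'.c)).wedge
            ((refOrientation x'.D).rename (innerEdge x.c a x'.c))).wedge
            (1, [newEdge x.c a x'.c]))
    else 0

/-- The operadic composition of `C` at the input with index `i`. -/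
def compC (R : Type*) [CommRing R] (i : ℕ) : CA R →ₗ[R] CA R →ₗ[R] CA R :=
  Finsupp.linearCombination R fun x => Finsupp.linearCombination R fun y => compGenC R i x y

/-! ## The operad `Q` -/

/-- A diagram with labeled leaves and with a set `N` of non-metric edges. -/
structure QGen where
  c : Corolla
  valid : c.Valid
  D : Finset (Finset ℕ)
  isDiagram : IsDiagram c D
  N : Finset (Finset ℕ)
  subset : N ⊆ D
  f : List ℕ
  isLabeling : f.Perm (List.range c.leaves)

/-- The module underlying the operad `Q`, generated by the units and by the labeled diagrams
`(D, f, g, ω)` modulo `(D, f, g, -ω) = -(D, f, g, ω)`. Here `g` is given by the set `N` of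
non-metric edges, and `ω` is an orientation of the set `D \ N` of metric edges. The basis vector of
a diagram is `(D, f, g, ω)` with `ω` the product of the metric edges in the reference order. -/
abbrev QA (R : Type*) [CommRing R] := (Color ⊕ QGen) →₀ R

open Classical in
/-- The generator `(D, f, g, ω)` of `Q`. -/
def mkQ (R : Type*) [CommRing R] (c : Corolla) (D N : Finset (Finset ℕ)) (f : List ℕ)
    (ω : Orientation) : QA R :=
  if h : c.Valid ∧ IsDiagram c D ∧ N ⊆ D ∧ f.Perm (List.range c.leaves) then
    ω.sign • Finsupp.single (Sum.inr ⟨c, h.1, D, h.2.1, N, h.2.2.1, f, h.2.2.2⟩) 1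
  else 0

open Classical in
/-- The action `σ · (D, f, g, ω) = (D, f ∘ σ, g, ω)`. -/
def actQ (R : Type*) [CommRing R] (σ : List ℕ) : QA R →ₗ[R] QA R :=
  Finsupp.linearCombination R fun
    | .inl y => if σ = [0] then Finsupp.single (.inl y) 1 else 0
    | .inr x =>
      if σ.Perm (List.range x.c.leaves) then
        mkQ R x.c x.D x.N (composeLabels x.f σ) (refOrientation (x.D \ x.N))
      else 0

open Classical in
/-- The operadic composition of generators at the input with index `i`; the new edge is
non-metric, and the orientation is `ω ∧ ω'`. -/
def compGenQ (R : Type*) [CommRing R] (i : ℕ) : Color ⊕ QGen → Color ⊕ QGen → QA R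
  | .inl y, .inl y' => if i = 0 ∧ y = y' then Finsupp.single (.inl y) 1 else 0
  | .inl y, .inr x' => if i = 0 ∧ y = x'.c.rootColor then Finsupp.single (.inr x') 1 else 0
  | .inr x, .inl y' =>
    if i < x.c.leaves ∧ x.c.leafColor (x.f.getD i 0) = y' then Finsupp.single (.inr x) 1 else 0
  | .inr x, .inr x' =>
    let a := x.f.getD i 0
    if i < x.c.leaves ∧ x.c.leafColor a = x'.c.rootColor then
      mkQ R (x.c.graft a x'.c) (graftEdges x.c x.D a x'.c x'.D)
        (graftEdges x.c x.N a x'.c x'.N) (graftLabels x.c x.f i x'.c x'.f)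
        (((refOrientation (x.D \ x.N)).rename (outerEdge x.c a x'.c)).wedge
          ((refOrientation (x'.D \ x'.N)).rename (innerEdge x.c a x'.c)))
    else 0

/-- The operadic composition of `Q` at the input with index `i`. -/
def compQ (R : Type*) [CommRing R] (i : ℕ) : QA R →ₗ[R] QA R →ₗ[R] QA R :=
  Finsupp.linearCombination R fun x => Finsupp.linearCombination R fun y => compGenQ R i x y

/-! ## The map `q` -/

open Classical in
/-- The value of `q` on a corolla with the canonical labeling: the sum of all fully metric binary
diagrams with their standard orientations. -/
def qCorolla (R : Type*) [CommRing R] (c : Corolla) : QA R :=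
  ∑ B ∈ (diagrams c).filter (IsBinary c), mkQ R c B ∅ (canonical c) (stdOrientation c B)

/-- The permutation `σ` that turns the labeling of the composition, at the leaf `cutLeaf c e`, of
the canonically labeled outer and inner parts into the canonical labeling. -/
def cutPerm (c : Corolla) (e : Finset ℕ) : List ℕ :=
  inversePerm (graftLabels (cutOuter c e) (canonical (cutOuter c e)) (cutLeaf c e)
    (cutInner c e) (canonical (cutInner c e)))

/-- The value of `q` on a diagram `(D, ω)` with the canonical labeling. An edge `e` is chosen such
that the inner part is a corolla. If `ω = ± ω' ∧ e`, then `(D, ω)` is, up to the sign of the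
composition and the sign of `σ`, equal to `σ · ((outer part, ω') ∘ corolla)`, and `q` respects
compositions and the action of permutations. -/
def qDiagram (R : Type*) [CommRing R] (c : Corolla) (D : Finset (Finset ℕ)) (ω : Orientation) :
    QA R :=
  if h : D.Nonempty then
    let e := innermost D h
    let w := ω.2.erase e
    (ω.sign * inversionSign code (w ++ [e]) * permSign (cutPerm c e) *
        (-1) ^ (((cutLeaf c e : ℤ) + 1) * ((cutInner c e).leaves + 1) +
          (cutOuter c e).leaves * degree (cutInner c e) ∅)) •
      actQ R (cutPerm c e)
        (compQ R (cutLeaf c e)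
          (qDiagram R (cutOuter c e) (outerPart c D e)
            (1, w.map fun d => d.image (cutOuterPos c e)))
          (qCorolla R (cutInner c e)))
  else ω.sign • qCorolla R c
termination_by D.card
decreasing_by exact card_outerPart_lt c D _ (innermost_mem D h)

/-- The map `q : C → Q`. It is the identity on units; a general labeling is reduced to the
canonical one by `(D, f, ω) = sgn(f) f · (D, canonical, ω)`. -/
def q (R : Type*) [CommRing R] : CA R →ₗ[R] QA R :=
  Finsupp.linearCombination R fun
    | .inl y => Finsupp.single (.inl y) 1
    | .inr x => permSign x.f • actQ R x.f (qDiagram R x.c x.D (refOrientation x.D))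

/-! ## The map `p` -/

open Classical in
/-- The value of `p` on a fully metric diagram with the canonical labeling: the sum of all `S` of
degree `#D` with `S_max ≤ D_min`, with their induced orientations. -/
def pMetric (R : Type*) [CommRing R] (c : Corolla) (D : Finset (Finset ℕ)) (ω : Orientation) :
    CA R :=
  ∑ S ∈ (diagrams c).filter
      (fun S => degree c S = D.card ∧ Le c (maxOf c S) (minOf c D)),
    mkC R c S (canonical c) (inducedOrientation c S D ω)

/-- The value of `p` on a diagram `(D, g, ω)` with the canonical labeling, where `N` is the set of
non-metric edges. An edge `e` in `N` is chosen such that the inner part is fully metric. If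
`ω = ± ω' ∧ ω''`, where `ω'` and `ω''` are orientations of the outer and the inner part, then
`(D, g, ω)` is, up to this sign, equal to `σ · ((outer part, ω') ∘ (inner part, ω''))`, and
`p` respects compositions and the action of permutations. -/
def pDiagram (R : Type*) [CommRing R] (c : Corolla) (D N : Finset (Finset ℕ)) (ω : Orientation) :
    CA R :=
  if h : N.Nonempty then
    let e := innermost N h
    let w' := ω.2.filter fun d => ¬ d ⊆ e
    let w'' := ω.2.filter fun d => d ⊂ e
    (ω.sign * inversionSign code (w' ++ w'')) •
      actC R (cutPerm c e)
        (compC R (cutLeaf c e)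
          (pDiagram R (cutOuter c e) (outerPart c D e) (outerPart c N e)
            (1, w'.map fun d => d.image (cutOuterPos c e)))
          (pMetric R (cutInner c e) (innerPart c D e)
            (1, w''.map fun d => d.image (cutInnerPos c e))))
  else pMetric R c D ω
termination_by N.card
decreasing_by exact card_outerPart_lt c N _ (innermost_mem N h)

/-- The map `p : Q → C`. It is the identity on units; a general labeling is reduced to the
canonical one by `(D, f, g, ω) = f · (D, canonical, g, ω)`. -/
def p (R : Type*) [CommRing R] : QA R →ₗ[R] CA R :=
  Finsupp.linearCombination R fun
    | .inl y => Finsupp.single (.inl y) 1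
    | .inr x => actC R x.f (pDiagram R x.c x.D x.N (refOrientation (x.D \ x.N)))

/-! ## The diagonals -/

/-- For a list of edges `e₁, …, eₖ`: the number of pairs `i < j` such that `eᵢ ∈ X` and
`eⱼ ∉ X`. -/
def rho (X : Finset (Finset ℕ)) : List (Finset ℕ) → ℕ
  | [] => 0
  | e :: w => (if e ∈ X then w.countP fun d => d ∉ X else 0) + rho X w

/-- The diagonal of `Q` that is induced by the Serre diagonal of the cubes:
`(D, f, g, ω) ↦ ∑ (-1)^ρ(X) (D / X, …) ⊗ (D_X̄, …)`, where `X` runs through the sets of metric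
edges, and `X̄` is the complement of `X` in the set of metric edges. In `D / X` the edges in `X`
are contracted, in `D_X̄` those in `X̄` are made non-metric. -/
def deltaQ (R : Type*) [CommRing R] : QA R →ₗ[R] QA R ⊗[R] QA R :=
  Finsupp.linearCombination R fun
    | .inl y => Finsupp.single (.inl y) 1 ⊗ₜ[R] Finsupp.single (.inl y) 1
    | .inr x =>
      let ω := refOrientation (x.D \ x.N)
      ∑ X ∈ (x.D \ x.N).powerset,
        ((-1 : ℤˣ) ^ rho X ω.2) •
          (mkQ R x.c (x.D \ X) x.N x.f (ω.1, ω.2.filter fun d => d ∉ X) ⊗ₜ[R]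
            mkQ R x.c x.D (x.N ∪ ((x.D \ x.N) \ X)) x.f (1, ω.2.filter fun d => d ∈ X))

/-- The diagonal `Δ_C = (p ⊗ p) ∘ Δ_Q ∘ q`. -/
def deltaC (R : Type*) [CommRing R] : CA R →ₗ[R] CA R ⊗[R] CA R :=
  TensorProduct.map (p R) (p R) ∘ₗ deltaQ R ∘ₗ q R

open Classical in
/-- The pairs of diagrams `(S, T)` over `c` with `|S| + |T| = k` and `S_max ≤ T_min`. -/
def matchingPairs (c : Corolla) (k : ℤ) : Finset (Finset (Finset ℕ) × Finset (Finset ℕ)) :=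
  (diagrams c ×ˢ diagrams c).filter fun x =>
    degree c x.1 + degree c x.2 = k ∧ Le c (maxOf c x.1) (minOf c x.2)

end Pairahedra

end

noncomputable section

namespace Pairahedra

/-! Up to sign, the image of the corolla `c` under `q` is the sum of all binary diagrams `B` over
`c`. The Serre diagonal splits each of them into the terms (`T` fully metric) ⊗ (`B` with `T`
non-metric and the rest metric), where `T` runs through the subsets of `B`. So the diagonal is a
double sum over `T ⊆ B`, and everything depends on the value of `p` on the right factor.

Since `p` is multiplicative, this value is a composition of values of `p` on fully metric binary
diagrams, one for each vertex of `T`. On a fully metric binary diagram over a corolla with `n`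
leaves, `p` sums over diagrams `S` of degree `n - 2`. Only the corolla itself has this degree, and
its maximum is the greatest binary diagram. Hence `p` gives plus or minus the corolla on the
greatest binary diagram and vanishes on all others (`pMetric_of_isBinary`). So for each `T` exactly
one `B` survives, namely `T` with every vertex refined by its greatest binary diagram, and the right
factor becomes `± T` (`exists_pDiagram_eq`). The left factor is by definition the signed sum of the
`S` with `|S| = #T` and `S_max ≤ T_min`, and `|S| = #T` means `|S| + |T| = k`.

The combinatorial input is twofold. One part is the existence of a greatest binary diagram
(`IsBinary.le_topDiagram`, `not_move_topDiagram`). It is made of combs, the intervals that run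
clockwise from a thin leaf to the next thick leaf or to the last leaf, and upward moves create the
combs of any binary diagram one at a time (`IsBinary.exists_le_mem`). The other part is that cutting
along an edge and grafting are mutually inverse (`IsDiagram.cut`, `IsEdge.graft_isDiagram`).

The extrema `maxOf c S` and `minOf c T` of general diagrams never have to be computed, because they
enter both sides through the same condition. Likewise the signs are free, so orientations are
carried along only as unspecified units. -/

/-! ### Clockwise arcs and edges -/

/-- Under the bound on `s + l` an arc wraps around at most once. Membership is then a disjunction of
linear inequalities, a form in which `omega` can compare arcs. -/
theorem mem_arc {n s l x : ℕ} (h : s + l ≤ 2 * n) :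
    x ∈ arc n s l ↔ x < n ∧ (s ≤ x ∧ x < s + l ∨ s ≤ x + n ∧ x + n < s + l) := by
  simp only [arc, Finset.mem_image, Finset.mem_range]
  constructor
  · rintro ⟨i, hi, rfl⟩
    have hn : 0 < n := by omega
    refine ⟨Nat.mod_lt _ hn, ?_⟩
    rcases lt_or_ge (s + i) n with h' | h'
    · rw [Nat.mod_eq_of_lt h']; omega
    · rw [Nat.mod_eq_sub_mod h', Nat.mod_eq_of_lt (by omega)]; omega
  · rintro ⟨hx, h' | h'⟩
    · exact ⟨x - s, by omega, by rw [Nat.add_sub_cancel' h'.1, Nat.mod_eq_of_lt hx]⟩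
    · exact ⟨x + n - s, by omega, by
        rw [Nat.add_sub_cancel' h'.1, Nat.add_mod_right, Nat.mod_eq_of_lt hx]⟩

theorem card_arc {n s l : ℕ} (h : l ≤ n) : (arc n s l).card = l := by
  rw [arc, Finset.card_image_of_injOn, Finset.card_range]
  intro i hi j hj hij
  simp only [Finset.coe_range, Set.mem_Iio] at hi hj
  have h1 : i ≡ j [MOD n] := Nat.ModEq.add_left_cancel' s hij
  rwa [Nat.ModEq, Nat.mod_eq_of_lt (by omega), Nat.mod_eq_of_lt (by omega)] at h1

theorem arc_subset_range {n s l : ℕ} (h : s + l ≤ 2 * n) : arc n s l ⊆ Finset.range n := by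
  intro x hx
  exact Finset.mem_range.2 ((mem_arc h).1 hx).1

/-- An edge never contains both the leaf `0` and this leaf. -/
def Corolla.opposite : Corolla → ℕ
  | .T n => n - 1
  | .M j k => j + k
  | .I k _ => k + 1

/-- An arc with fewer than `n` leaves passes the end of the numbering exactly when it contains both
the first and the last leaf. So the linear condition for trees and module trees takes the form of
the condition on the two thick leaves of an inner product diagram, and the three kinds of corollas
can be treated together. -/
theorem isEdge_iff {c : Corolla} {e : Finset ℕ} :
    IsEdge c e ↔ ∃ s l : ℕ, s < c.leaves ∧ 2 ≤ l ∧ l < c.leaves ∧ e = arc c.leaves s l ∧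
      ¬ (0 ∈ e ∧ c.opposite ∈ e) := by
  unfold IsEdge
  refine exists_congr fun s => exists_congr fun l => and_congr_right fun h1 =>
    and_congr_right fun h2 => and_congr_right fun h3 => and_congr_right fun h4 => ?_
  subst h4
  cases c with
  | T n =>
    simp only [Corolla.leaves, Corolla.opposite] at *
    rw [mem_arc (by omega), mem_arc (by omega)]
    omega
  | M j k =>
    simp only [Corolla.leaves, Corolla.opposite] at *
    rw [mem_arc (by omega), mem_arc (by omega)]
    omega
  | I k l => rfl

theorem IsEdge.subset_range {c : Corolla} {e : Finset ℕ} (h : IsEdge c e) :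
    e ⊆ Finset.range c.leaves := by
  obtain ⟨s, l, h1, h2, h3, rfl, -⟩ := h
  exact arc_subset_range (by omega)

theorem IsEdge.two_le_card {c : Corolla} {e : Finset ℕ} (h : IsEdge c e) : 2 ≤ e.card := by
  obtain ⟨s, l, h1, h2, h3, rfl, -⟩ := h
  rwa [card_arc (by omega)]

theorem IsEdge.card_lt {c : Corolla} {e : Finset ℕ} (h : IsEdge c e) : e.card < c.leaves := by
  obtain ⟨s, l, h1, h2, h3, rfl, -⟩ := h
  rwa [card_arc (by omega)]

/-! ### Laminar families and the maximality of binary diagrams -/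

/-- The members of `F` are pairwise nested or disjoint. -/
def Laminar {α : Type*} (F : Finset (Finset α)) : Prop :=
  ∀ e ∈ F, ∀ e' ∈ F, e ⊆ e' ∨ e' ⊆ e ∨ Disjoint e e'

/-- Induction: a smallest member `e` is discarded and one of its points `x` is deleted from all
other sets. Every other member contains `e` properly or misses both `x` and a second point `y` of
`e`, so the deletion identifies no two members and leaves at least two points in each. -/
theorem Laminar.card_lt {α : Type*} [DecidableEq α] {F : Finset (Finset α)} (hF : Laminar F)
    {W : Finset α} (hW : ∀ e ∈ F, e ⊆ W) (h2 : ∀ e ∈ F, 2 ≤ e.card) (h0 : W.Nonempty) :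
    F.card < W.card := by
  induction hk : F.card generalizing F W with
  | zero => exact h0.card_pos
  | succ k ih =>
    obtain ⟨e, he, hmin⟩ := F.exists_min_image Finset.card (Finset.card_pos.1 (by omega))
    obtain ⟨x, hx, y, hy, hxy⟩ := Finset.one_lt_card.1 (h2 e he)
    have key : ∀ d ∈ F.erase e, (x ∉ d ∧ y ∉ d) ∨ e ⊂ d := by
      intro d hd
      obtain ⟨hne, hd⟩ := Finset.mem_erase.1 hd
      rcases hF d hd e he with h | h | h
      · exact absurd (Finset.eq_of_subset_of_card_le h (hmin d hd)) hne
      · exact Or.inr (h.ssubset_of_ne hne.symm)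
      · exact Or.inl ⟨Finset.disjoint_right.1 h hx, Finset.disjoint_right.1 h hy⟩
    -- Whether `x` belongs to a member can be read off from `y`, which is not deleted.
    have hinj : Set.InjOn (fun d : Finset α => d.erase x) (F.erase e) := by
      intro d hd d' hd' hdd
      have hyd : y ∈ d ↔ y ∈ d' := by
        have := congrArg (y ∈ ·) hdd
        simpa [hxy.symm] using this
      have hxd : x ∈ d ↔ x ∈ d' := by
        rcases key d hd with h | h <;> rcases key d' hd' with h' | h'
        · simp [h.1, h'.1]
        · exact absurd (hyd.2 (h'.1 hy)) h.2
        · exact absurd (hyd.1 (h.1 hy)) h'.2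
        · simp [h.1 hx, h'.1 hx]
      ext z
      by_cases hz : z = x
      · rw [hz, hxd]
      · have := congrArg (z ∈ ·) hdd
        simpa [hz] using this
    have := @ih ((F.erase e).image fun d => d.erase x) ?_ (W.erase x) ?_ ?_ ?_ ?_
    · rw [Finset.card_erase_of_mem (hW e he hx)] at this
      omega
    · intro d hd d' hd'
      obtain ⟨d, hdF, rfl⟩ := Finset.mem_image.1 hd
      obtain ⟨d', hdF', rfl⟩ := Finset.mem_image.1 hd'
      rcases hF d (Finset.mem_of_mem_erase hdF) d' (Finset.mem_of_mem_erase hdF') with h | h | h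
      · exact Or.inl (Finset.erase_subset_erase x h)
      · exact Or.inr (Or.inl (Finset.erase_subset_erase x h))
      · exact Or.inr (Or.inr (h.mono (Finset.erase_subset _ _) (Finset.erase_subset _ _)))
    · intro d hd
      obtain ⟨d, hdF, rfl⟩ := Finset.mem_image.1 hd
      exact Finset.erase_subset_erase x (hW d (Finset.mem_of_mem_erase hdF))
    · intro d hd
      obtain ⟨d, hdF, rfl⟩ := Finset.mem_image.1 hd
      rcases key d hdF with h | h
      · rw [Finset.erase_eq_of_notMem h.1]
        exact h2 d (Finset.mem_of_mem_erase hdF)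
      · have := Finset.card_lt_card h
        have := Finset.card_erase_of_mem (h.1 hx)
        have := h2 e he
        omega
    · exact ⟨y, Finset.mem_erase.2 ⟨hxy.symm, hW e he hy⟩⟩
    · rw [Finset.card_image_of_injOn hinj, Finset.card_erase_of_mem he]
      omega

theorem Corolla.Valid.two_le_leaves {c : Corolla} (hc : c.Valid) : 2 ≤ c.leaves := by
  cases c <;> simp only [Corolla.Valid, Corolla.leaves] at * <;> omega

/-- The edges of a diagram, together with the set of all leaves and the single leaves. -/
def clades (c : Corolla) (B : Finset (Finset ℕ)) : Finset (Finset ℕ) :=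
  B ∪ insert (Finset.range c.leaves) ((Finset.range c.leaves).image fun x => {x})

theorem mem_clades {c : Corolla} {B : Finset (Finset ℕ)} {d : Finset ℕ} :
    d ∈ clades c B ↔ d ∈ B ∨ d = Finset.range c.leaves ∨ ∃ x < c.leaves, d = {x} := by
  simp only [clades, Finset.mem_union, Finset.mem_insert, Finset.mem_image, Finset.mem_range,
    eq_comm]

theorem IsDiagram.subset_range {c : Corolla} {B : Finset (Finset ℕ)} (hB : IsDiagram c B)
    {d : Finset ℕ} (hd : d ∈ clades c B) : d ⊆ Finset.range c.leaves := by
  rcases mem_clades.1 hd with h | h | ⟨x, hx, rfl⟩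
  · exact (hB.1 d h).subset_range
  · exact h.subset
  · simpa using hx

theorem IsDiagram.laminar_clades {c : Corolla} {B : Finset (Finset ℕ)} (hB : IsDiagram c B) :
    Laminar (clades c B) := by
  intro d hd d' hd'
  have h1 := hB.subset_range hd
  have h2 := hB.subset_range hd'
  rcases mem_clades.1 hd with h | rfl | ⟨x, hx, rfl⟩
  · rcases mem_clades.1 hd' with h' | rfl | ⟨x, hx, rfl⟩
    · exact hB.2 d h d' h'
    · exact Or.inl h1
    · by_cases hxd : x ∈ d
      · exact Or.inr (Or.inl (by simpa using hxd))
      · exact Or.inr (Or.inr (by simpa using hxd))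
  · exact Or.inr (Or.inl h2)
  · by_cases hxd : x ∈ d'
    · exact Or.inl (by simpa using hxd)
    · exact Or.inr (Or.inr (by simpa using hxd))

theorem range_notMem {c : Corolla} {B : Finset (Finset ℕ)} (hB : IsDiagram c B) :
    Finset.range c.leaves ∉ B := by
  intro h
  simpa using (hB.1 _ h).card_lt

/-- A family of pairwise nested or disjoint sets of at least two, but not all, of `n` leaves has
at most `n - 2` members. -/
theorem card_add_two_le {n : ℕ} (hn : 1 ≤ n) {B : Finset (Finset ℕ)} (hB : Laminar B)
    (h : ∀ e ∈ B, e ⊆ Finset.range n ∧ 2 ≤ e.card ∧ e.card < n) :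
    B.card + 1 < n ∨ n = 1 ∧ B = ∅ := by
  rcases Nat.lt_or_ge n 2 with h1 | h1
  · refine Or.inr ⟨by omega, Finset.eq_empty_of_forall_notMem fun e he => ?_⟩
    have := h e he
    omega
  have hW : Finset.range n ∉ B := fun hW => by simpa using (h _ hW).2.2
  have := @Laminar.card_lt ℕ _ (insert (Finset.range n) B) ?_ (Finset.range n) ?_ ?_ ?_
  · rw [Finset.card_insert_of_notMem hW, Finset.card_range] at this
    exact Or.inl this
  · intro d hd d' hd'
    rcases Finset.mem_insert.1 hd with rfl | hd <;> rcases Finset.mem_insert.1 hd' with rfl | hd'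
    · simp
    · exact Or.inr (Or.inl (h _ hd').1)
    · exact Or.inl (h _ hd).1
    · exact hB d hd d' hd'
  · intro d hd
    rcases Finset.mem_insert.1 hd with rfl | hd
    · exact subset_rfl
    · exact (h _ hd).1
  · intro d hd
    rcases Finset.mem_insert.1 hd with rfl | hd
    · simpa using h1
    · exact (h _ hd).2.1
  · exact ⟨0, by simp; omega⟩

theorem IsDiagram.card_add_two_le {c : Corolla} (hc : c.Valid) {B : Finset (Finset ℕ)}
    (hB : IsDiagram c B) : B.card + 2 ≤ c.leaves := by
  have := hc.two_le_leaves
  have := Pairahedra.card_add_two_le (n := c.leaves) (by omega) hB.2 fun e he =>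
    ⟨(hB.1 e he).subset_range, (hB.1 e he).two_le_card, (hB.1 e he).card_lt⟩
  omega

theorem isBinary_iff {c : Corolla} {B : Finset (Finset ℕ)} :
    IsBinary c B ↔ IsDiagram c B ∧ B.card + 2 = c.leaves := by
  unfold IsBinary degree
  refine and_congr_right fun _ => ?_
  omega

/-- A binary diagram attains the bound for laminar families, so no compatible set can be added. The
bound holds for arbitrary sets, hence `d` need not be an arc; this is what makes the lemma
applicable to complements. -/
theorem IsBinary.mem_of_compatible {c : Corolla} (hc : c.Valid) {B : Finset (Finset ℕ)}
    (hB : IsBinary c B) {d : Finset ℕ} (hd : d ⊆ Finset.range c.leaves) (h0 : d.Nonempty)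
    (h : ∀ e ∈ B, e ⊆ d ∨ d ⊆ e ∨ Disjoint e d) : d ∈ clades c B := by
  by_contra hcon
  rw [mem_clades] at hcon
  push Not at hcon
  obtain ⟨h1, h2, h3⟩ := hcon
  have hBd := isBinary_iff.1 hB
  have hcard : 2 ≤ d.card := by
    by_contra hlt
    obtain ⟨x, rfl⟩ := Finset.card_eq_one.1 (by have := h0.card_pos; omega : d.card = 1)
    exact h3 x (by simpa using hd) rfl
  have hlt : d.card < c.leaves := by
    simpa using Finset.card_lt_card (hd.ssubset_of_ne h2)
  have hn := hc.two_le_leaves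
  have := Pairahedra.card_add_two_le (n := c.leaves) (B := insert d B) (by omega) ?_ ?_
  · rw [Finset.card_insert_of_notMem h1] at this
    omega
  · intro e he e' he'
    rcases Finset.mem_insert.1 he with ha | ha <;> rcases Finset.mem_insert.1 he' with hb | hb
    · simp [ha, hb]
    · subst ha
      rcases h e' hb with h | h | h
      · exact Or.inr (Or.inl h)
      · exact Or.inl h
      · exact Or.inr (Or.inr h.symm)
    · subst hb
      exact h e ha
    · exact hB.1.2 e ha e' hb
  · intro e he
    rcases Finset.mem_insert.1 he with rfl | he
    · exact ⟨hd, hcard, hlt⟩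
    · exact ⟨(hB.1.1 e he).subset_range, (hB.1.1 e he).two_le_card, (hB.1.1 e he).card_lt⟩

/-- In a binary diagram, the complement of a child is a child. -/
theorem IsBinary.sdiff_mem {c : Corolla} (hc : c.Valid) {B : Finset (Finset ℕ)}
    (hB : IsBinary c B) {A P : Finset ℕ} (hA : A ∈ clades c B) (hP : P ∈ clades c B) (hPA : P ⊂ A)
    (hmax : ∀ d ∈ clades c B, P ⊂ d → ¬ d ⊂ A) :
    A \ P ∈ clades c B ∧ ∀ d ∈ clades c B, d ⊂ A → d ⊆ P ∨ d ⊆ A \ P := by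
  have key : ∀ d ∈ clades c B, d ⊂ A → d ⊆ P ∨ d ⊆ A \ P := by
    intro d hd hdA
    rcases hB.1.laminar_clades d hd P hP with h | h | h
    · exact Or.inl h
    · rcases h.eq_or_ssubset with rfl | h
      · exact Or.inl subset_rfl
      · exact absurd hdA (hmax d hd h)
    · exact Or.inr (Finset.subset_sdiff.2 ⟨hdA.1, h⟩)
  refine ⟨?_, key⟩
  refine hB.mem_of_compatible hc (Finset.sdiff_subset.trans (hB.1.subset_range hA))
    (Finset.sdiff_nonempty.2 hPA.2) fun e he => ?_
  have he' : e ∈ clades c B := mem_clades.2 (Or.inl he)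
  rcases hB.1.laminar_clades e he' A hA with h | h | h
  · rcases h.eq_or_ssubset with rfl | h
    · exact Or.inr (Or.inl Finset.sdiff_subset)
    · rcases key e he' h with h | h
      · exact Or.inr (Or.inr (Finset.disjoint_sdiff.mono_left h))
      · exact Or.inl h
  · exact Or.inr (Or.inl (Finset.sdiff_subset.trans h))
  · exact Or.inr (Or.inr (h.mono_right Finset.sdiff_subset))

/-- In a binary diagram, every clade with at least two leaves splits into two clades. -/
theorem IsBinary.exists_split {c : Corolla} (hc : c.Valid) {B : Finset (Finset ℕ)}
    (hB : IsBinary c B) {A : Finset ℕ} (hA : A ∈ clades c B) (h2 : 2 ≤ A.card) {x : ℕ}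
    (hx : x ∈ A) :
    ∃ P ∈ clades c B, x ∈ P ∧ P ⊂ A ∧ A \ P ∈ clades c B ∧
      ∀ d ∈ clades c B, d ⊂ A → d ⊆ P ∨ d ⊆ A \ P := by
  have hne : ((clades c B).filter fun d => x ∈ d ∧ d ⊂ A).Nonempty := by
    refine ⟨{x}, Finset.mem_filter.2 ⟨mem_clades.2 (Or.inr (Or.inr ⟨x, ?_, rfl⟩)), by simp, ?_⟩⟩
    · simpa using hB.1.subset_range hA hx
    · refine (Finset.singleton_subset_iff.2 hx).ssubset_of_ne fun h => ?_
      rw [← h] at h2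
      simp at h2
  obtain ⟨P, hP, hmax⟩ := Finset.exists_max_image _ Finset.card hne
  obtain ⟨hP, hxP, hPA⟩ := Finset.mem_filter.1 hP
  refine ⟨P, hP, hxP, hPA, hB.sdiff_mem hc hA hP hPA fun d hd hPd hdA => ?_⟩
  have := hmax d (Finset.mem_filter.2 ⟨hd, hPd.1 hxP, hdA⟩)
  exact absurd (Finset.card_lt_card hPd) (by omega)

/-- There is a least clade that contains a given nonempty set of leaves. -/
theorem IsDiagram.exists_least {c : Corolla} {B : Finset (Finset ℕ)} (hB : IsDiagram c B)
    {t : Finset ℕ} (ht : t ⊆ Finset.range c.leaves) (h0 : t.Nonempty) :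
    ∃ A ∈ clades c B, t ⊆ A ∧ ∀ d ∈ clades c B, t ⊆ d → A ⊆ d := by
  obtain ⟨A, hA, hmin⟩ := Finset.exists_min_image ((clades c B).filter (t ⊆ ·)) Finset.card
    ⟨Finset.range c.leaves, by simp [mem_clades, ht]⟩
  obtain ⟨hA, htA⟩ := Finset.mem_filter.1 hA
  refine ⟨A, hA, htA, fun d hd htd => ?_⟩
  rcases hB.laminar_clades A hA d hd with h | h | h
  · exact h
  · exact (Finset.eq_of_subset_of_card_le h (hmin d (Finset.mem_filter.2 ⟨hd, htd⟩))).ge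
  · obtain ⟨x, hx⟩ := h0
    exact absurd (htd hx) (Finset.disjoint_left.1 h (htA hx))

theorem IsDiagram.exists_arc {c : Corolla} (hc : c.Valid) {B : Finset (Finset ℕ)}
    (hB : IsDiagram c B) {d : Finset ℕ} (hd : d ∈ clades c B) :
    ∃ s l, s < c.leaves ∧ 1 ≤ l ∧ l ≤ c.leaves ∧ d = arc c.leaves s l := by
  have := hc.two_le_leaves
  rcases mem_clades.1 hd with h | rfl | ⟨x, hx, rfl⟩
  · obtain ⟨s, l, h1, h2, h3, h4, -⟩ := hB.1 d h
    exact ⟨s, l, h1, by omega, by omega, h4⟩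
  · refine ⟨0, c.leaves, by omega, by omega, le_rfl, ?_⟩
    ext y
    rw [mem_arc (by omega), Finset.mem_range]
    omega
  · refine ⟨x, 1, hx, le_rfl, by omega, ?_⟩
    ext y
    rw [mem_arc (by omega), Finset.mem_singleton]
    omega

theorem IsDiagram.isEdge_or {c : Corolla} {B : Finset (Finset ℕ)} (hB : IsDiagram c B)
    {d : Finset ℕ} (hd : d ∈ clades c B) :
    d = Finset.range c.leaves ∨ IsEdge c d ∧ d ∈ B ∨ ∃ x < c.leaves, d = {x} := by
  rcases mem_clades.1 hd with h | h | h
  · exact Or.inr (Or.inl ⟨hB.1 d h, h⟩)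
  · exact Or.inl h
  · exact Or.inr (Or.inr h)

/-! ### Neighboring branches and local moves -/

/-- The leaf that follows the leaf `i` in the clockwise order. -/
def next (n i : ℕ) : ℕ := if i + 1 = n then 0 else i + 1

theorem arc_end {n s l i : ℕ} (hs : s < n) (hl : l ≤ n) (h : i ∈ arc n s l)
    (h' : next n i ∉ arc n s l) : s + l = i + 1 ∨ s + l = i + 1 + n := by
  rw [mem_arc (by omega)] at h h'
  unfold next at h'
  split_ifs at h' <;> omega

theorem arc_start {n s l i : ℕ} (hs : s < n) (hl : l ≤ n) (h : i ∉ arc n s l)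
    (h' : next n i ∈ arc n s l) : s = next n i := by
  rw [mem_arc (by omega)] at h h'
  unfold next at h' ⊢
  split_ifs at h' ⊢ <;> omega

theorem arc_union {n s l s' l' : ℕ} (hs : s < n) (hs' : s' < n) (hl : l + l' ≤ n)
    (h : s + l = s' ∨ s + l = s' + n) : arc n s l ∪ arc n s' l' = arc n s (l + l') := by
  ext x
  rw [Finset.mem_union, mem_arc (by omega), mem_arc (by omega), mem_arc (by omega)]
  omega

/-- The moved edge is `X ∪ Y`, with `Y` its final part of `l₂` leaves and `X` the remaining `l - l₂`
leaves. The three alternatives in `he` reconcile starting points below `c.leaves` with those in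
`LocalMove`, which may run beyond it. -/
theorem localMove_right {c : Corolla} {s l s₂ l₂ s' l' : ℕ} (hs : s < c.leaves)
    (hs₂ : s₂ < c.leaves) (hs' : s' < c.leaves) (h₂ : 0 < l₂) (hl₂ : l₂ < l) (hl' : 0 < l')
    (hl : l + l' ≤ c.leaves) (he : s + l = s₂ + l₂ ∨ s + l + c.leaves = s₂ + l₂ ∨
      s + l = s₂ + l₂ + c.leaves) (hn : s + l = s' ∨ s + l = s' + c.leaves)
    (ht : Disjoint (arc c.leaves s₂ l₂) c.thickLeaves) :
    LocalMove c (arc c.leaves s l) (arc c.leaves s₂ l₂ ∪ arc c.leaves s' l') := by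
  have hY : arc c.leaves (s + (l - l₂)) l₂ = arc c.leaves s₂ l₂ := by
    ext x
    rw [mem_arc (by omega), mem_arc (by omega)]
    omega
  refine ⟨s, l - l₂, l₂, l', by omega, h₂, hl', hs, by omega, Or.inl ?_⟩
  rw [hY]
  refine ⟨ht, ?_, ?_⟩
  · ext x
    rw [Finset.mem_union, mem_arc (by omega), mem_arc (by omega), mem_arc (by omega)]
    omega
  · congr 1
    ext x
    rw [mem_arc (by omega), mem_arc (by omega)]
    omega

/-- The counterpart with a thick middle branch: `Y` is the initial part of the moved edge `Y ∪ Z`,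
and `X` is the arc just before it. -/
theorem localMove_left {c : Corolla} {s l l₁ s' l' : ℕ} (hs : s < c.leaves)
    (hs' : s' < c.leaves) (h₁ : 0 < l₁) (hl₁ : l₁ < l) (hl' : 0 < l')
    (hl : l + l' ≤ c.leaves) (hn : s' + l' = s ∨ s' + l' = s + c.leaves)
    (ht : ¬ Disjoint (arc c.leaves s l₁) c.thickLeaves) :
    LocalMove c (arc c.leaves s l) (arc c.leaves s l₁ ∪ arc c.leaves s' l') := by
  have hY : arc c.leaves (s' + l') l₁ = arc c.leaves s l₁ := by
    ext x
    rw [mem_arc (by omega), mem_arc (by omega)]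
    omega
  refine ⟨s', l', l₁, l - l₁, hl', h₁, by omega, hs', by omega, Or.inr ?_⟩
  rw [hY]
  refine ⟨ht, ?_, Finset.union_comm _ _⟩
  ext x
  rw [Finset.mem_union, mem_arc (by omega), mem_arc (by omega), mem_arc (by omega)]
  omega

/-- Below `A` there are the three branches `P'`, `P \ P'` and `A \ P`, of which `P` joins the first
two. Any other edge lies in one of these branches, contains `A`, or is disjoint from `A`; so it is
compatible with the edge that joins `P'` to `A \ P` instead. -/
theorem IsBinary.flip {c : Corolla} {B : Finset (Finset ℕ)} (hB : IsBinary c B)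
    {A P P' : Finset ℕ} (hP : P ∈ B) (hPA : P ⊂ A)
    (hA : ∀ d ∈ clades c B, d ⊂ A → d ⊆ P ∨ d ⊆ A \ P) (hAc : A ∈ clades c B) (h0 : P'.Nonempty)
    (hP' : P' ⊂ P) (hPs : ∀ d ∈ clades c B, d ⊂ P → d ⊆ P' ∨ d ⊆ P \ P')
    (he : IsEdge c (P' ∪ (A \ P))) :
    P' ∪ (A \ P) ∉ B ∧ IsBinary c (insert (P' ∪ (A \ P)) (B.erase P)) := by
  obtain ⟨x, hx⟩ := h0
  obtain ⟨y, hy, hy'⟩ := Finset.exists_of_ssubset hP'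
  obtain ⟨z, hz, hz'⟩ := Finset.exists_of_ssubset hPA
  have hnot : P' ∪ (A \ P) ∉ B := by
    intro h
    rcases hB.1.2 _ h P hP with h | h | h
    · exact hz' (h (by simp [hz, hz']))
    · have := h hy
      simp [hy, hy'] at this
    · exact Finset.disjoint_left.1 h (Finset.mem_union_left _ hx) (hP'.1 hx)
  refine ⟨hnot, isBinary_iff.2 ⟨⟨?_, ?_⟩, ?_⟩⟩
  · intro e h
    rcases Finset.mem_insert.1 h with rfl | h
    · exact he
    · exact hB.1.1 e (Finset.mem_of_mem_erase h)
  · have key : ∀ e ∈ B.erase P, e ⊆ P' ∪ (A \ P) ∨ P' ∪ (A \ P) ⊆ e ∨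
        Disjoint e (P' ∪ (A \ P)) := by
      intro e h
      obtain ⟨hne, h⟩ := Finset.mem_erase.1 h
      have h' : e ∈ clades c B := mem_clades.2 (Or.inl h)
      have hsub : P' ∪ (A \ P) ⊆ A :=
        Finset.union_subset (hP'.1.trans hPA.1) Finset.sdiff_subset
      rcases hB.1.laminar_clades e h' A hAc with hh | hh | hh
      · rcases hh.eq_or_ssubset with rfl | hh
        · exact Or.inr (Or.inl hsub)
        · rcases hA e h' hh with hh | hh
          · rcases hPs e h' (hh.ssubset_of_ne hne) with hh' | hh'
            · exact Or.inl (hh'.trans Finset.subset_union_left)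
            · refine Or.inr (Or.inr (Finset.disjoint_union_right.2 ⟨?_, ?_⟩))
              · exact Finset.sdiff_disjoint.mono_left hh'
              · exact Finset.disjoint_sdiff.mono_left hh
          · exact Or.inl (hh.trans Finset.subset_union_right)
      · exact Or.inr (Or.inl (hsub.trans hh))
      · exact Or.inr (Or.inr (hh.mono_right hsub))
    intro e h e' h'
    rcases Finset.mem_insert.1 h with ha | ha <;> rcases Finset.mem_insert.1 h' with hb | hb
    · simp [ha, hb]
    · rw [ha]
      rcases key e' hb with hh | hh | hh
      · exact Or.inr (Or.inl hh)
      · exact Or.inl hh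
      · exact Or.inr (Or.inr hh.symm)
    · rw [hb]
      exact key e ha
    · exact hB.1.2 e (Finset.mem_of_mem_erase ha) e' (Finset.mem_of_mem_erase hb)
  · rw [Finset.card_insert_of_notMem (fun h => hnot (Finset.mem_of_mem_erase h)),
      Finset.card_erase_of_mem hP]
    have := (isBinary_iff.1 hB).2
    have := Finset.card_pos.2 ⟨P, hP⟩
    omega

theorem move_of_flip {c : Corolla} {B : Finset (Finset ℕ)} (hB : IsBinary c B) {e e' : Finset ℕ}
    (he : e ∈ B) (he' : e' ∉ B) (hB' : IsBinary c (insert e' (B.erase e)))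
    (h : LocalMove c e e') : Move c B e (insert e' (B.erase e)) e' :=
  ⟨hB, hB', he, Finset.mem_insert_self _ _,
    by rw [Finset.erase_insert fun h => he' (Finset.mem_of_mem_erase h)], h⟩

/-- Provides the two arguments by which a new edge is seen not to contain both `0` and `c.opposite`:
by position if the opposite leaf is the last one, by color otherwise. -/
theorem opposite_cases (c : Corolla) :
    c.opposite = c.leaves - 1 ∨ 0 ∈ c.thickLeaves ∧ c.opposite ∈ c.thickLeaves := by
  cases c <;> simp [Corolla.opposite, Corolla.leaves, Corolla.thickLeaves]

theorem opposite_lt {c : Corolla} (hc : c.Valid) : c.opposite < c.leaves ∧ 0 < c.opposite := by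
  cases c <;> simp only [Corolla.opposite, Corolla.leaves, Corolla.Valid] at * <;> omega

theorem IsDiagram.not_both {c : Corolla} {B : Finset (Finset ℕ)} (hB : IsDiagram c B)
    (hc : c.Valid) {d : Finset ℕ} (hd : d ∈ clades c B) (hne : d ≠ Finset.range c.leaves) :
    ¬ (0 ∈ d ∧ c.opposite ∈ d) := by
  rcases hB.isEdge_or hd with h | ⟨h, -⟩ | ⟨x, hx, rfl⟩
  · exact absurd h hne
  · obtain ⟨s, l, -, -, -, -, h⟩ := isEdge_iff.1 h
    exact h
  · have := opposite_lt hc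
    simp only [Finset.mem_singleton]
    omega

theorem card_add_card_le {n : ℕ} {A P : Finset ℕ} (hA : A ⊆ Finset.range n) (hP : P ⊆ A) :
    P.card + (A \ P).card ≤ n := by
  rw [add_comm, Finset.card_sdiff_add_card_eq_card hP]
  simpa using Finset.card_le_card hA

theorem IsDiagram.mem_of_two_le {c : Corolla} {B : Finset (Finset ℕ)} (hB : IsDiagram c B)
    {P A : Finset ℕ} (hP : P ∈ clades c B) (hA : A ∈ clades c B) (hPA : P ⊂ A)
    (h2 : 2 ≤ P.card) : P ∈ B := by
  rcases mem_clades.1 hP with h | rfl | ⟨x, hx, rfl⟩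
  · exact h
  · exact absurd (hB.subset_range hA) hPA.2
  · simp at h2

/-- A branch that ends at the leaf `i` and its neighbor `A \ P` are rearranged. -/
theorem IsBinary.move_right {c : Corolla} {B : Finset (Finset ℕ)} (hB : IsBinary c B)
    (hc : c.Valid) {i : ℕ} (hin : c.opposite = c.leaves - 1 → i + 1 < c.leaves)
    {A P P' : Finset ℕ} (hA : A ∈ clades c B) (hP : P ∈ B) (hPA : P ⊂ A)
    (hQ : A \ P ∈ clades c B) (hAs : ∀ d ∈ clades c B, d ⊂ A → d ⊆ P ∨ d ⊆ A \ P)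
    (hP'c : P' ∈ clades c B) (hP' : P' ⊂ P)
    (hPs : ∀ d ∈ clades c B, d ⊂ P → d ⊆ P' ∨ d ⊆ P \ P')
    (hi : i ∈ P') (hi' : next c.leaves i ∈ A \ P) (ht : Disjoint P' c.thickLeaves) :
    P' ∪ (A \ P) ∉ B ∧
      Move c B P (insert (P' ∪ (A \ P)) (B.erase P)) (P' ∪ (A \ P)) := by
  have hopp := opposite_lt hc
  have hPc : P ∈ clades c B := mem_clades.2 (Or.inl hP)
  have hcard := card_add_card_le (hB.1.subset_range hA) hPA.1
  have hlt := Finset.card_lt_card hP'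
  have hPW : P ≠ Finset.range c.leaves := by
    rintro rfl
    exact hPA.2 (hB.1.subset_range hA)
  have hQW : A \ P ≠ Finset.range c.leaves := by
    intro h
    have := h.ge (hB.1.subset_range hPc (hP'.1 hi))
    exact (Finset.mem_sdiff.1 this).2 (hP'.1 hi)
  have hPb := hB.1.not_both hc hPc hPW
  have hQb := hB.1.not_both hc hQ hQW
  have hiQ : i ∉ A \ P := fun h => (Finset.mem_sdiff.1 h).2 (hP'.1 hi)
  have hiP : next c.leaves i ∉ P := (Finset.mem_sdiff.1 hi').2
  have hiP' : next c.leaves i ∉ P' := fun h => hiP (hP'.1 h)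
  have hin' : i < c.leaves := by simpa using hB.1.subset_range hP'c hi
  obtain ⟨s, l, hs, hl, hl', hPe⟩ := hB.1.exists_arc hc hPc
  obtain ⟨s₂, l₂, hs₂, hl₂, hl₂', hP'e⟩ := hB.1.exists_arc hc hP'c
  obtain ⟨s', l', hs', hlq, hlq', hQe⟩ := hB.1.exists_arc hc hQ
  have hiP0 := hP'.1 hi
  have hQstart : s' = next c.leaves i := arc_start hs' hlq' (hQe ▸ hiQ) (hQe ▸ hi')
  have hPend := arc_end hs hl' (hPe ▸ hiP0) (hPe ▸ hiP)
  have hP'end := arc_end hs₂ hl₂' (hP'e ▸ hi) (hP'e ▸ hiP')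
  rw [hQe, hPe, card_arc hl', card_arc hlq'] at hcard
  rw [hP'e, hPe, card_arc hl', card_arc hl₂'] at hlt
  have hnext : s + l = s' ∨ s + l = s' + c.leaves := by
    rw [hQstart]; unfold next; split_ifs <;> omega
  have hnext₂ : s₂ + l₂ = s' ∨ s₂ + l₂ = s' + c.leaves := by
    rw [hQstart]; unfold next; split_ifs <;> omega
  have hU : P' ∪ (A \ P) = arc c.leaves s₂ (l₂ + l') := by
    rw [hQe, hP'e]
    exact arc_union hs₂ hs' (by omega) hnext₂
  have hedge : IsEdge c (P' ∪ (A \ P)) := by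
    refine isEdge_iff.2 ⟨s₂, l₂ + l', hs₂, by omega, by omega, hU, ?_⟩
    -- If the opposite leaf is the last one, neither part passes the end of the numbering, and the
    -- two parts meet between `i` and `i + 1`, so neither does the union. Otherwise both leaves are
    -- thick, and as `P'` is thin they would both lie in `A \ P`.
    rintro ⟨h0, h1⟩
    rcases opposite_cases c with hlin | ⟨h0t, h1t⟩
    · have hin := hin hlin
      rw [hlin] at h1 hopp hPb hQb
      rw [hU, mem_arc (by omega)] at h0 h1
      rw [hPe, mem_arc (by omega), mem_arc (by omega)] at hPb
      rw [hQe, mem_arc (by omega), mem_arc (by omega)] at hQb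
      unfold next at hQstart
      split_ifs at hQstart <;> omega
    · have h0' := (Finset.mem_union.1 h0).resolve_left fun h => Finset.disjoint_left.1 ht h h0t
      have h1' := (Finset.mem_union.1 h1).resolve_left fun h => Finset.disjoint_left.1 ht h h1t
      exact hQb ⟨h0', h1'⟩
  obtain ⟨hnot, hB'⟩ := hB.flip hP hPA hAs hA ⟨i, hi⟩ hP' hPs hedge
  refine ⟨hnot, move_of_flip hB hP hnot hB' ?_⟩
  rw [hQe, hP'e, hPe]
  rw [hP'e] at ht
  exact localMove_right hs hs₂ hs' (by omega) hlt (by omega) hcard (by omega) hnext ht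

/-- A branch whose first part `P'` is thick and the branch `A \ P` before it are rearranged. -/
theorem IsBinary.move_left {c : Corolla} {B : Finset (Finset ℕ)} (hB : IsBinary c B)
    (hc : c.Valid) {i : ℕ} {A P P' : Finset ℕ} (hA : A ∈ clades c B) (hP : P ∈ B) (hPA : P ⊂ A)
    (hQ : A \ P ∈ clades c B) (hAs : ∀ d ∈ clades c B, d ⊂ A → d ⊆ P ∨ d ⊆ A \ P)
    (hP'c : P' ∈ clades c B) (hP' : P' ⊂ P)
    (hPs : ∀ d ∈ clades c B, d ⊂ P → d ⊆ P' ∨ d ⊆ P \ P')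
    (hi : i ∈ A \ P) (hi' : next c.leaves i ∈ P') (ht : ¬ Disjoint P' c.thickLeaves)
    (hnb : ¬ (0 ∈ P' ∪ (A \ P) ∧ c.opposite ∈ P' ∪ (A \ P))) :
    P' ∪ (A \ P) ∉ B ∧
      Move c B P (insert (P' ∪ (A \ P)) (B.erase P)) (P' ∪ (A \ P)) := by
  have hPc : P ∈ clades c B := mem_clades.2 (Or.inl hP)
  have hcard := card_add_card_le (hB.1.subset_range hA) hPA.1
  have hlt := Finset.card_lt_card hP'
  have hiP : i ∉ P := (Finset.mem_sdiff.1 hi).2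
  have hiP' : i ∉ P' := fun h => hiP (hP'.1 h)
  have hi'P := hP'.1 hi'
  have hi'Q : next c.leaves i ∉ A \ P := fun h => (Finset.mem_sdiff.1 h).2 hi'P
  have hin' : i < c.leaves := by simpa using hB.1.subset_range hQ hi
  obtain ⟨s, l, hs, hl, hl', hPe⟩ := hB.1.exists_arc hc hPc
  obtain ⟨s₂, l₂, hs₂, hl₂, hl₂', hP'e⟩ := hB.1.exists_arc hc hP'c
  obtain ⟨s', l', hs', hlq, hlq', hQe⟩ := hB.1.exists_arc hc hQ
  have hPstart : s = next c.leaves i := arc_start hs hl' (hPe ▸ hiP) (hPe ▸ hi'P)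
  have hP'start : s₂ = next c.leaves i := arc_start hs₂ hl₂' (hP'e ▸ hiP') (hP'e ▸ hi')
  have hQend := arc_end hs' hlq' (hQe ▸ hi) (hQe ▸ hi'Q)
  rw [hQe, hPe, card_arc hl', card_arc hlq'] at hcard
  rw [hP'e, hPe, card_arc hl', card_arc hl₂'] at hlt
  obtain rfl : s = s₂ := by omega
  have hnext : s' + l' = s ∨ s' + l' = s + c.leaves := by
    rw [hPstart]; unfold next; split_ifs <;> omega
  have hedge : IsEdge c (P' ∪ (A \ P)) := by
    refine isEdge_iff.2 ⟨s', l' + l₂, hs', by omega, by omega, ?_, hnb⟩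
    rw [hQe, hP'e, Finset.union_comm]
    exact arc_union hs' hs (by omega) hnext
  obtain ⟨hnot, hB'⟩ := hB.flip hP hPA hAs hA ⟨_, hi'⟩ hP' hPs hedge
  refine ⟨hnot, move_of_flip hB hP hnot hB' ?_⟩
  rw [hQe, hP'e, hPe]
  rw [hP'e] at ht
  exact localMove_left hs hs' (by omega) hlt (by omega) hcard hnext ht

theorem mem_clades_move {c : Corolla} {B : Finset (Finset ℕ)} {d e e' : Finset ℕ}
    (hd : d ∈ clades c B) (hne : d ≠ e) : d ∈ clades c (insert e' (B.erase e)) := by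
  rcases mem_clades.1 hd with h | h
  · exact mem_clades.2 (Or.inl (Finset.mem_insert_of_mem (Finset.mem_erase.2 ⟨hne, h⟩)))
  · exact mem_clades.2 (Or.inr h)

/-! ### Upward moves that create a prescribed edge -/

/-- If the edge `insert i V` is missing in `B`, then there is an upward move towards a diagram that
contains it. -/
theorem IsBinary.exists_move {c : Corolla} (hc : c.Valid) {i : ℕ} {V : Finset ℕ}
    (hiV : i ∉ V) (hi'V : next c.leaves i ∈ V) (ht : IsEdge c (insert i V))
    (hit : i ∉ c.thickLeaves)
    (huniq : ∀ x ∈ c.thickLeaves, ∀ y ∈ c.thickLeaves, x ∉ V → y ∉ V → x = y)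
    (hV : (∃ x ∈ V, x ∈ c.thickLeaves) ∨ c.opposite = c.leaves - 1 ∧ c.opposite ∈ V)
    {B : Finset (Finset ℕ)} (hB : IsBinary c B) (hVB : V ∈ clades c B) (htB : insert i V ∉ B)
    {A : Finset ℕ} (hA : A ∈ clades c B) (htA : insert i V ⊆ A)
    (hmin : ∀ d ∈ clades c B, insert i V ⊆ d → A ⊆ d) {m : ℕ}
    (hm : ∀ D ∈ clades c B, i ∈ D → (∃ x ∈ D, x ∈ c.thickLeaves ∧ x ∉ V) →
      c.leaves ≤ D.card + m) :
    ∃ e e' : Finset ℕ, e' ∉ B ∧ Move c B e (insert e' (B.erase e)) e' ∧ (i ∈ e ∨ V ⊂ e) ∧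
      ((insert i V ⊆ e' ∧ e'.card < A.card) ∨
        (A ≠ e ∧ 0 < m ∧ ∀ D ∈ clades c (insert e' (B.erase e)), i ∈ D →
          (∃ x ∈ D, x ∈ c.thickLeaves ∧ x ∉ V) → c.leaves + 1 ≤ D.card + m)) := by
  have hopp := opposite_lt hc
  have hin : i < c.leaves := by simpa using ht.subset_range (Finset.mem_insert_self i V)
  have hi'n : next c.leaves i < c.leaves := by
    simpa using ht.subset_range (Finset.mem_insert_of_mem hi'V)
  have htnb : ¬ (0 ∈ insert i V ∧ c.opposite ∈ insert i V) := by
    obtain ⟨_, _, -, -, -, -, h⟩ := isEdge_iff.1 ht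
    exact h
  have hlin : c.opposite = c.leaves - 1 → i + 1 < c.leaves := by
    intro h
    by_contra hcon
    have h1 : i + 1 = c.leaves := by omega
    rw [next, if_pos h1] at hi'V
    refine htnb ⟨Finset.mem_insert_of_mem hi'V, ?_⟩
    rw [h, show c.leaves - 1 = i by omega]
    exact Finset.mem_insert_self i V
  have htne : insert i V ∉ clades c B := by
    rw [mem_clades]
    rintro (h | h | ⟨x, hx, h⟩)
    · exact htB h
    · have := ht.card_lt
      rw [h] at this
      simp at this
    · have := ht.two_le_card
      rw [h] at this
      simp at this
  have hV0 : V.Nonempty := ⟨_, hi'V⟩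
  have htA' : insert i V ⊂ A := htA.ssubset_of_ne fun h => htne (h ▸ hA)
  have hiA : i ∈ A := htA (Finset.mem_insert_self i V)
  have hVA : V ⊂ A := (Finset.subset_insert i V).trans_ssubset htA'
  have hA2 : 2 ≤ A.card := by
    have := Finset.card_lt_card htA'
    have := ht.two_le_card
    omega
  -- By minimality of `A` its two children separate `i` from `V`. If `P` is larger than `{i}`, the
  -- aim is to pass a thin branch of `P` containing `i` over to `A \ P`; a thick leaf in `P` may
  -- require preparation. If `P = {i}`, the superfluous part of `A \ P` is split off instead.
  obtain ⟨P, hP, hiP, hPA, hQ, hAs⟩ := hB.exists_split hc hA hA2 hiA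
  have hVQ : V ⊆ A \ P := by
    refine (hAs V hVB hVA).resolve_left fun h => hPA.2 (hmin P hP ?_)
    exact Finset.insert_subset hiP h
  have hi'Q := hVQ hi'V
  have hAn := hB.1.subset_range hA
  rcases Nat.lt_or_ge 1 P.card with hP2 | hP1
  · have hPB := hB.1.mem_of_two_le hP hA hPA hP2
    -- When the child `P'` of `P` at `i` is thin, it is joined to `A \ P`. The new edge contains `i`
    -- and `V` but misses `P \ P'`, so it is smaller than `A`.
    have goodR : ∀ P' ∈ clades c B, P' ⊂ P →
        (∀ d ∈ clades c B, d ⊂ P → d ⊆ P' ∨ d ⊆ P \ P') → i ∈ P' → Disjoint P' c.thickLeaves →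
        ∃ e e' : Finset ℕ, e' ∉ B ∧ Move c B e (insert e' (B.erase e)) e' ∧ (i ∈ e ∨ V ⊂ e) ∧
        ((insert i V ⊆ e' ∧ e'.card < A.card) ∨
        (A ≠ e ∧ 0 < m ∧ ∀ D ∈ clades c (insert e' (B.erase e)), i ∈ D →
          (∃ x ∈ D, x ∈ c.thickLeaves ∧ x ∉ V) → c.leaves + 1 ≤ D.card + m)) := by
      intro P' hP'c hP' hPs hiP' hthin
      obtain ⟨h1, h2⟩ := hB.move_right hc hlin hA hPB hPA hQ hAs hP'c hP' hPs hiP' hi'Q hthin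
      refine ⟨P, P' ∪ (A \ P), h1, h2, Or.inl hiP, Or.inl ⟨?_, ?_⟩⟩
      · exact Finset.insert_subset (Finset.mem_union_left _ hiP')
          (hVQ.trans Finset.subset_union_right)
      · refine Finset.card_lt_card ((Finset.ssubset_iff_of_subset (Finset.union_subset
          (hP'.1.trans hPA.1) Finset.sdiff_subset)).2 ?_)
        obtain ⟨x, hx, hx'⟩ := Finset.exists_of_ssubset hP'
        exact ⟨x, hPA.1 hx, by simp [hx, hx']⟩
    by_cases hthin : Disjoint P c.thickLeaves
    · obtain ⟨P', hP'c, hiP', hP', -, hPs⟩ := hB.exists_split hc hP hP2 hiP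
      exact goodR P' hP'c hP' hPs hiP' (hthin.mono_left hP'.1)
    · obtain ⟨κ, hκP, hκt⟩ := Finset.not_disjoint_iff.1 hthin
      have hκV : ∀ x ∈ P, x ∉ V := fun x hx h => (Finset.mem_sdiff.1 (hVQ h)).2 hx
      have hκuniq : ∀ x ∈ P, x ∈ c.thickLeaves → x = κ := fun x hx hxt =>
        huniq x hxt κ hκt (hκV x hx) (hκV κ hκP)
      have hκi : κ ≠ i := fun h => hit (h ▸ hκt)
      have hPn := hB.1.subset_range hP
      -- `κ` is the only thick leaf of `P`. It meets `i` in `D`, so the child `D₂` of `D` at `i`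
      -- does not contain `κ` and is thin.
      obtain ⟨D, hD, hκD, hDmin⟩ := hB.1.exists_least (t := {κ, i})
        (Finset.insert_subset (hPn hκP) (by simpa using hin)) (by simp)
      have hD2 : 2 ≤ D.card := by
        rw [← Finset.card_pair hκi]
        exact Finset.card_le_card hκD
      have hDP : D ⊆ P := hDmin P hP (Finset.insert_subset hκP (by simpa using hiP))
      have hiD : i ∈ D := hκD (by simp)
      obtain ⟨D₂, hD₂, hiD₂, hD₂D, hD₁, hDs⟩ := hB.exists_split hc hD hD2 hiD
      have hκD₂ : κ ∉ D₂ := fun h =>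
        hD₂D.2 (hDmin D₂ hD₂ (Finset.insert_subset h (by simpa using hiD₂)))
      have hD₂thin : Disjoint D₂ c.thickLeaves := by
        rw [Finset.disjoint_left]
        intro x hx hxt
        exact hκD₂ (hκuniq x (hDP (hD₂D.1 hx)) hxt ▸ hx)
      -- If `D = P`, the branch `D₂` can be passed over at once. Otherwise the thick branch `D \ D₂`
      -- is joined to the sibling of `D`. This leaves `A` unchanged but destroys the least clade
      -- that contains both `i` and `κ`, so the second measure `m` drops.
      rcases hDP.eq_or_ssubset with rfl | hDP
      · exact goodR D₂ hD₂ hD₂D hDs hiD₂ hD₂thin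
      · -- the least clade that is larger than `D`
        obtain ⟨D', hD', hDD'min⟩ := Finset.exists_min_image
          ((clades c B).filter fun d => D ⊂ d) Finset.card
          ⟨P, Finset.mem_filter.2 ⟨hP, hDP⟩⟩
        obtain ⟨hD', hDD'⟩ := Finset.mem_filter.1 hD'
        have hDmax : ∀ d ∈ clades c B, D ⊂ d → ¬ d ⊂ D' := fun d hd hDd hdD' => by
          have := hDD'min d (Finset.mem_filter.2 ⟨hd, hDd⟩)
          exact absurd (Finset.card_lt_card hdD') (by omega)
        have hD'P : D' ⊆ P := by
          rcases hB.1.laminar_clades D' hD' P hP with h | h | h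
          · exact h
          · rcases h.eq_or_ssubset with h | h
            · exact h.ge
            · exact absurd h (hDmax P hP hDP)
          · exact absurd (hDP.1 hiD) (Finset.disjoint_left.1 h (hDD'.1 hiD))
        obtain ⟨hE, hD's⟩ := hB.sdiff_mem hc hD' hD hDD' hDmax
        have hDB : D ∈ B := hB.1.mem_of_two_le hD hP hDP hD2
        have hPW : P ≠ Finset.range c.leaves := by
          rintro rfl
          exact hPA.2 hAn
        have hsub : (D \ D₂) ∪ (D' \ D) ⊆ P :=
          Finset.union_subset (Finset.sdiff_subset.trans hDP.1) (Finset.sdiff_subset.trans hD'P)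
        have hnb : ¬ (0 ∈ (D \ D₂) ∪ (D' \ D) ∧ c.opposite ∈ (D \ D₂) ∪ (D' \ D)) := fun h =>
          hB.1.not_both hc hP hPW ⟨hsub h.1, hsub h.2⟩
        -- the first leaf of `D` follows a leaf of `D' \ D`
        have hstart : ∃ j ∈ D' \ D, next c.leaves j ∈ D \ D₂ := by
          -- Each of `D₂`, `D`, `D'` contains `i` but not the next leaf, so all three end at `i`.
          -- Hence `D' \ D` comes immediately before `D`, and `D \ D₂` is the initial part of `D`.
          have hi'D' : next c.leaves i ∉ D' := fun h =>
            (Finset.mem_sdiff.1 hi'Q).2 (hD'P h)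
          have hi'D : next c.leaves i ∉ D := fun h => hi'D' (hDD'.1 h)
          have hi'D₂ : next c.leaves i ∉ D₂ := fun h => hi'D (hD₂D.1 h)
          have hlt := Finset.card_lt_card hDD'
          have hlt₂ := Finset.card_lt_card hD₂D
          have hlt' : D'.card < c.leaves := by
            have h := (hB.1.subset_range hD').ssubset_of_ne fun h => hPW
              (Finset.Subset.antisymm hPn (h ▸ hD'P))
            simpa using Finset.card_lt_card h
          obtain ⟨s, l, hs, hl, hl', hDe⟩ := hB.1.exists_arc hc hD
          obtain ⟨s₂, l₂, hs₂, hl₂, hl₂', hD₂e⟩ := hB.1.exists_arc hc hD₂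
          obtain ⟨s', l', hs', hlq, hlq', hD'e⟩ := hB.1.exists_arc hc hD'
          have h1 := arc_end hs hl' (hDe ▸ hiD) (hDe ▸ hi'D)
          have h2 := arc_end hs₂ hl₂' (hD₂e ▸ hiD₂) (hD₂e ▸ hi'D₂)
          have h3 := arc_end hs' hlq' (hD'e ▸ hDD'.1 hiD) (hD'e ▸ hi'D')
          rw [hDe, hD'e, card_arc hl', card_arc hlq'] at hlt
          rw [hDe, hD₂e, card_arc hl', card_arc hl₂'] at hlt₂
          rw [hD'e, card_arc hlq'] at hlt'
          refine ⟨if s = 0 then c.leaves - 1 else s - 1, ?_, ?_⟩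
          · rw [Finset.mem_sdiff, hDe, hD'e, mem_arc (by omega), mem_arc (by omega)]
            split_ifs <;> omega
          · have : next c.leaves (if s = 0 then c.leaves - 1 else s - 1) = s := by
              unfold next
              split_ifs <;> omega
            rw [this, Finset.mem_sdiff, hDe, hD₂e, mem_arc (by omega), mem_arc (by omega)]
            omega
        obtain ⟨j, hj, hj'⟩ := hstart
        have hκD₁ : κ ∈ D \ D₂ := Finset.mem_sdiff.2 ⟨hκD (by simp), hκD₂⟩
        obtain ⟨h1, h2⟩ := hB.move_left hc hD' hDB hDD' hE hD's hD₁
          (Finset.sdiff_ssubset hD₂D.1 ⟨i, hiD₂⟩)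
          (fun d hd hdD => by
            rw [Finset.sdiff_sdiff_eq_self hD₂D.1]
            exact (hDs d hd hdD).symm) hj hj'
          (Finset.not_disjoint_iff.2 ⟨κ, hκD₁, hκt⟩) hnb
        have hDlt : D.card < c.leaves := (hB.1.1 D hDB).card_lt
        have hDm := hm D hD hiD ⟨κ, hκD (by simp), hκt, hκV κ hκP⟩
        refine ⟨D, _, h1, h2, Or.inl hiD, Or.inr ⟨?_, by omega, ?_⟩⟩
        · rintro rfl
          exact hPA.2 hDP.1
        -- The new edge misses `i`, so `F` was a clade before the move, different from the replaced
        -- edge `D`. It contains `i` and `κ`, so it contains `D` properly.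
        · rintro F hF hiF ⟨x, hxF, hxt, hxV⟩
          have hx : x = κ := huniq x hxt κ hκt hxV (hκV κ hκP)
          subst hx
          have hF' : F ∈ clades c B ∧ F ≠ D := by
            rcases mem_clades.1 hF with h | h | ⟨y, hy, h⟩
            · rcases Finset.mem_insert.1 h with h | h
              · rw [h] at hiF
                simp [hiD, hiD₂] at hiF
              · exact ⟨mem_clades.2 (Or.inl (Finset.mem_of_mem_erase h)),
                  Finset.ne_of_mem_erase h⟩
            · refine ⟨mem_clades.2 (Or.inr (Or.inl h)), ?_⟩
              rintro rfl
              exact range_notMem hB.1 (h ▸ hDB)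
            · rw [h] at hxF hiF
              simp only [Finset.mem_singleton] at hxF hiF
              omega
          have hDF : D ⊂ F := (hDmin F hF'.1 (Finset.insert_subset hxF
            (by simpa using hiF))).ssubset_of_ne hF'.2.symm
          have := Finset.card_lt_card hDF
          omega
  · have hPi : P = {i} := by
      obtain ⟨x, rfl⟩ := Finset.card_eq_one.1 (le_antisymm hP1 (Finset.card_pos.2 ⟨i, hiP⟩))
      rw [Finset.mem_singleton.1 hiP]
    have hVQ' : V ⊂ A \ P := by
      refine hVQ.ssubset_of_ne fun h => htA'.2 ?_
      intro x hx
      by_cases hxi : x = i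
      · simp [hxi]
      · refine Finset.mem_insert_of_mem ?_
        rw [h, hPi]
        simp [hx, hxi]
    have hQ2 : 2 ≤ (A \ P).card := by
      have := Finset.card_lt_card hVQ'
      have := hV0.card_pos
      omega
    have hQA : A \ P ⊂ A := Finset.sdiff_ssubset hPA.1 ⟨i, hiP⟩
    have hQB := hB.1.mem_of_two_le hQ hA hQA hQ2
    obtain ⟨Q₁, hQ₁, hi'Q₁, hQ₁Q, hQ₂, hQs⟩ := hB.exists_split hc hQ hQ2 hi'Q
    have hVQ₁ : V ⊆ Q₁ := (hQs V hVB hVQ').resolve_right fun h =>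
      (Finset.mem_sdiff.1 (h hi'V)).2 hi'Q₁
    have hPQ : A \ (A \ P) = P := Finset.sdiff_sdiff_eq_self hPA.1
    have hQW : A \ P ≠ Finset.range c.leaves := by
      intro h
      have := h.ge (Finset.mem_range.2 hin)
      exact (Finset.mem_sdiff.1 this).2 hiP
    have hQnb := hB.1.not_both hc hQ hQW
    have hiQ : i ∉ A \ P := fun h => (Finset.mem_sdiff.1 h).2 hiP
    -- the position of `A \ P`
    obtain ⟨s, l, hs, hl, hl', hQe⟩ := hB.1.exists_arc hc hQ
    have hQstart := arc_start hs hl' (hQe ▸ hiQ) (hQe ▸ hi'Q)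
    -- If the opposite leaf were the last one and belonged to `V`, then `V` and `A \ P`, both
    -- starting right after `i` and unable to pass the end, would coincide.
    have hthick : ∃ x ∈ V, x ∈ c.thickLeaves := by
      refine hV.resolve_right ?_
      rintro ⟨h1, h2⟩
      have hi1 := hlin h1
      have hsl : l ≤ c.leaves - s := by
        have hQnb' := hQnb
        rw [hQe, mem_arc (by omega), mem_arc (by omega)] at hQnb'
        have h3 := hVQ h2
        rw [hQe, mem_arc (by omega)] at h3
        by_contra
        apply hQnb'
        omega
      refine hVQ'.2 fun x hx => ?_
      obtain ⟨s', l', hs', hlq, hlq', hVe⟩ := hB.1.exists_arc hc hVB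
      have hVstart := arc_start hs' hlq' (hVe ▸ hiV) (hVe ▸ hi'V)
      have hV0 : 0 ∉ V := fun h0 => htnb ⟨Finset.mem_insert_of_mem h0, Finset.mem_insert_of_mem h2⟩
      rw [hQe, mem_arc (by omega)] at hx
      rw [h1, hVe, mem_arc (by omega)] at h2
      rw [hVe, mem_arc (by omega)] at hV0 ⊢
      omega
    obtain ⟨x, hxV, hxt⟩ := hthick
    obtain ⟨s₁, l₁, hs₁, hl₁, hl₁', hQ₁e⟩ := hB.1.exists_arc hc hQ₁
    have hiQ₁ : i ∉ Q₁ := fun h => hiQ (hQ₁Q.1 h)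
    have hQ₁start := arc_start hs₁ hl₁' (hQ₁e ▸ hiQ₁) (hQ₁e ▸ hi'Q₁)
    have hnb : ¬ (0 ∈ Q₁ ∪ (A \ (A \ P)) ∧ c.opposite ∈ Q₁ ∪ (A \ (A \ P))) := by
      rw [hPQ, hPi, Finset.mem_union, Finset.mem_union, Finset.mem_singleton, Finset.mem_singleton]
      rintro ⟨h0, h1⟩
      rcases opposite_cases c with hl1 | ⟨h0t, h1t⟩
      · have hi1 := hlin hl1
        have hlt := Finset.card_lt_card hQ₁Q
        rw [hQe, hQ₁e, card_arc hl₁', card_arc hl'] at hlt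
        have hle := card_add_card_le hAn hPA.1
        rw [hPi, ← hPi, hQe, card_arc hl', hPi, Finset.card_singleton] at hle
        rw [hQ₁e, mem_arc (by omega)] at h0 h1
        rw [hQe, mem_arc (by omega), mem_arc (by omega)] at hQnb
        rw [next, if_neg (by omega)] at hQstart hQ₁start
        omega
      · have h0' := h0.resolve_right fun h => hit (h ▸ h0t)
        have h1' := h1.resolve_right fun h => hit (h ▸ h1t)
        exact hQnb ⟨hQ₁Q.1 h0', hQ₁Q.1 h1'⟩
    -- Here the clade to be replaced is `A \ P`, its thick initial part is `Q₁ ⊇ V`, and the branch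
    -- before it is `{i}`.
    obtain ⟨h1, h2⟩ := hB.move_left hc (i := i) hA hQB hQA (hPQ.symm ▸ hP)
      (fun d hd hdA => by rw [hPQ]; exact (hAs d hd hdA).symm) hQ₁ hQ₁Q hQs
      (by rw [hPQ]; exact hiP) hi'Q₁ (Finset.not_disjoint_iff.2 ⟨x, hVQ₁ hxV, hxt⟩) hnb
    refine ⟨_, _, h1, h2, Or.inr hVQ', Or.inl ⟨?_, ?_⟩⟩
    · rw [hPQ]
      exact Finset.insert_subset (Finset.mem_union_right _ hiP)
        (hVQ₁.trans Finset.subset_union_left)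
    · rw [hPQ]
      refine Finset.card_lt_card ((Finset.ssubset_iff_of_subset (Finset.union_subset
        (hQ₁Q.1.trans Finset.sdiff_subset) hPA.1)).2 ?_)
      obtain ⟨y, hy, hy'⟩ := Finset.exists_of_ssubset hQ₁Q
      exact ⟨y, Finset.sdiff_subset hy, by
        simp only [Finset.mem_union, hy', false_or]
        exact (Finset.mem_sdiff.1 hy).2⟩

/-- Upward moves lead to a diagram that contains the edge `insert i V`. -/
theorem IsBinary.exists_le_mem {c : Corolla} (hc : c.Valid) {i : ℕ} {V : Finset ℕ}
    (hiV : i ∉ V) (hi'V : next c.leaves i ∈ V) (ht : IsEdge c (insert i V))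
    (hit : i ∉ c.thickLeaves)
    (huniq : ∀ x ∈ c.thickLeaves, ∀ y ∈ c.thickLeaves, x ∉ V → y ∉ V → x = y)
    (hV : (∃ x ∈ V, x ∈ c.thickLeaves) ∨ c.opposite = c.leaves - 1 ∧ c.opposite ∈ V)
    {B : Finset (Finset ℕ)} (hB : IsBinary c B) (hVB : V ∈ clades c B) :
    ∃ B', Le c B B' ∧ IsBinary c B' ∧ insert i V ∈ B' ∧
      ∀ e ∈ B, i ∉ e → (e ⊆ V ∨ Disjoint e V) → e ∈ B' := by
  -- Lexicographic induction: `a` bounds the size of a clade containing `insert i V`, and `m` bounds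
  -- the number of leaves missing from any clade that contains `i` and a thick leaf outside `V`.
  -- When `a` drops, `m` is reset to the trivial bound `c.leaves`.
  have main : ∀ a m : ℕ, ∀ B, IsBinary c B → V ∈ clades c B →
      (∃ A ∈ clades c B, insert i V ⊆ A ∧ A.card ≤ a) →
      (∀ D ∈ clades c B, i ∈ D → (∃ x ∈ D, x ∈ c.thickLeaves ∧ x ∉ V) →
        c.leaves ≤ D.card + m) →
      ∃ B', Le c B B' ∧ IsBinary c B' ∧ insert i V ∈ B' ∧
        ∀ e ∈ B, i ∉ e → (e ⊆ V ∨ Disjoint e V) → e ∈ B' := by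
    intro a
    induction a with
    | zero =>
      rintro m B hB hVB ⟨A, hA, htA, hA0⟩
      have := Finset.card_le_card htA
      have := ht.two_le_card
      omega
    | succ a iha =>
      intro m
      induction m with
      | zero =>
        rintro B hB hVB ⟨A₀, hA₀, htA₀, hA₀a⟩ hm
        by_cases htB : insert i V ∈ B
        · exact ⟨B, Relation.ReflTransGen.refl, hB, htB, fun e he _ _ => he⟩
        obtain ⟨A, hA, htA, hmin⟩ := hB.1.exists_least ht.subset_range (by simp)
        have hAa := Finset.card_le_card (hmin A₀ hA₀ htA₀)
        obtain ⟨e, e', he', hmove, hkeep, hh | hh⟩ := hB.exists_move hc hiV hi'V ht hit huniq hV hVB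
          htB hA htA hmin hm
        -- The moved edge contains `i` or contains `V` properly, so the move destroys neither `V`
        -- nor an edge that has to be kept.
        · have hVe : V ≠ e := by
            rintro rfl
            rcases hkeep with h | h
            · exact hiV h
            · exact h.2 subset_rfl
          obtain ⟨B', h1, h2, h3, h4⟩ := iha c.leaves _ hmove.2.1 (mem_clades_move hVB hVe)
            ⟨e', mem_clades.2 (Or.inl (Finset.mem_insert_self _ _)), hh.1, by omega⟩
            (fun _ _ _ _ => by omega)
          refine ⟨B', Relation.ReflTransGen.head ⟨e, e', hmove⟩ h1, h2, h3, fun d hd hid hdV => ?_⟩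
          refine h4 d (Finset.mem_insert_of_mem (Finset.mem_erase.2 ⟨?_, hd⟩)) hid hdV
          rintro rfl
          rcases hkeep with h | h
          · exact hid h
          · rcases hdV with h' | h'
            · exact h.2 h'
            · exact Finset.disjoint_left.1 h' (h.1 hi'V) hi'V
        · omega
      | succ m ihm =>
        rintro B hB hVB ⟨A₀, hA₀, htA₀, hA₀a⟩ hm
        by_cases htB : insert i V ∈ B
        · exact ⟨B, Relation.ReflTransGen.refl, hB, htB, fun e he _ _ => he⟩
        obtain ⟨A, hA, htA, hmin⟩ := hB.1.exists_least ht.subset_range (by simp)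
        have hAa := Finset.card_le_card (hmin A₀ hA₀ htA₀)
        obtain ⟨e, e', he', hmove, hkeep, hh⟩ := hB.exists_move hc hiV hi'V ht hit huniq hV hVB
          htB hA htA hmin hm
        have hVe : V ≠ e := by
          rintro rfl
          rcases hkeep with h | h
          · exact hiV h
          · exact h.2 subset_rfl
        have hnext : ∃ B', Le c (insert e' (B.erase e)) B' ∧ IsBinary c B' ∧ insert i V ∈ B' ∧
            ∀ d ∈ insert e' (B.erase e), i ∉ d → (d ⊆ V ∨ Disjoint d V) → d ∈ B' := by
          rcases hh with hh | hh
          · exact iha c.leaves _ hmove.2.1 (mem_clades_move hVB hVe)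
              ⟨e', mem_clades.2 (Or.inl (Finset.mem_insert_self _ _)), hh.1, by omega⟩
              (fun _ _ _ _ => by omega)
          · exact ihm _ hmove.2.1 (mem_clades_move hVB hVe)
              ⟨A, mem_clades_move hA hh.1, htA, by omega⟩ fun D hD hiD hx => by
                have := hh.2.2 D hD hiD hx
                omega
        obtain ⟨B', h1, h2, h3, h4⟩ := hnext
        refine ⟨B', Relation.ReflTransGen.head ⟨e, e', hmove⟩ h1, h2, h3, fun d hd hid hdV => ?_⟩
        refine h4 d (Finset.mem_insert_of_mem (Finset.mem_erase.2 ⟨?_, hd⟩)) hid hdV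
        rintro rfl
        rcases hkeep with h | h
        · exact hid h
        · rcases hdV with h' | h'
          · exact h.2 h'
          · exact Finset.disjoint_left.1 h' (h.1 hi'V) hi'V
  exact main c.leaves c.leaves B hB hVB ⟨_, mem_clades.2 (Or.inr (Or.inl rfl)), ht.subset_range,
    by simp⟩ fun _ _ _ _ => by omega

/-! ### The greatest binary diagram -/

/-- The number of leaves of the clockwise interval from the leaf `i` to the next thick leaf, or to
the last leaf if there is no thick leaf before the root. -/
def combLen : Corolla → ℕ → ℕ
  | .T n, i => n - i
  | .M j k, i => if i ≤ j then j + 1 - i else j + 1 + k - i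
  -- Below the thick line the interval runs up to position `k + l + 1` and then wraps to the left
  -- thick leaf `0`, which counts as one more leaf.
  | .I k l, i => if i = 0 then 1 else if i ≤ k + 1 then k + 2 - i else k + l + 3 - i

/-- The clockwise interval from `i` to the next thick leaf, or to the last leaf if there is no
thick leaf before the root. -/
def comb (c : Corolla) (i : ℕ) : Finset ℕ := arc c.leaves i (combLen c i)

/-- The first leaves of the edges of the greatest binary diagram. -/
def topIndices : Corolla → Finset ℕ
  | .T n => Finset.Ico 1 (n - 1)
  -- For `k = 0` the interval from `0` consists of all leaves and is no edge. The indices `j` and,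
  -- for `k > 0`, `j + k` would give single leaves.
  | .M j k => if k = 0 then Finset.Ico 1 j else (Finset.range (j + k)).erase j
  | .I k l => ((Finset.range (k + l + 2)).erase 0).erase (k + 1)

/-- The greatest binary diagram. -/
def topDiagram (c : Corolla) : Finset (Finset ℕ) := (topIndices c).image (comb c)

theorem mem_topIndices {c : Corolla} {i : ℕ} : i ∈ topIndices c ↔
    i < c.leaves ∧ i ∉ c.thickLeaves ∧ 2 ≤ combLen c i ∧ combLen c i < c.leaves := by
  cases c with
  | T n =>
    simp only [topIndices, Corolla.leaves, Corolla.thickLeaves, combLen, Finset.mem_Ico,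
      Finset.notMem_empty, not_false_eq_true, true_and]
    omega
  | M j k =>
    simp only [topIndices, Corolla.leaves, Corolla.thickLeaves, combLen, Finset.mem_singleton]
    split_ifs <;> simp only [Finset.mem_Ico, Finset.mem_erase, Finset.mem_range] <;> omega
  | I k l =>
    simp only [topIndices, Corolla.leaves, Corolla.thickLeaves, combLen, Finset.mem_singleton,
      Finset.mem_insert, Finset.mem_erase, Finset.mem_range]
    split_ifs <;> omega

theorem card_topIndices {c : Corolla} (hc : c.Valid) : (topIndices c).card + 2 = c.leaves := by
  cases c with
  | T n =>
    simp only [topIndices, Corolla.leaves, Nat.card_Ico, Corolla.Valid] at *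
    omega
  | M j k =>
    simp only [topIndices, Corolla.leaves, Corolla.Valid] at *
    split_ifs
    · rw [Nat.card_Ico]
      omega
    · rw [Finset.card_erase_of_mem (by rw [Finset.mem_range]; omega), Finset.card_range]
      omega
  | I k l =>
    simp only [topIndices, Corolla.leaves]
    rw [Finset.card_erase_of_mem (by rw [Finset.mem_erase, Finset.mem_range]; omega),
      Finset.card_erase_of_mem (by rw [Finset.mem_range]; omega), Finset.card_range]
    omega

theorem combLen_le {c : Corolla} {i : ℕ} (hi : i < c.leaves) :
    1 ≤ combLen c i ∧ i + combLen c i ≤ c.leaves + 1 := by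
  cases c <;> simp only [combLen, Corolla.leaves] at * <;>
    (try split_ifs) <;> omega

theorem mem_comb {c : Corolla} {i x : ℕ} (hc : c.Valid) (hi : i < c.leaves) :
    x ∈ comb c i ↔ x < c.leaves ∧
      (i ≤ x ∧ x < i + combLen c i ∨ i ≤ x + c.leaves ∧ x + c.leaves < i + combLen c i) := by
  have := combLen_le hi
  have := hc.two_le_leaves
  exact mem_arc (by omega)

theorem isEdge_comb {c : Corolla} (hc : c.Valid) {i : ℕ} (hi : i ∈ topIndices c) :
    IsEdge c (comb c i) := by
  obtain ⟨h1, h2, h3, h4⟩ := mem_topIndices.1 hi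
  refine isEdge_iff.2 ⟨i, combLen c i, h1, h3, h4, rfl, ?_⟩
  rw [mem_comb hc h1, mem_comb hc h1]
  cases c <;> simp only [combLen, Corolla.leaves, Corolla.opposite, Corolla.thickLeaves,
    Finset.mem_singleton, Finset.mem_insert] at * <;> (try split_ifs at *) <;> omega

/-- A comb stops at the first possible end after its start. So if `i'` lies in the comb of `i`, both
combs have the same end and one is a final segment of the other; if not, the comb of `i'` starts and
ends beyond that of `i`. -/
theorem comb_nested {c : Corolla} (hc : c.Valid) {i i' : ℕ} (hi' : i' < c.leaves)
    (hit : i ∉ c.thickLeaves) (h : i < i') :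
    i ∉ comb c i' ∧ (comb c i' ⊆ comb c i ∨ Disjoint (comb c i') (comb c i)) := by
  have hi : i < c.leaves := by omega
  refine ⟨?_, ?_⟩
  · rw [mem_comb hc hi']
    cases c <;> simp only [combLen, Corolla.leaves, Corolla.thickLeaves,
      Finset.mem_singleton, Finset.mem_insert] at * <;> (try split_ifs at *) <;> omega
  · by_cases hcase : combLen c i + i ≤ i'
    · refine Or.inr (Finset.disjoint_left.2 fun x hx hx' => ?_)
      rw [mem_comb hc hi'] at hx
      rw [mem_comb hc hi] at hx'
      cases c <;> simp only [combLen, Corolla.leaves, Corolla.thickLeaves,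
        Finset.mem_singleton, Finset.mem_insert] at * <;> (try split_ifs at *) <;> omega
    · refine Or.inl fun x hx => ?_
      rw [mem_comb hc hi'] at hx
      rw [mem_comb hc hi]
      cases c <;> simp only [combLen, Corolla.leaves, Corolla.thickLeaves,
        Finset.mem_singleton, Finset.mem_insert] at * <;> (try split_ifs at *) <;> omega

theorem comb_injOn {c : Corolla} (hc : c.Valid) : Set.InjOn (comb c) (topIndices c) := by
  intro i hi i' hi' h
  obtain ⟨h1, h2, h3, h4⟩ := mem_topIndices.1 hi
  obtain ⟨h1', h2', h3', h4'⟩ := mem_topIndices.1 hi'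
  have hmem : ∀ {i}, i < c.leaves → i ∈ comb c i := fun {i} hi => by
    have := combLen_le hi
    rw [mem_comb hc hi]
    omega
  rcases lt_trichotomy i i' with hlt | rfl | hlt
  · exact absurd (h ▸ hmem h1) (comb_nested hc h1' h2 hlt).1
  · rfl
  · exact absurd (h ▸ hmem h1') (comb_nested hc h1 h2' hlt).1

theorem isBinary_topDiagram {c : Corolla} (hc : c.Valid) : IsBinary c (topDiagram c) := by
  refine isBinary_iff.2 ⟨⟨?_, ?_⟩, ?_⟩
  · intro e he
    obtain ⟨i, hi, rfl⟩ := Finset.mem_image.1 he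
    exact isEdge_comb hc hi
  · intro e he e' he'
    obtain ⟨i, hi, rfl⟩ := Finset.mem_image.1 he
    obtain ⟨i', hi', rfl⟩ := Finset.mem_image.1 he'
    obtain ⟨h1, h2, -⟩ := mem_topIndices.1 hi
    obtain ⟨h1', h2', -⟩ := mem_topIndices.1 hi'
    rcases lt_trichotomy i i' with hlt | rfl | hlt
    · rcases (comb_nested hc h1' h2 hlt).2 with h | h
      · exact Or.inr (Or.inl h)
      · exact Or.inr (Or.inr h.symm)
    · exact Or.inl subset_rfl
    · rcases (comb_nested hc h1 h2' hlt).2 with h | h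
      · exact Or.inl h
      · exact Or.inr (Or.inr h)
  · rw [topDiagram, Finset.card_image_of_injOn (comb_injOn hc), card_topIndices hc]

theorem comb_eq_insert {c : Corolla} (hc : c.Valid) {i : ℕ} (hi : i ∈ topIndices c) :
    next c.leaves i < c.leaves ∧ comb c i = insert i (comb c (next c.leaves i)) ∧
      i ∉ comb c (next c.leaves i) ∧
      (combLen c (next c.leaves i) = 1 ∨
        i < next c.leaves i ∧ next c.leaves i ∈ topIndices c) := by
  obtain ⟨h1, h2, h3, h4⟩ := mem_topIndices.1 hi
  have hn : next c.leaves i < c.leaves := by unfold next; split_ifs <;> omega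
  have hlen : combLen c i = combLen c (next c.leaves i) + 1 ∧
      (combLen c (next c.leaves i) = 1 ∨ i < next c.leaves i ∧
        next c.leaves i ∉ c.thickLeaves ∧ 2 ≤ combLen c (next c.leaves i)) := by
    have hnx : i + 1 = c.leaves ∧ next c.leaves i = 0 ∨
        i + 1 < c.leaves ∧ next c.leaves i = i + 1 := by
      unfold next; split_ifs <;> omega
    generalize next c.leaves i = i' at *
    cases c <;> simp only [combLen, Corolla.leaves, Corolla.thickLeaves,
        Finset.mem_singleton, Finset.mem_insert, Finset.notMem_empty, not_false_eq_true,
        true_and, Corolla.Valid] at * <;>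
      (try split_ifs at *) <;> omega
  obtain ⟨hlen, hcase⟩ := hlen
  have hs : i + 1 = next c.leaves i ∨ i + 1 = next c.leaves i + c.leaves := by
    unfold next; split_ifs <;> omega
  have hn2 := combLen_le hn
  refine ⟨hn, ?_, ?_, ?_⟩
  · ext x
    rw [Finset.mem_insert, mem_comb hc h1, mem_comb hc hn]
    omega
  · rw [mem_comb hc hn]
    omega
  · refine hcase.imp_right fun h => ⟨h.1, mem_topIndices.2 ⟨hn, h.2.1, h.2.2, by omega⟩⟩

theorem comb_of_combLen {c : Corolla} (hc : c.Valid) {i : ℕ} (hi : i < c.leaves)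
    (h : combLen c i = 1) : comb c i = {i} := by
  ext x
  rw [mem_comb hc hi, Finset.mem_singleton]
  omega

/-- Supplies the hypotheses of `IsBinary.exists_le_mem` when `V` is the comb after `i`: this comb
ends at a thick leaf or at the last leaf. -/
theorem comb_next_thick {c : Corolla} (hc : c.Valid) {i : ℕ} (hi : i ∈ topIndices c) :
    (∀ x ∈ c.thickLeaves, ∀ y ∈ c.thickLeaves, x ∉ comb c (next c.leaves i) →
      y ∉ comb c (next c.leaves i) → x = y) ∧
    ((∃ x ∈ comb c (next c.leaves i), x ∈ c.thickLeaves) ∨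
      c.opposite = c.leaves - 1 ∧ c.opposite ∈ comb c (next c.leaves i)) := by
  obtain ⟨hl, ht, hl2, hln⟩ := mem_topIndices.1 hi
  have hn := (comb_eq_insert hc hi).1
  have hnx : i + 1 = c.leaves ∧ next c.leaves i = 0 ∨
      i + 1 < c.leaves ∧ next c.leaves i = i + 1 := by
    unfold next; split_ifs <;> omega
  generalize next c.leaves i = i' at *
  cases c with
  | T n =>
    refine ⟨by simp [Corolla.thickLeaves], Or.inr ⟨rfl, ?_⟩⟩
    rw [mem_comb hc hn]
    simp only [combLen, Corolla.leaves, Corolla.opposite] at *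
    omega
  | M j k =>
    refine ⟨by simp [Corolla.thickLeaves], ?_⟩
    simp only [Corolla.thickLeaves, Finset.mem_singleton] at ht
    rcases Nat.lt_or_ge i j with h | h
    · refine Or.inl ⟨j, ?_, by simp [Corolla.thickLeaves]⟩
      rw [mem_comb hc hn]
      simp only [combLen, Corolla.leaves] at *
      split_ifs at * <;> omega
    · refine Or.inr ⟨by simp [Corolla.opposite, Corolla.leaves], ?_⟩
      rw [mem_comb hc hn]
      simp only [combLen, Corolla.leaves, Corolla.opposite] at *
      split_ifs at * <;> omega
  | I k l =>
    have hmem := fun x => @mem_comb _ i' x hc hn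
    simp only [combLen, Corolla.leaves, Corolla.thickLeaves, Finset.mem_singleton,
      Finset.mem_insert] at hl ht hl2 hln hn hnx hmem ⊢
    have h0 := hmem 0
    have h1 := hmem (k + 1)
    refine ⟨?_, Or.inl ?_⟩
    · rintro x (rfl | rfl) y (rfl | rfl) hx hy
      · rfl
      · rw [h0] at hx
        rw [h1] at hy
        split_ifs at * <;> omega
      · rw [h1] at hx
        rw [h0] at hy
        split_ifs at * <;> omega
      · rfl
    · rcases Nat.lt_or_ge i (k + 1) with h | h
      · exact ⟨k + 1, h1.2 (by split_ifs at * <;> omega), Or.inr rfl⟩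
      · exact ⟨0, h0.2 (by split_ifs at * <;> omega), Or.inl rfl⟩

/-- Every binary diagram is at most `topDiagram c`. -/
theorem IsBinary.le_topDiagram {c : Corolla} (hc : c.Valid) {B : Finset (Finset ℕ)}
    (hB : IsBinary c B) : Le c B (topDiagram c) := by
  -- After `m` rounds all combs that start at one of the last `m` positions are present.
  have main : ∀ m : ℕ, ∃ B', Le c B B' ∧ IsBinary c B' ∧
      ∀ i ∈ topIndices c, c.leaves ≤ i + m → comb c i ∈ B' := by
    intro m
    induction m with
    | zero =>
      refine ⟨B, Relation.ReflTransGen.refl, hB, fun i hi h => ?_⟩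
      have := (mem_topIndices.1 hi).1
      omega
    | succ m ih =>
      obtain ⟨B', h1, h2, h3⟩ := ih
      by_cases hi : ∃ i ∈ topIndices c, c.leaves = i + (m + 1)
      · obtain ⟨i, hi, him⟩ := hi
        obtain ⟨hl, ht, hl2, hln⟩ := mem_topIndices.1 hi
        obtain ⟨hn, hins, hnot, hcase⟩ := comb_eq_insert hc hi
        have hnlen := combLen_le hn
        have hVB : comb c (next c.leaves i) ∈ clades c B' := by
          rcases hcase with h | ⟨h, h'⟩
          · exact mem_clades.2 (Or.inr (Or.inr ⟨_, hn, comb_of_combLen hc hn h⟩))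
          · exact mem_clades.2 (Or.inl (h3 _ h' (by omega)))
        obtain ⟨huniq, hV⟩ := comb_next_thick hc hi
        obtain ⟨B'', h1', h2', h4, h5⟩ := h2.exists_le_mem hc hnot
          (by rw [mem_comb hc hn]; omega) (hins ▸ isEdge_comb hc hi) ht huniq hV hVB
        refine ⟨B'', h1.trans h1', h2', fun i' hi' hm => ?_⟩
        have hl' := (mem_topIndices.1 hi').1
        rcases Nat.lt_or_ge i i' with hlt | hge
        -- The combs created earlier avoid `i` and are contained in or disjoint from the present
        -- one, so they survive.
        · obtain ⟨hx, hy⟩ := comb_nested hc hl' ht hlt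
          refine h5 _ (h3 i' hi' (by omega)) hx ?_
          rw [hins] at hy
          rcases hy with hy | hy
          · exact Or.inl ((Finset.subset_insert_iff_of_notMem hx).1 hy)
          · exact Or.inr (hy.mono_right (Finset.subset_insert _ _))
        · obtain rfl : i = i' := by omega
          rw [hins]
          exact h4
      · refine ⟨B', h1, h2, fun i hi' him => ?_⟩
        by_cases h : c.leaves = i + (m + 1)
        · exact absurd ⟨i, hi', h⟩ hi
        · exact h3 i hi' (by omega)
  obtain ⟨B', h1, h2, h3⟩ := main c.leaves
  have hsub : topDiagram c ⊆ B' := by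
    intro e he
    obtain ⟨i, hi, rfl⟩ := Finset.mem_image.1 he
    exact h3 i hi (by omega)
  have := (isBinary_iff.1 h2).2
  have := (isBinary_iff.1 (isBinary_topDiagram hc)).2
  rwa [Finset.eq_of_subset_of_card_le hsub (by omega)]

/-- No local move leads from `topDiagram c` to a greater diagram. -/
theorem not_move_topDiagram {c : Corolla} (hc : c.Valid) {e e' : Finset ℕ}
    {B : Finset (Finset ℕ)} : ¬ Move c (topDiagram c) e B e' := by
  rintro ⟨-, hB, he, he', -, s, x, y, z, hx, hy, hz, hs, hle, h⟩
  obtain ⟨i, hi, rfl⟩ := Finset.mem_image.1 he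
  obtain ⟨h1, h2, h3, h4⟩ := mem_topIndices.1 hi
  obtain ⟨s', l', -, -, -, -, hnb⟩ := isEdge_iff.1 (hB.1.1 e' he')
  have hlen := combLen_le h1
  -- A thick leaf of a comb can only be its last leaf. If `Y` is thin, the comb ends with `Y`, hence
  -- at the last leaf, and `Y ∪ Z` would contain the last and the first leaf. If `Y` is thick, the
  -- comb would continue into `Z` after a thick leaf.
  rcases h with ⟨hthin, he1, he2⟩ | ⟨hthick, he1, -⟩
  · rw [he2] at hnb
    have hmem : ∀ a, a ∈ comb c i ↔ a ∈ arc c.leaves s x ∪ arc c.leaves (s + x) y := fun a => by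
      rw [he1]
    simp only [Finset.mem_union, mem_arc (show s + x + y + z ≤ 2 * c.leaves by omega),
      mem_arc (show s + x + y ≤ 2 * c.leaves by omega)] at hnb
    simp only [mem_comb hc h1, Finset.mem_union, mem_arc (show s + x ≤ 2 * c.leaves by omega),
      mem_arc (show s + x + y ≤ 2 * c.leaves by omega)] at hmem
    have hY : ∀ a ∈ c.thickLeaves, ¬ (a < c.leaves ∧
        (s + x ≤ a ∧ a < s + x + y ∨ s + x ≤ a + c.leaves ∧ a + c.leaves < s + x + y)) := by
      intro a ha h
      exact Finset.disjoint_left.1 hthin ((mem_arc (by omega)).2 h) ha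
    -- The starts of the two equal arcs are compared by testing membership at both starts and at the
    -- leaves before them. The lengths are then compared at the first leaf beyond the shorter arc.
    have hsi : s = i := by
      have := hmem s
      have := hmem i
      have := hmem (if i = 0 then c.leaves - 1 else i - 1)
      have := hmem (if s = 0 then c.leaves - 1 else s - 1)
      (try split_ifs at *) <;> omega
    subst hsi
    have hxy : x + y = combLen c s := by
      rcases lt_trichotomy (x + y) (combLen c s) with h | h | h
      · have := hmem (if s + (x + y) < c.leaves then s + (x + y) else s + (x + y) - c.leaves)
        (try split_ifs at *) <;> omega
      · exact h
      · have := hmem (if s + combLen c s < c.leaves then s + combLen c s else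
          s + combLen c s - c.leaves)
        (try split_ifs at *) <;> omega
    clear hmem
    cases c with
    | T n =>
      simp only [combLen, Corolla.leaves, Corolla.opposite] at *
      omega
    | M j k =>
      have := hY j (by simp [Corolla.thickLeaves])
      simp only [combLen, Corolla.leaves, Corolla.opposite] at *
      (try split_ifs at *) <;> omega
    | I k l =>
      have := hY 0 (by simp [Corolla.thickLeaves])
      have := hY (k + 1) (by simp [Corolla.thickLeaves])
      simp only [combLen, Corolla.leaves, Corolla.opposite, Corolla.thickLeaves,
        Finset.mem_singleton, Finset.mem_insert] at *
      (try split_ifs at *) <;> omega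
  · have hmem : ∀ a, a ∈ comb c i ↔ a ∈ arc c.leaves (s + x) y ∪ arc c.leaves (s + x + y) z :=
      fun a => by rw [he1]
    simp only [mem_comb hc h1, Finset.mem_union, mem_arc (show s + x + y ≤ 2 * c.leaves by omega),
      mem_arc (show s + x + y + z ≤ 2 * c.leaves by omega)] at hmem
    obtain ⟨a, ha, hat⟩ := Finset.not_disjoint_iff.1 hthick
    rw [mem_arc (by omega)] at ha
    have hsi : s + x = i ∨ s + x = i + c.leaves := by
      have := hmem (if s + x < c.leaves then s + x else s + x - c.leaves)
      have := hmem i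
      have := hmem (if i = 0 then c.leaves - 1 else i - 1)
      have := hmem (if s + x = 0 then c.leaves - 1 else if s + x - 1 < c.leaves then s + x - 1
        else s + x - 1 - c.leaves)
      (try split_ifs at *) <;> omega
    have hxy : y + z = combLen c i := by
      rcases lt_trichotomy (y + z) (combLen c i) with h | h | h
      · have := hmem (if i + (y + z) < c.leaves then i + (y + z) else i + (y + z) - c.leaves)
        (try split_ifs at *) <;> omega
      · exact h
      · have := hmem (if i + combLen c i < c.leaves then i + combLen c i else
          i + combLen c i - c.leaves)
        (try split_ifs at *) <;> omega
    clear hmem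
    cases c <;> simp only [combLen, Corolla.leaves, Corolla.thickLeaves,
      Finset.mem_singleton, Finset.mem_insert, Finset.notMem_empty] at * <;>
      (try split_ifs at *) <;> omega

theorem eq_of_topDiagram_le {c : Corolla} (hc : c.Valid) {B : Finset (Finset ℕ)}
    (h : Le c (topDiagram c) B) : B = topDiagram c := by
  rcases Relation.ReflTransGen.cases_head h with h | ⟨B', ⟨e, e', hm⟩, -⟩
  · exact h.symm
  · exact absurd hm (not_move_topDiagram hc)

/-- The maximum chosen in the definition lies above `topDiagram c`, and no move leads upward from
there, so the choice is forced. -/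
theorem maxOf_empty {c : Corolla} (hc : c.Valid) : maxOf c ∅ = topDiagram c := by
  have h : ∃ B ∈ refinements c ∅, ∀ B' ∈ refinements c ∅, Le c B' B :=
    ⟨topDiagram c, ⟨isBinary_topDiagram hc, Finset.empty_subset _⟩,
      fun B' hB' => IsBinary.le_topDiagram hc hB'.1⟩
  rw [maxOf, dif_pos h]
  exact eq_of_topDiagram_le hc
    (h.choose_spec.2 _ ⟨isBinary_topDiagram hc, Finset.empty_subset _⟩)

theorem IsBinary.eq_of_subset {c : Corolla} {B B' : Finset (Finset ℕ)} (hB : IsBinary c B)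
    (hB' : IsBinary c B') (h : B ⊆ B') : B = B' := by
  have := (isBinary_iff.1 hB).2
  have := (isBinary_iff.1 hB').2
  exact Finset.eq_of_subset_of_card_le h (by omega)

/-- All binary diagrams over `c` have the same number of edges, so `B` is its own only refinement.
-/
theorem IsBinary.minOf_eq {c : Corolla} {B : Finset (Finset ℕ)} (hB : IsBinary c B) :
    minOf c B = B := by
  have h : ∃ B' ∈ refinements c B, ∀ B'' ∈ refinements c B, Le c B' B'' :=
    ⟨B, ⟨hB, subset_rfl⟩, fun B' hB' => by
      rw [hB.eq_of_subset hB'.1 hB'.2]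
      exact Relation.ReflTransGen.refl⟩
  rw [minOf, dif_pos h]
  exact (hB.eq_of_subset h.choose_spec.1.1 h.choose_spec.1.2).symm

/-! ### Arithmetic of collapsing an arc to a leaf -/

/-- Numerical data of cutting an `n`-gon along the arc of length `l` that starts at `s`: after a
rotation of the numbering by `r`, the arc starts at `a` and does not pass `n`. -/
structure CutData (n s l a r : ℕ) : Prop where
  two_le : 2 ≤ l
  lt : l < n
  s_lt : s < n
  r_lt : r < n
  le : a + l ≤ n
  eq : s + r = a ∨ s + r = a + n

namespace CutData

variable {n s l a r : ℕ}

/-- The piecewise formula, written without remainders and truncated subtraction as input for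
`omega`. The outer alternative is whether the rotation passes `n`; the inner one is the position
relative to the collapsed arc. -/
theorem collapsePos_eq (h : CutData n s l a r) {x : ℕ} (hx : x < n) :
    (x + r < n ∧ (x + r < a ∧ collapsePos n l a r x = x + r ∨
      a ≤ x + r ∧ x + r < a + l ∧ collapsePos n l a r x = a ∨
      a + l ≤ x + r ∧ collapsePos n l a r x + l = x + r + 1)) ∨
    (n ≤ x + r ∧ (x + r < a + n ∧ collapsePos n l a r x + n = x + r ∨
      a + n ≤ x + r ∧ x + r < a + l + n ∧ collapsePos n l a r x = a ∨
      a + l + n ≤ x + r ∧ collapsePos n l a r x + l + n = x + r + 1)) := by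
  have h1 := h.two_le
  have h2 := h.r_lt
  have h3 := h.le
  rcases Nat.lt_or_ge (x + r) n with hlt | hge
  · simp only [collapsePos, Nat.mod_eq_of_lt hlt]
    split_ifs <;> omega
  · simp only [collapsePos, Nat.mod_eq_sub_mod hge, Nat.mod_eq_of_lt (show x + r - n < n by omega)]
    split_ifs <;> omega

theorem collapsePos_lt (h : CutData n s l a r) {x : ℕ} (hx : x < n) :
    collapsePos n l a r x < n + 1 - l := by
  have := h.collapsePos_eq hx
  have := h.two_le
  have := h.lt
  have := h.le
  have := h.r_lt
  omega

theorem mem_arc_iff (h : CutData n s l a r) {x : ℕ} :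
    x ∈ arc n s l ↔ x < n ∧ (s ≤ x ∧ x < s + l ∨ s ≤ x + n ∧ x + n < s + l) :=
  mem_arc (by have := h.lt; have := h.s_lt; omega)

theorem collapsePos_eq_iff (h : CutData n s l a r) {x : ℕ} (hx : x < n) :
    collapsePos n l a r x = a ↔ x ∈ arc n s l := by
  obtain ⟨h1, h2, h3, h4, h5, h6⟩ := id h
  have := h.collapsePos_eq hx
  rw [h.mem_arc_iff]
  omega

theorem collapsePos_inj (h : CutData n s l a r) {x x' : ℕ} (hx : x < n) (hx' : x' < n)
    (hne : x ∉ arc n s l) (he : collapsePos n l a r x = collapsePos n l a r x') : x = x' := by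
  obtain ⟨h1, h2, h3, h4, h5, h6⟩ := id h
  rw [h.mem_arc_iff] at hne
  have := h.collapsePos_eq hx
  have := h.collapsePos_eq hx'
  omega

theorem innerPos_eq (h : CutData n s l a r) {b : ℕ} (hb : b < l) :
    innerPos n a r b < n ∧ (s + b < n ∧ innerPos n a r b = s + b ∨
      n ≤ s + b ∧ innerPos n a r b + n = s + b) := by
  obtain ⟨h1, h2, h3, h4, h5, h6⟩ := id h
  have hn : 0 < n := by omega
  refine ⟨Nat.mod_lt _ hn, ?_⟩
  unfold innerPos
  have h7 : (a + b + n - r) % n = (s + b) % n := by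
    rcases h6 with h6 | h6
    · rw [show a + b + n - r = s + b + n by omega, Nat.add_mod_right]
    · rw [show a + b + n - r = s + b by omega]
  rw [h7]
  rcases Nat.lt_or_ge (s + b) n with hlt | hge
  · rw [Nat.mod_eq_of_lt hlt]; omega
  · rw [Nat.mod_eq_sub_mod hge, Nat.mod_eq_of_lt (by omega)]; omega

theorem cutPos_eq (h : CutData n s l a r) {x : ℕ} (hx : x < n) :
    s ≤ x ∧ (x + n - s) % n = x - s ∨ x < s ∧ (x + n - s) % n = x + n - s := by
  have h3 := h.s_lt
  rcases Nat.lt_or_ge x s with hlt | hge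
  · rw [Nat.mod_eq_of_lt (by omega)]; omega
  · rw [Nat.mod_eq_sub_mod (by omega), Nat.mod_eq_of_lt (by omega)]; omega

theorem outerPos_eq (h : CutData n s l a r) {p : ℕ} (hp : p < n + 1 - l) (hpa : p ≠ a) :
    outerPos n l a r p < n ∧ outerPos n l a r p ∉ arc n s l ∧
      collapsePos n l a r (outerPos n l a r p) = p := by
  obtain ⟨h1, h2, h3, h4, h5, h6⟩ := id h
  have hn : 0 < n := by omega
  have hlt : outerPos n l a r p < n := Nat.mod_lt _ hn
  have hval : ∃ q, q < n ∧ (p < a ∧ q = p ∨ a < p ∧ q + 1 = p + l) ∧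
      (r ≤ q ∧ outerPos n l a r p + r = q ∨ q < r ∧ outerPos n l a r p + r = q + n) := by
    refine ⟨if p < a then p else p + l - 1, by split_ifs <;> omega, by split_ifs <;> omega, ?_⟩
    unfold outerPos
    have hq : (if p < a then p else p + l - 1) < n := by split_ifs <;> omega
    generalize (if p < a then p else p + l - 1) = q at *
    rcases Nat.lt_or_ge q r with hlt | hge
    · rw [Nat.mod_eq_of_lt (by omega)]; omega
    · rw [Nat.mod_eq_sub_mod (by omega), Nat.mod_eq_of_lt (by omega)]; omega
  obtain ⟨q, hq, hq1, hq2⟩ := hval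
  have hc := h.collapsePos_eq hlt
  refine ⟨hlt, ?_, by omega⟩
  rw [h.mem_arc_iff]
  omega

theorem exists_collapsePos_eq (h : CutData n s l a r) {p : ℕ} (hp : p < n + 1 - l) :
    ∃ x < n, collapsePos n l a r x = p := by
  by_cases hpa : p = a
  · refine ⟨s, h.s_lt, ?_⟩
    rw [hpa, h.collapsePos_eq_iff h.s_lt, h.mem_arc_iff]
    have := h.two_le
    have := h.s_lt
    omega
  · obtain ⟨h1, -, h2⟩ := h.outerPos_eq hp hpa
    exact ⟨_, h1, h2⟩

/-- The preimage under collapsing the arc to a point. -/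
def preimage (n l a r : ℕ) (d : Finset ℕ) : Finset ℕ :=
  (Finset.range n).filter fun x => collapsePos n l a r x ∈ d

theorem mem_preimage {d : Finset ℕ} {x : ℕ} :
    x ∈ preimage n l a r d ↔ x < n ∧ collapsePos n l a r x ∈ d := by
  simp [preimage]

theorem image_preimage (h : CutData n s l a r) {d : Finset ℕ}
    (hd : d ⊆ Finset.range (n + 1 - l)) :
    (preimage n l a r d).image (collapsePos n l a r) = d := by
  ext p
  rw [Finset.mem_image]
  constructor
  · rintro ⟨x, hx, rfl⟩
    exact (mem_preimage.1 hx).2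
  · intro hp
    obtain ⟨x, hx, rfl⟩ := h.exists_collapsePos_eq (Finset.mem_range.1 (hd hp))
    exact ⟨x, mem_preimage.2 ⟨hx, hp⟩, rfl⟩

theorem preimage_subset_or (h : CutData n s l a r) (d : Finset ℕ) :
    arc n s l ⊆ preimage n l a r d ∨ Disjoint (arc n s l) (preimage n l a r d) := by
  by_cases ha : a ∈ d
  · refine Or.inl fun x hx => mem_preimage.2 ?_
    have hxn := (h.mem_arc_iff.1 hx).1
    exact ⟨hxn, by rwa [(h.collapsePos_eq_iff hxn).2 hx]⟩
  · refine Or.inr (Finset.disjoint_left.2 fun x hx hx' => ha ?_)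
    obtain ⟨hxn, hx'⟩ := mem_preimage.1 hx'
    rwa [(h.collapsePos_eq_iff hxn).2 hx] at hx'

/-- Undoing the collapse stretches the point `a` to `l` leaves. An arc through `a` becomes longer by
`l - 1`, any other arc keeps its length, and starts beyond `a` are shifted by `l - 1`. -/
theorem preimage_arc (h : CutData n s l a r) {s₁ l₁ : ℕ} (hs : s₁ < n + 1 - l) (h₁ : 2 ≤ l₁)
    (hl₁ : l₁ < n + 1 - l) :
    ∃ s' l', s' < n ∧ 2 ≤ l' ∧ l' < n ∧ preimage n l a r (arc (n + 1 - l) s₁ l₁) = arc n s' l' := by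
  obtain ⟨h1, h2, h3, h4, h5, h6⟩ := id h
  have key : ∀ s' l', s' < n → l' < n →
      (s₁ ≤ a ∧ (s' + r = s₁ ∨ s' + r = s₁ + n) ∨
        a < s₁ ∧ (s' + r + 1 = s₁ + l ∨ s' + r + 1 = s₁ + l + n)) →
      ((s₁ ≤ a ∧ a < s₁ + l₁ ∨ a + (n + 1 - l) < s₁ + l₁) ∧ l' = l₁ + (l - 1) ∨
        (¬ (s₁ ≤ a ∧ a < s₁ + l₁ ∨ a + (n + 1 - l) < s₁ + l₁)) ∧ l' = l₁) →
      preimage n l a r (arc (n + 1 - l) s₁ l₁) = arc n s' l' := by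
    intro s' l' hs' hl' hss hll
    ext x
    rw [mem_preimage, mem_arc (by omega), mem_arc (by omega)]
    refine and_congr_right fun hx => ?_
    have h7 := h.collapsePos_eq hx
    have h8 := h.collapsePos_lt hx
    rcases h7 with ⟨h7, h9 | h9 | h9⟩ | ⟨h7, h9 | h9 | h9⟩ <;> omega
  refine ⟨if s₁ ≤ a then (if r ≤ s₁ then s₁ - r else s₁ + n - r) else
      (if r + 1 ≤ s₁ + l then s₁ + l - 1 - r else s₁ + l - 1 + n - r),
    if s₁ ≤ a ∧ a < s₁ + l₁ ∨ a + (n + 1 - l) < s₁ + l₁ then l₁ + (l - 1) else l₁, ?_, ?_, ?_,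
    key _ _ ?_ ?_ ?_ ?_⟩
  all_goals split_ifs <;> omega

/-- The arc contains the cut arc and loses `l - 1` leaves under the collapse, or it is disjoint from
the cut arc and keeps its length. In both cases the clockwise distance `δ` (from start to start, or
from the end of the cut arc to the start of the other) turns the set relation into a linear
inequality. -/
theorem exists_preimage_eq (h : CutData n s l a r) {s' l' : ℕ} (hs : s' < n) (h' : 2 ≤ l')
    (hl' : l' < n) (hc : arc n s' l' ⊆ arc n s l ∨ arc n s l ⊆ arc n s' l' ∨
      Disjoint (arc n s' l') (arc n s l)) (hn : ¬ arc n s' l' ⊆ arc n s l) :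
    ∃ s₁ l₁, s₁ < n + 1 - l ∧ 2 ≤ l₁ ∧ l₁ < n + 1 - l ∧
      arc n s' l' = preimage n l a r (arc (n + 1 - l) s₁ l₁) := by
  obtain ⟨h1, h2, h3, h4, h5, h6⟩ := id h
  have hcs := h.collapsePos_lt hs
  have hce := h.collapsePos_eq hs
  have hc := hc.resolve_left hn
  rcases hc with hc | hc
  · have hlt : l < l' := by
      have := Finset.card_lt_card (hc.ssubset_of_ne fun he => hn he.ge)
      rwa [card_arc h2.le, card_arc hl'.le] at this
    have e1 := @hc s
    have e2 := @hc (if s' + l' < n then s' + l' else s' + l' - n)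
    rw [h.mem_arc_iff, mem_arc (by omega)] at e1 e2
    have e3 : ∃ δ, δ + l ≤ l' ∧ (s' + δ = s ∨ s' + δ = s + n) := by
      refine ⟨if s' ≤ s then s - s' else s + n - s', ?_, ?_⟩ <;> split_ifs at * <;> omega
    clear e1 e2
    obtain ⟨δ, hδ, e3⟩ := e3
    refine ⟨_, l' - (l - 1), hcs, by omega, by omega, ?_⟩
    ext x
    rw [mem_preimage, mem_arc (by omega), mem_arc (by omega)]
    refine and_congr_right fun hx => ?_
    have h7 := h.collapsePos_eq hx
    have h8 := h.collapsePos_lt hx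
    rcases hce with ⟨_, h10 | h10 | h10⟩ | ⟨_, h10 | h10 | h10⟩ <;>
    rcases h7 with ⟨h7, h9 | h9 | h9⟩ | ⟨h7, h9 | h9 | h9⟩ <;> omega
  · have e1 : s ∈ arc n s' l' → s ∉ arc n s l := fun hx => Finset.disjoint_left.1 hc hx
    have e2 : s' ∈ arc n s' l' → s' ∉ arc n s l := fun hx => Finset.disjoint_left.1 hc hx
    rw [h.mem_arc_iff, mem_arc (by omega)] at e1 e2
    have e3 : ∃ δ, δ + l + l' ≤ n ∧ (s + l + δ = s' ∨ s + l + δ = s' + n) := by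
      refine ⟨if s + l ≤ s' then s' - (s + l) else s' + n - (s + l), ?_, ?_⟩ <;>
        split_ifs at * <;> omega
    clear e1 e2
    obtain ⟨δ, hδ, e3⟩ := e3
    refine ⟨_, l', hcs, by omega, by omega, ?_⟩
    ext x
    rw [mem_preimage, mem_arc (by omega), mem_arc (by omega)]
    refine and_congr_right fun hx => ?_
    have h7 := h.collapsePos_eq hx
    have h8 := h.collapsePos_lt hx
    rcases hce with ⟨_, h10 | h10 | h10⟩ | ⟨_, h10 | h10 | h10⟩ <;>
    rcases h7 with ⟨h7, h9 | h9 | h9⟩ | ⟨h7, h9 | h9 | h9⟩ <;> omega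

theorem not_preimage_subset (h : CutData n s l a r) {d : Finset ℕ}
    (hd : d ⊆ Finset.range (n + 1 - l)) (h2 : 2 ≤ d.card) :
    ¬ preimage n l a r d ⊆ arc n s l := by
  intro hsub
  obtain ⟨p, hp, hpa⟩ := Finset.exists_mem_ne h2 a
  obtain ⟨h1, h2, h3⟩ := h.outerPos_eq (Finset.mem_range.1 (hd hp)) hpa
  exact h2 (hsub (mem_preimage.2 ⟨h1, by rwa [h3]⟩))

theorem cutPos_lt (h : CutData n s l a r) {x : ℕ} (hx : x ∈ arc n s l) :
    (x + n - s) % n < l := by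
  have hx' := h.mem_arc_iff.1 hx
  have := h.cutPos_eq hx'.1
  have := h.s_lt
  omega

theorem innerPos_cutPos (h : CutData n s l a r) {x : ℕ} (hx : x ∈ arc n s l) :
    innerPos n a r ((x + n - s) % n) = x := by
  have hx' := h.mem_arc_iff.1 hx
  have := h.cutPos_eq hx'.1
  have := h.innerPos_eq (h.cutPos_lt hx)
  omega

theorem innerPos_mem (h : CutData n s l a r) {b : ℕ} (hb : b < l) :
    innerPos n a r b ∈ arc n s l := by
  have := h.innerPos_eq hb
  rw [h.mem_arc_iff]
  omega

theorem cutPos_innerPos (h : CutData n s l a r) {b : ℕ} (hb : b < l) :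
    (innerPos n a r b + n - s) % n = b := by
  have h1 := h.innerPos_eq hb
  have := h.cutPos_eq h1.1
  have := h.lt
  omega

theorem image_innerPos_range (h : CutData n s l a r) :
    (Finset.range l).image (innerPos n a r) = arc n s l := by
  ext x
  rw [Finset.mem_image]
  constructor
  · rintro ⟨b, hb, rfl⟩
    exact h.innerPos_mem (Finset.mem_range.1 hb)
  · intro hx
    exact ⟨_, Finset.mem_range.2 (h.cutPos_lt hx), h.innerPos_cutPos hx⟩

theorem image_innerPos_image (h : CutData n s l a r) {d : Finset ℕ} (hd : d ⊆ arc n s l) :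
    (d.image fun x => (x + n - s) % n).image (innerPos n a r) = d := by
  rw [Finset.image_image]
  conv_rhs => rw [← Finset.image_id (s := d)]
  exact Finset.image_congr fun x hx => h.innerPos_cutPos (hd hx)

theorem image_image_innerPos (h : CutData n s l a r) {d : Finset ℕ} (hd : d ⊆ Finset.range l) :
    (d.image (innerPos n a r)).image (fun x => (x + n - s) % n) = d := by
  rw [Finset.image_image]
  conv_rhs => rw [← Finset.image_id (s := d)]
  exact Finset.image_congr fun x hx => h.cutPos_innerPos (Finset.mem_range.1 (hd hx))

theorem image_innerPos_arc (h : CutData n s l a r) {s₁ l₁ : ℕ} (hs : s₁ < l) (hl₁ : s₁ + l₁ ≤ l) :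
    ∃ s' < n, (arc l s₁ l₁).image (innerPos n a r) = arc n s' l₁ := by
  obtain ⟨h1, h2, h3, h4, h5, h6⟩ := id h
  refine ⟨if s + s₁ < n then s + s₁ else s + s₁ - n, by split_ifs <;> omega, ?_⟩
  ext x
  rw [Finset.mem_image, mem_arc (by split_ifs <;> omega)]
  constructor
  · rintro ⟨b, hb, rfl⟩
    rw [mem_arc (by omega)] at hb
    have := h.innerPos_eq hb.1
    split_ifs <;> omega
  · intro hx
    have hx' : x ∈ arc n s l := by
      rw [h.mem_arc_iff]
      split_ifs at hx <;> omega
    refine ⟨_, ?_, h.innerPos_cutPos hx'⟩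
    have h7 := h.cutPos_eq hx.1
    have h8 := h.cutPos_lt hx'
    rw [mem_arc (by omega)]
    split_ifs at hx <;> omega

theorem exists_image_innerPos_eq (h : CutData n s l a r) {s' l' : ℕ} (hs : s' < n) (h' : 2 ≤ l')
    (hl' : l' < n) (hsub : arc n s' l' ⊂ arc n s l) :
    ∃ s₁, s₁ + l' ≤ l ∧ l' < l ∧ (arc n s' l').image (fun x => (x + n - s) % n) = arc l s₁ l' := by
  obtain ⟨h1, h2, h3, h4, h5, h6⟩ := id h
  have hlt := Finset.card_lt_card hsub
  rw [card_arc h2.le, card_arc hl'.le] at hlt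
  have e1 := @hsub.1 s'
  have e2 := @hsub.1 (if s + l < n then s + l else s + l - n)
  rw [h.mem_arc_iff, mem_arc (by omega)] at e1 e2
  have e3 : ∃ δ, δ + l' ≤ l ∧ (s + δ = s' ∨ s + δ = s' + n) := by
    refine ⟨if s ≤ s' then s' - s else s' + n - s, ?_, ?_⟩ <;> split_ifs at * <;> omega
  clear e1 e2
  obtain ⟨δ, hδ, e3⟩ := e3
  refine ⟨δ, hδ, hlt, ?_⟩
  ext b
  rw [Finset.mem_image, mem_arc (by omega)]
  constructor
  · rintro ⟨x, hx, rfl⟩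
    have h8 := h.cutPos_lt (hsub.1 hx)
    rw [mem_arc (by omega)] at hx
    have h7 := h.cutPos_eq hx.1
    omega
  · rintro ⟨hb, hb'⟩
    refine ⟨_, ?_, h.cutPos_innerPos hb⟩
    have := h.innerPos_eq hb
    rw [mem_arc (by omega)]
    omega

end CutData

/-! ### Cutting a corolla along an edge -/

/-- Only the start of an arc that is not the full circle has its predecessor outside the arc, so the
supremum in `firstLeaf` is over a single leaf. -/
theorem firstLeaf_arc {c : Corolla} {s l : ℕ} (hs : s < c.leaves) (h1 : 1 ≤ l)
    (hl : l < c.leaves) : firstLeaf c (arc c.leaves s l) = s := by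
  have : (arc c.leaves s l).filter (fun x => (x + c.leaves - 1) % c.leaves ∉ arc c.leaves s l) =
      {s} := by
    ext x
    rw [Finset.mem_filter, Finset.mem_singleton, mem_arc (by omega)]
    by_cases hx : x < c.leaves
    · rcases Nat.eq_zero_or_pos x with h0 | h0
      · rw [Nat.mod_eq_of_lt (by omega), mem_arc (by omega)]
        omega
      · rw [Nat.mod_eq_sub_mod (by omega), Nat.mod_eq_of_lt (by omega), mem_arc (by omega)]
        omega
    · omega
  rw [firstLeaf, this, Finset.sup_singleton, id]

theorem IsEdge.eq_arc {c : Corolla} {e : Finset ℕ} (he : IsEdge c e) :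
    firstLeaf c e < c.leaves ∧ e = arc c.leaves (firstLeaf c e) e.card := by
  obtain ⟨s, l, h1, h2, h3, rfl, -⟩ := isEdge_iff.1 he
  rw [firstLeaf_arc h1 (by omega) h3, card_arc h3.le]
  exact ⟨h1, rfl⟩

theorem IsEdge.not_both {c : Corolla} {e : Finset ℕ} (he : IsEdge c e) :
    ¬ (0 ∈ e ∧ c.opposite ∈ e) := by
  obtain ⟨s, l, -, -, -, -, h⟩ := isEdge_iff.1 he
  exact h

/-- If `e` contains the left thick leaf, the rotation brings its first leaf to position `0`.
Otherwise nothing is rotated, and `e` does not wrap, since it would then contain `0`. -/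
theorem IsEdge.cutData {c : Corolla} {e : Finset ℕ} (he : IsEdge c e) :
    CutData c.leaves (firstLeaf c e) e.card (cutLeaf c e) (cutRotation c e) := by
  obtain ⟨h1, h2⟩ := he.eq_arc
  have h3 := he.two_le_card
  have h4 := he.card_lt
  by_cases hcut : CutsLeft c e
  · rw [cutLeaf, cutRotation, if_pos hcut, if_pos hcut]
    rcases Nat.eq_zero_or_pos (firstLeaf c e) with h0 | h0
    · rw [h0, Nat.sub_zero, Nat.mod_self]
      exact ⟨h3, h4, by omega, by omega, by omega, by omega⟩
    · rw [Nat.mod_eq_of_lt (by omega)]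
      exact ⟨h3, h4, by omega, by omega, by omega, by omega⟩
  · rw [cutLeaf, cutRotation, if_neg hcut, if_neg hcut]
    refine ⟨h3, h4, h1, by omega, ?_, by omega⟩
    have hnb := he.not_both
    rw [h2, mem_arc (by omega), mem_arc (by omega)] at hnb
    cases c with
    | T n =>
      simp only [Corolla.opposite, Corolla.leaves] at *
      omega
    | M j k =>
      simp only [Corolla.opposite, Corolla.leaves] at *
      omega
    | I k l =>
      have h5 : 0 ∉ e := hcut
      rw [h2, mem_arc (by omega)] at h5
      omega

theorem IsEdge.mem_iff {c : Corolla} {e : Finset ℕ} (he : IsEdge c e) {x : ℕ} :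
    x ∈ e ↔ x ∈ arc c.leaves (firstLeaf c e) e.card := by
  rw [← he.eq_arc.2]

theorem IsEdge.cutOuterPos_eq_iff {c : Corolla} {e : Finset ℕ} (he : IsEdge c e) {x : ℕ}
    (hx : x < c.leaves) : cutOuterPos c e x = cutLeaf c e ↔ x ∈ e := by
  rw [he.mem_iff]
  exact he.cutData.collapsePos_eq_iff hx

theorem IsEdge.cutOuterPos_inj {c : Corolla} {e : Finset ℕ} (he : IsEdge c e) {x x' : ℕ}
    (hx : x < c.leaves) (hx' : x' < c.leaves) (hne : x ∉ e)
    (h : cutOuterPos c e x = cutOuterPos c e x') : x = x' := by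
  rw [he.mem_iff] at hne
  exact he.cutData.collapsePos_inj hx hx' hne h

theorem IsEdge.cutOuterPos_lt {c : Corolla} {e : Finset ℕ} (he : IsEdge c e) {x : ℕ}
    (hx : x < c.leaves) : cutOuterPos c e x < c.leaves + 1 - e.card :=
  he.cutData.collapsePos_lt hx

theorem IsEdge.cutOuterPos_zero {c : Corolla} {e : Finset ℕ} (he : IsEdge c e) :
    cutOuterPos c e 0 = 0 := by
  have hn : 0 < c.leaves := by have := he.card_lt; omega
  by_cases hcut : CutsLeft c e
  · have h0 : 0 ∈ e := by
      cases c
      · exact hcut.elim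
      · exact hcut.elim
      · exact hcut
    rw [(he.cutOuterPos_eq_iff hn).2 h0, cutLeaf, if_pos hcut]
  · have := he.cutData.collapsePos_eq hn
    have h2 := he.two_le_card
    rw [cutOuterPos]
    have hr : cutRotation c e = 0 := if_neg hcut
    omega

/-- The two thick leaves are never cut off together, so they stay distinct after the collapse. This
makes the truncated `t - 1` in `Corolla.resize` harmless. -/
theorem IsEdge.lastThick_pos {k m : ℕ} {e : Finset ℕ} (he : IsEdge (.I k m) e) :
    1 ≤ cutOuterPos (.I k m) e (k + 1) := by
  rw [Nat.one_le_iff_ne_zero]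
  intro h0
  have h1 : k + 1 < (Corolla.I k m).leaves := by simp only [Corolla.leaves]; omega
  have h2 : 0 < (Corolla.I k m).leaves := by simp only [Corolla.leaves]; omega
  rw [← he.cutOuterPos_zero] at h0
  by_cases hk : k + 1 ∈ e
  · rw [(he.cutOuterPos_eq_iff h1).2 hk] at h0
    exact he.not_both ⟨(he.cutOuterPos_eq_iff h2).1 h0.symm, hk⟩
  · have := he.cutOuterPos_inj h1 h2 hk h0
    omega

theorem IsEdge.leaves_cutOuter {c : Corolla} {e : Finset ℕ} (he : IsEdge c e) :
    (cutOuter c e).leaves = c.leaves + 1 - e.card := by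
  cases c with
  | T n => rfl
  | M j k =>
    have := he.cutOuterPos_lt (x := j) (by simp only [Corolla.leaves]; omega)
    simp only [cutOuter, Corolla.resize, Corolla.lastThick]
    rw [Corolla.leaves]
    omega
  | I k m =>
    have h1 := he.cutOuterPos_lt (x := k + 1) (by simp only [Corolla.leaves]; omega)
    have h2 := he.lastThick_pos
    simp only [cutOuter, Corolla.resize, Corolla.lastThick]
    rw [Corolla.leaves]
    omega

theorem IsEdge.valid_cutOuter {c : Corolla} {e : Finset ℕ} (he : IsEdge c e) :
    (cutOuter c e).Valid := by
  have h1 := he.leaves_cutOuter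
  have h2 := he.card_lt
  cases c with
  | T n =>
    simp only [cutOuter, Corolla.resize, Corolla.leaves, Corolla.Valid] at *
    omega
  | M j k =>
    simp only [cutOuter, Corolla.resize, Corolla.leaves, Corolla.Valid] at *
    omega
  | I k m => trivial

theorem IsEdge.opposite_cutOuter {c : Corolla} {e : Finset ℕ} (he : IsEdge c e) :
    (cutOuter c e).opposite = cutOuterPos c e c.opposite := by
  have h1 := he.card_lt
  have h2 := he.two_le_card
  have hlin : ∀ x, x + 1 = c.leaves → ¬ CutsLeft c e →
      cutOuterPos c e x = c.leaves - e.card := by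
    intro x hx hcut
    have := he.cutData.collapsePos_eq (x := x) (by omega)
    have h3 := he.cutData.le
    have hr : cutRotation c e = 0 := if_neg hcut
    rw [cutOuterPos]
    omega
  cases c with
  | T n =>
    have := hlin (n - 1) (by simp only [Corolla.leaves] at *; omega) id
    simp only [Corolla.opposite]
    rw [this]
    simp only [cutOuter, Corolla.resize, Corolla.leaves] at *
    omega
  | M j k =>
    have := hlin (j + k) (by simp only [Corolla.leaves] at *; omega) id
    have h3 := he.cutOuterPos_lt (x := j) (by simp only [Corolla.leaves]; omega)
    simp only [Corolla.opposite]
    rw [this]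
    simp only [cutOuter, Corolla.resize, Corolla.leaves, Corolla.lastThick] at *
    omega
  | I k m =>
    have h3 := he.lastThick_pos
    simp only [cutOuter, Corolla.resize, Corolla.opposite, Corolla.lastThick]
    omega

theorem cutInner_cases (c : Corolla) (e : Finset ℕ) :
    (c.thickLeaves ∩ e = ∅ ∧ cutInner c e = .T e.card) ∨
      ∃ x ∈ c.thickLeaves, x ∈ e ∧ x = (c.thickLeaves ∩ e).sup id ∧
        cutInner c e = .M (cutInnerPos c e x) (e.card - 1 - cutInnerPos c e x) := by
  by_cases h : c.thickLeaves ∩ e = ∅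
  · exact Or.inl ⟨h, by rw [cutInner, if_pos h]⟩
  · refine Or.inr ⟨(c.thickLeaves ∩ e).sup id, ?_⟩
    obtain ⟨x, hx, hx'⟩ := Finset.exists_mem_eq_sup _ (Finset.nonempty_iff_ne_empty.2 h) id
    rw [hx']
    obtain ⟨h1, h2⟩ := Finset.mem_inter.1 hx
    refine ⟨h1, h2, rfl, ?_⟩
    rw [cutInner, if_neg h, hx']

theorem IsEdge.cutInnerPos_lt {c : Corolla} {e : Finset ℕ} (he : IsEdge c e) {x : ℕ}
    (hx : x ∈ e) : cutInnerPos c e x < e.card :=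
  he.cutData.cutPos_lt (he.mem_iff.1 hx)

theorem IsEdge.cutInner_spec {c : Corolla} {e : Finset ℕ} (he : IsEdge c e) :
    (cutInner c e).leaves = e.card ∧ (cutInner c e).Valid ∧
      (cutInner c e).opposite = e.card - 1 ∧
      ((cutInner c e).rootColor = .thick ↔ ∃ x ∈ c.thickLeaves, x ∈ e) ∧
      (cutInner c e).rootColor ≠ .empty := by
  have h2 := he.two_le_card
  rcases cutInner_cases c e with ⟨h, h'⟩ | ⟨x, hx, hxe, -, h'⟩
  · rw [h']
    refine ⟨rfl, h2, rfl, ?_, by simp [Corolla.rootColor]⟩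
    simp only [Corolla.rootColor, reduceCtorEq, false_iff]
    rintro ⟨x, hx, hxe⟩
    exact Finset.notMem_empty x (h ▸ Finset.mem_inter.2 ⟨hx, hxe⟩)
  · have := he.cutInnerPos_lt hxe
    rw [h']
    refine ⟨?_, ?_, ?_, ?_, by simp [Corolla.rootColor]⟩
    · simp only [Corolla.leaves]; omega
    · simp only [Corolla.Valid]; omega
    · simp only [Corolla.opposite]; omega
    · simp only [Corolla.rootColor, true_iff]
      exact ⟨x, hx, hxe⟩

theorem IsEdge.leaves_add {c : Corolla} {e : Finset ℕ} (he : IsEdge c e) :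
    (cutOuter c e).leaves + (cutInner c e).leaves - 1 = c.leaves := by
  rw [he.leaves_cutOuter, he.cutInner_spec.1]
  have := he.card_lt
  omega

/-- Matching colors guarantee that composing the two parts does not fall into the default value `0`
of `compGenC`. -/
theorem IsEdge.leafColor_cutLeaf {c : Corolla} {e : Finset ℕ} (he : IsEdge c e) :
    (cutOuter c e).leafColor (cutLeaf c e) = (cutInner c e).rootColor := by
  have key : cutLeaf c e ∈ (cutOuter c e).thickLeaves ↔ ∃ x ∈ c.thickLeaves, x ∈ e := by
    cases c with
    | T n => simp [cutOuter, Corolla.resize, Corolla.thickLeaves]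
    | M j k =>
      have h1 := he.cutOuterPos_eq_iff (x := j) (by simp only [Corolla.leaves]; omega)
      simp only [cutOuter, Corolla.resize, Corolla.thickLeaves, Corolla.lastThick,
        Finset.mem_singleton, exists_eq_left]
      rw [← h1, eq_comm]
    | I k m =>
      have h1 := he.cutOuterPos_eq_iff (x := k + 1) (by simp only [Corolla.leaves]; omega)
      have h2 := he.cutOuterPos_eq_iff (x := 0) (by simp only [Corolla.leaves]; omega)
      have h3 := he.lastThick_pos
      rw [he.cutOuterPos_zero] at h2
      simp only [cutOuter, Corolla.resize, Corolla.thickLeaves, Corolla.lastThick,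
        Finset.mem_singleton, Finset.mem_insert, exists_eq_or_imp, exists_eq_left]
      rw [← h1, ← h2, Nat.sub_add_cancel h3, eq_comm (a := 0), eq_comm (b := cutLeaf _ _)]
  obtain ⟨-, -, -, h1, h2⟩ := he.cutInner_spec
  rw [Corolla.leafColor]
  split_ifs with h
  · exact (h1.2 (key.1 h)).symm
  · have h3 := mt h1.1 (mt key.2 h)
    revert h2 h3
    cases (cutInner c e).rootColor <;> simp

/-- In the rotated case the inner part is a module tree whose thick leaf is the leaf `0` of `c`. The
number of leaves to its left is the distance from the first leaf of `e` to `0`, which is the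
rotation used for cutting. -/
theorem IsEdge.rotation_eq {c : Corolla} {e : Finset ℕ} (he : IsEdge c e) :
    rotation (cutOuter c e) (cutLeaf c e) (cutInner c e) = cutRotation c e := by
  cases c with
  | T n => rfl
  | M j k => rfl
  | I k m =>
    by_cases hcut : CutsLeft (.I k m) e
    · have h0 : 0 ∈ e := hcut
      rw [cutLeaf, if_pos hcut, cutRotation, if_pos hcut]
      rcases cutInner_cases (.I k m) e with ⟨h, h'⟩ | ⟨x, hx, hxe, -, h'⟩
      · exact absurd (h ▸ Finset.mem_inter.2 ⟨by simp [Corolla.thickLeaves], h0⟩)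
          (Finset.notMem_empty 0)
      · have hx0 : x = 0 := by
          simp only [Corolla.thickLeaves, Finset.mem_insert, Finset.mem_singleton] at hx
          refine hx.resolve_right fun h => he.not_both ⟨h0, ?_⟩
          rw [h] at hxe
          exact hxe
        rw [h', hx0]
        simp only [cutOuter, Corolla.resize, rotation, cutInnerPos, zero_add]
    · have h0 : 0 ∉ e := hcut
      have hpos : 0 < cutLeaf (.I k m) e := by
        rw [cutLeaf, if_neg hcut, Nat.pos_iff_ne_zero]
        intro h
        apply h0
        rw [he.mem_iff, h, mem_arc (by have := he.card_lt; omega)]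
        have := he.card_lt
        have := he.two_le_card
        omega
      rw [cutRotation, if_neg hcut]
      obtain ⟨b, hb⟩ := Nat.exists_eq_succ_of_ne_zero hpos.ne'
      rw [hb]
      rfl

/-- A corolla is determined by its kind, its number of leaves and, unless it is a tree, the position
`τ` of its last thick leaf. Grafting returns `τ` to its place: as an inner position if `e` cuts it
off, as an outer position otherwise. -/
theorem IsEdge.graft_eq {c : Corolla} {e : Finset ℕ} (he : IsEdge c e) :
    (cutOuter c e).graft (cutLeaf c e) (cutInner c e) = c := by
  have hτ : ∀ τ ∈ c.thickLeaves, (∀ x ∈ c.thickLeaves, x ∈ e → τ ∈ e → x = τ) →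
      τ < c.leaves → (cutOuter c e).lastThick = cutOuterPos c e τ →
      (if cutLeaf c e = (cutOuter c e).lastThick then
        innerPos c.leaves (cutLeaf c e) (cutRotation c e) (cutInner c e).lastThick
      else outerPos c.leaves e.card (cutLeaf c e) (cutRotation c e) (cutOuter c e).lastThick) =
        τ := by
    intro τ hτ hu hτn hlast
    rw [hlast]
    split_ifs with h
    · have hτe := (he.cutOuterPos_eq_iff hτn).1 h.symm
      rcases cutInner_cases c e with ⟨h1, h'⟩ | ⟨x, hx, hxe, -, h'⟩
      · exact absurd (h1 ▸ Finset.mem_inter.2 ⟨hτ, hτe⟩) (Finset.notMem_empty τ)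
      · rw [h', hu x hx hxe hτe]
        exact he.cutData.innerPos_cutPos (he.mem_iff.1 hτe)
    · obtain ⟨h1, h2, h3⟩ := he.cutData.outerPos_eq (he.cutOuterPos_lt hτn) (Ne.symm h)
      rw [← he.mem_iff] at h2
      exact he.cutOuterPos_inj h1 hτn h2 h3
  unfold Corolla.graft
  simp only [he.leaves_add, he.rotation_eq]
  simp only [he.cutInner_spec.1]
  cases c with
  | T n => rfl
  | M j k =>
    rw [hτ j (by simp [Corolla.thickLeaves]) (by simp [Corolla.thickLeaves])
      (by simp only [Corolla.leaves]; omega) rfl]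
    simp only [cutOuter, Corolla.resize, Corolla.leaves]
    congr 1
    omega
  | I k m =>
    rw [hτ (k + 1) (by simp [Corolla.thickLeaves]) ?_
      (by simp only [Corolla.leaves]; omega) (Nat.sub_add_cancel he.lastThick_pos)]
    · simp only [cutOuter, Corolla.resize, Corolla.leaves]
      congr 1
      omega
    · intro x hx hxe hk
      simp only [Corolla.thickLeaves, Finset.mem_insert, Finset.mem_singleton] at hx
      refine hx.resolve_left fun h => he.not_both ⟨h ▸ hxe, hk⟩

/-! ### Cutting and grafting diagrams -/

section Cutting

variable {c : Corolla} {e : Finset ℕ}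

theorem IsEdge.outerEdge_eq (he : IsEdge c e) (d : Finset ℕ) :
    outerEdge (cutOuter c e) (cutLeaf c e) (cutInner c e) d =
      CutData.preimage c.leaves e.card (cutLeaf c e) (cutRotation c e) d := by
  unfold outerEdge CutData.preimage
  simp only [he.leaves_add, he.rotation_eq]
  rw [he.cutInner_spec.1]

theorem IsEdge.mem_outerEdge (he : IsEdge c e) {d : Finset ℕ} {x : ℕ} :
    x ∈ outerEdge (cutOuter c e) (cutLeaf c e) (cutInner c e) d ↔
      x < c.leaves ∧ cutOuterPos c e x ∈ d := by
  rw [he.outerEdge_eq]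
  exact CutData.mem_preimage

theorem IsEdge.innerEdge_eq (he : IsEdge c e) (d : Finset ℕ) :
    innerEdge (cutOuter c e) (cutLeaf c e) (cutInner c e) d =
      d.image (innerPos c.leaves (cutLeaf c e) (cutRotation c e)) := by
  unfold innerEdge
  rw [he.leaves_add, he.rotation_eq]

theorem IsEdge.newEdge_eq (he : IsEdge c e) :
    newEdge (cutOuter c e) (cutLeaf c e) (cutInner c e) = e := by
  rw [newEdge, he.innerEdge_eq, he.cutInner_spec.1, he.cutData.image_innerPos_range, ← he.eq_arc.2]

theorem IsEdge.isEdge_image_outer (he : IsEdge c e) {d : Finset ℕ} (hd : IsEdge c d)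
    (hc : d ⊆ e ∨ e ⊆ d ∨ Disjoint d e) (hde : ¬ d ⊆ e) :
    IsEdge (cutOuter c e) (d.image (cutOuterPos c e)) ∧
      outerEdge (cutOuter c e) (cutLeaf c e) (cutInner c e) (d.image (cutOuterPos c e)) = d := by
  obtain ⟨s', l', h1, h2, h3, h4, h5⟩ := isEdge_iff.1 hd
  have hcd := he.cutData
  rw [he.eq_arc.2, h4] at hc hde
  obtain ⟨s₁, l₁, h6, h7, h8, h9⟩ := hcd.exists_preimage_eq h1 h2 h3 hc hde
  rw [← h4] at h9
  have hn := he.card_lt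
  have h10 : d.image (cutOuterPos c e) = arc (c.leaves + 1 - e.card) s₁ l₁ := by
    rw [h9]
    exact hcd.image_preimage (arc_subset_range (by omega))
  have hN := he.leaves_cutOuter
  refine ⟨isEdge_iff.2 ⟨s₁, l₁, by omega, h7, by omega, by rw [h10, hN], ?_⟩, ?_⟩
  · rintro ⟨ha, hb⟩
    rw [h10] at ha hb
    rw [he.opposite_cutOuter] at hb
    have hopp : c.opposite < c.leaves := by
      have := he.card_lt
      cases c <;> simp only [Corolla.opposite, Corolla.leaves] at * <;> omega
    refine h5 ⟨?_, ?_⟩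
    · rw [h9]
      refine CutData.mem_preimage.2 ⟨by omega, ?_⟩
      have := he.cutOuterPos_zero
      rw [cutOuterPos] at this
      rwa [this]
    · rw [h9]
      exact CutData.mem_preimage.2 ⟨hopp, hb⟩
  · rw [h10, he.outerEdge_eq, ← h9]

theorem IsEdge.isEdge_outerEdge (he : IsEdge c e) {d : Finset ℕ} (hd : IsEdge (cutOuter c e) d) :
    IsEdge c (outerEdge (cutOuter c e) (cutLeaf c e) (cutInner c e) d) ∧
      (outerEdge (cutOuter c e) (cutLeaf c e) (cutInner c e) d).image (cutOuterPos c e) = d ∧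
      ¬ outerEdge (cutOuter c e) (cutLeaf c e) (cutInner c e) d ⊆ e ∧
      (e ⊆ outerEdge (cutOuter c e) (cutLeaf c e) (cutInner c e) d ∨
        Disjoint e (outerEdge (cutOuter c e) (cutLeaf c e) (cutInner c e) d)) := by
  have hsub := hd.subset_range
  have h2 := hd.two_le_card
  obtain ⟨s₁, l₁, h3, h4, h5, h6, h7⟩ := isEdge_iff.1 hd
  have hcd := he.cutData
  rw [he.leaves_cutOuter] at hsub h3 h5 h6
  rw [he.outerEdge_eq]
  refine ⟨?_, hcd.image_preimage hsub, ?_, ?_⟩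
  · obtain ⟨s', l', h8, h9, h10, h11⟩ := hcd.preimage_arc h3 h4 h5
    rw [← h6] at h11
    refine isEdge_iff.2 ⟨s', l', h8, h9, h10, h11, ?_⟩
    rintro ⟨ha, hb⟩
    refine h7 ⟨?_, ?_⟩
    · have := (CutData.mem_preimage.1 ha).2
      rwa [← cutOuterPos, he.cutOuterPos_zero] at this
    · rw [he.opposite_cutOuter]
      exact (CutData.mem_preimage.1 hb).2
  · have := hcd.not_preimage_subset hsub h2
    rwa [← he.eq_arc.2] at this
  · have := hcd.preimage_subset_or d
    rwa [← he.eq_arc.2] at this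

theorem IsEdge.isEdge_image_inner (he : IsEdge c e) {d : Finset ℕ} (hd : IsEdge c d)
    (hde : d ⊂ e) : IsEdge (cutInner c e) (d.image (cutInnerPos c e)) ∧
      innerEdge (cutOuter c e) (cutLeaf c e) (cutInner c e) (d.image (cutInnerPos c e)) = d := by
  obtain ⟨s', l', h1, h2, h3, h4, -⟩ := isEdge_iff.1 hd
  have hcd := he.cutData
  obtain ⟨hl, -, hopp, -⟩ := he.cutInner_spec
  constructor
  · rw [he.eq_arc.2, h4] at hde
    obtain ⟨s₁, h5, h6, h7⟩ := hcd.exists_image_innerPos_eq h1 h2 h3 hde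
    rw [← h4] at h7
    have h8 : d.image (cutInnerPos c e) = arc e.card s₁ l' := h7
    refine isEdge_iff.2 ⟨s₁, l', by omega, h2, by omega, by rw [h8, hl], ?_⟩
    rw [hopp, h8, mem_arc (by omega), mem_arc (by omega)]
    omega
  · rw [he.innerEdge_eq]
    exact hcd.image_innerPos_image (he.eq_arc.2 ▸ hde.1)

theorem IsEdge.isEdge_innerEdge (he : IsEdge c e) {d : Finset ℕ} (hd : IsEdge (cutInner c e) d) :
    IsEdge c (innerEdge (cutOuter c e) (cutLeaf c e) (cutInner c e) d) ∧
      (innerEdge (cutOuter c e) (cutLeaf c e) (cutInner c e) d).image (cutInnerPos c e) = d ∧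
      innerEdge (cutOuter c e) (cutLeaf c e) (cutInner c e) d ⊂ e := by
  have hcd := he.cutData
  obtain ⟨hl, -, hopp, -⟩ := he.cutInner_spec
  have hsub := hd.subset_range
  have hcard := hd.card_lt
  obtain ⟨s₁, l₁, h3, h4, h5, h6, h7⟩ := isEdge_iff.1 hd
  rw [hl] at hsub h3 h5 h6 hcard
  rw [hopp, h6, mem_arc (by omega), mem_arc (by omega)] at h7
  obtain ⟨s', hs', h8⟩ := hcd.image_innerPos_arc h3 (l₁ := l₁) (by omega)
  rw [← h6, ← he.innerEdge_eq] at h8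
  have hss : innerEdge (cutOuter c e) (cutLeaf c e) (cutInner c e) d ⊂ e := by
    refine Finset.ssubset_iff_subset_ne.2 ⟨?_, fun h => ?_⟩
    · rw [he.innerEdge_eq]
      conv_rhs => rw [he.eq_arc.2, ← hcd.image_innerPos_range]
      exact Finset.image_subset_image hsub
    · have := Finset.card_image_le (s := d)
        (f := innerPos c.leaves (cutLeaf c e) (cutRotation c e))
      rw [← he.innerEdge_eq, h] at this
      omega
  have hn := he.card_lt
  refine ⟨isEdge_iff.2 ⟨s', l₁, hs', h4, by omega, h8, fun h => ?_⟩, ?_, hss⟩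
  · exact he.not_both ⟨hss.1 h.1, hss.1 h.2⟩
  · rw [he.innerEdge_eq]
    exact hcd.image_image_innerPos hsub

/-- The collapse maps onto the leaves of the outer part, so taking preimages both preserves and
reflects inclusion and disjointness. -/
theorem IsEdge.outerEdge_laminar (he : IsEdge c e) {d d' : Finset ℕ}
    (hd : d ⊆ Finset.range (cutOuter c e).leaves) (hd' : d' ⊆ Finset.range (cutOuter c e).leaves) :
    (d ⊆ d' ∨ d' ⊆ d ∨ Disjoint d d') ↔
      (outerEdge (cutOuter c e) (cutLeaf c e) (cutInner c e) d ⊆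
          outerEdge (cutOuter c e) (cutLeaf c e) (cutInner c e) d' ∨
        outerEdge (cutOuter c e) (cutLeaf c e) (cutInner c e) d' ⊆
          outerEdge (cutOuter c e) (cutLeaf c e) (cutInner c e) d ∨
        Disjoint (outerEdge (cutOuter c e) (cutLeaf c e) (cutInner c e) d)
          (outerEdge (cutOuter c e) (cutLeaf c e) (cutInner c e) d')) := by
  rw [he.leaves_cutOuter] at hd hd'
  have key : ∀ {u v : Finset ℕ}, u ⊆ Finset.range (c.leaves + 1 - e.card) → (u ⊆ v ↔
      outerEdge (cutOuter c e) (cutLeaf c e) (cutInner c e) u ⊆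
        outerEdge (cutOuter c e) (cutLeaf c e) (cutInner c e) v) := by
    intro u v hu
    constructor
    · intro h x hx
      rw [he.mem_outerEdge] at hx ⊢
      exact ⟨hx.1, h hx.2⟩
    · intro h p hp
      obtain ⟨x, hx, rfl⟩ := he.cutData.exists_collapsePos_eq (Finset.mem_range.1 (hu hp))
      exact (he.mem_outerEdge.1 (h (he.mem_outerEdge.2 ⟨hx, hp⟩))).2
  refine or_congr (key hd) (or_congr (key hd') ?_)
  rw [Finset.disjoint_left, Finset.disjoint_left]
  constructor
  · intro h x hx hx'
    rw [he.mem_outerEdge] at hx hx'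
    exact h hx.2 hx'.2
  · intro h p hp hp'
    obtain ⟨x, hx, rfl⟩ := he.cutData.exists_collapsePos_eq (Finset.mem_range.1 (hd hp))
    exact h (he.mem_outerEdge.2 ⟨hx, hp⟩) (he.mem_outerEdge.2 ⟨hx, hp'⟩)

theorem image_laminar {α β : Type*} [DecidableEq β] {f : α → β} {U : Finset α}
    (hf : Set.InjOn f U) {d d' : Finset α} (hd : d ⊆ U) (hd' : d' ⊆ U)
    (h : d ⊆ d' ∨ d' ⊆ d ∨ Disjoint d d') :
    d.image f ⊆ d'.image f ∨ d'.image f ⊆ d.image f ∨ Disjoint (d.image f) (d'.image f) := by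
  rcases h with h | h | h
  · exact Or.inl (Finset.image_subset_image h)
  · exact Or.inr (Or.inl (Finset.image_subset_image h))
  · refine Or.inr (Or.inr (Finset.disjoint_left.2 fun y hy hy' => ?_))
    obtain ⟨x, hx, rfl⟩ := Finset.mem_image.1 hy
    obtain ⟨x', hx', hxx⟩ := Finset.mem_image.1 hy'
    rw [hf (hd' hx') (hd hx) hxx] at hx'
    exact Finset.disjoint_left.1 h hx hx'

theorem IsEdge.cutInnerPos_injOn (he : IsEdge c e) : Set.InjOn (cutInnerPos c e) e := by
  intro x hx x' hx' h
  have h1 := he.cutData.innerPos_cutPos (he.mem_iff.1 hx)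
  have h2 := he.cutData.innerPos_cutPos (he.mem_iff.1 hx')
  rw [cutInnerPos, cutInnerPos] at h
  rw [← h1, ← h2, h]

theorem IsEdge.innerPos_injOn (he : IsEdge c e) :
    Set.InjOn (innerPos c.leaves (cutLeaf c e) (cutRotation c e)) (Finset.range e.card) := by
  intro x hx x' hx' h
  have h1 := he.cutData.cutPos_innerPos (Finset.mem_range.1 hx)
  have h2 := he.cutData.cutPos_innerPos (Finset.mem_range.1 hx')
  rw [← h1, ← h2, h]

variable {D : Finset (Finset ℕ)}

/-- Every edge other than `e` is either properly contained in `e` or not contained in it, so the two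
parts together with `e` account for all of `D`. Regrafting inverts both renamings of edges, hence
they are injective and the edges can be counted. -/
theorem IsDiagram.cut (hD : IsDiagram c D) (he : e ∈ D) :
    IsDiagram (cutOuter c e) (outerPart c D e) ∧ IsDiagram (cutInner c e) (innerPart c D e) ∧
      graftEdges (cutOuter c e) (outerPart c D e) (cutLeaf c e) (cutInner c e)
        (innerPart c D e) = D ∧
      D.card = (outerPart c D e).card + (innerPart c D e).card + 1 := by
  have hE := hD.1 e he
  have hout : ∀ d ∈ D.filter (fun d => ¬ d ⊆ e), IsEdge (cutOuter c e)
      (d.image (cutOuterPos c e)) ∧ outerEdge (cutOuter c e) (cutLeaf c e) (cutInner c e)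
        (d.image (cutOuterPos c e)) = d := by
    intro d hd
    obtain ⟨hd, hde⟩ := Finset.mem_filter.1 hd
    exact hE.isEdge_image_outer (hD.1 d hd) (hD.2 d hd e he) hde
  have hinn : ∀ d ∈ D.filter (fun d => d ⊂ e), IsEdge (cutInner c e)
      (d.image (cutInnerPos c e)) ∧ innerEdge (cutOuter c e) (cutLeaf c e) (cutInner c e)
        (d.image (cutInnerPos c e)) = d := by
    intro d hd
    obtain ⟨hd, hde⟩ := Finset.mem_filter.1 hd
    exact hE.isEdge_image_inner (hD.1 d hd) hde
  have hsplit : D = insert e (D.filter (fun d => ¬ d ⊆ e) ∪ D.filter (fun d => d ⊂ e)) := by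
    ext d
    simp only [Finset.mem_insert, Finset.mem_union, Finset.mem_filter]
    constructor
    · intro hd
      by_cases hde : d ⊆ e
      · rcases hde.eq_or_ssubset with h | h
        · exact Or.inl h
        · exact Or.inr (Or.inr ⟨hd, h⟩)
      · exact Or.inr (Or.inl ⟨hd, hde⟩)
    · rintro (rfl | h | h)
      · exact he
      · exact h.1
      · exact h.1
  refine ⟨⟨?_, ?_⟩, ⟨?_, ?_⟩, ?_, ?_⟩
  · intro d hd
    obtain ⟨d, hd', rfl⟩ := Finset.mem_image.1 hd
    exact (hout d hd').1
  · intro d hd d' hd'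
    obtain ⟨d, hdF, rfl⟩ := Finset.mem_image.1 hd
    obtain ⟨d', hdF', rfl⟩ := Finset.mem_image.1 hd'
    rw [hE.outerEdge_laminar (hout d hdF).1.subset_range (hout d' hdF').1.subset_range,
      (hout d hdF).2, (hout d' hdF').2]
    exact hD.2 d (Finset.mem_filter.1 hdF).1 d' (Finset.mem_filter.1 hdF').1
  · intro d hd
    obtain ⟨d, hd', rfl⟩ := Finset.mem_image.1 hd
    exact (hinn d hd').1
  · intro d hd d' hd'
    obtain ⟨d, hdF, rfl⟩ := Finset.mem_image.1 hd
    obtain ⟨d', hdF', rfl⟩ := Finset.mem_image.1 hd'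
    exact image_laminar hE.cutInnerPos_injOn (Finset.mem_filter.1 hdF).2.1
      (Finset.mem_filter.1 hdF').2.1
      (hD.2 d (Finset.mem_filter.1 hdF).1 d' (Finset.mem_filter.1 hdF').1)
  · rw [graftEdges, hE.newEdge_eq, outerPart, innerPart, Finset.image_image, Finset.image_image]
    conv_rhs => rw [hsplit]
    congr 2
    · conv_rhs => rw [← Finset.image_id (s := D.filter (fun d => ¬ d ⊆ e))]
      exact Finset.image_congr fun d hd => (hout d hd).2
    · conv_rhs => rw [← Finset.image_id (s := D.filter (fun d => d ⊂ e))]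
      exact Finset.image_congr fun d hd => (hinn d hd).2
  · conv_lhs => rw [hsplit]
    rw [Finset.card_insert_of_notMem (by simp),
      Finset.card_union_of_disjoint, outerPart, innerPart, Finset.card_image_of_injOn,
      Finset.card_image_of_injOn]
    · intro d hd d' hd' h
      rw [← (hinn d hd).2, ← (hinn d' hd').2]
      exact congrArg _ h
    · intro d hd d' hd' h
      rw [← (hout d hd).2, ← (hout d' hd').2]
      exact congrArg _ h
    · rw [Finset.disjoint_left]
      intro d hd hd'
      exact (Finset.mem_filter.1 hd).2 (Finset.mem_filter.1 hd').2.1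

/-- An outer edge, read on `c`, contains `e` or is disjoint from it, so it is compatible with
everything inside `e`. Compatibility within each part is transported by the renaming. -/
theorem IsEdge.graft_isDiagram (he : IsEdge c e) {D₁ D₂ : Finset (Finset ℕ)}
    (h₁ : IsDiagram (cutOuter c e) D₁) (h₂ : IsDiagram (cutInner c e) D₂) :
    IsDiagram c (graftEdges (cutOuter c e) D₁ (cutLeaf c e) (cutInner c e) D₂) ∧
      outerPart c (graftEdges (cutOuter c e) D₁ (cutLeaf c e) (cutInner c e) D₂) e = D₁ ∧
      innerPart c (graftEdges (cutOuter c e) D₁ (cutLeaf c e) (cutInner c e) D₂) e = D₂ := by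
  have hmem : ∀ d, d ∈ graftEdges (cutOuter c e) D₁ (cutLeaf c e) (cutInner c e) D₂ ↔
      d = e ∨ (∃ d' ∈ D₁, outerEdge (cutOuter c e) (cutLeaf c e) (cutInner c e) d' = d) ∨
        ∃ d' ∈ D₂, innerEdge (cutOuter c e) (cutLeaf c e) (cutInner c e) d' = d := by
    intro d
    simp only [graftEdges, he.newEdge_eq, Finset.mem_insert, Finset.mem_union, Finset.mem_image]
  have hout := fun d hd => he.isEdge_outerEdge (h₁.1 d hd)
  have hinn := fun d hd => he.isEdge_innerEdge (h₂.1 d hd)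
  refine ⟨⟨?_, ?_⟩, ?_, ?_⟩
  · intro d hd
    rcases (hmem d).1 hd with rfl | ⟨d', hd', rfl⟩ | ⟨d', hd', rfl⟩
    · exact he
    · exact (hout d' hd').1
    · exact (hinn d' hd').1
  · have hei : ∀ d ∈ D₁, ∀ u ⊆ e,
        u ⊆ outerEdge (cutOuter c e) (cutLeaf c e) (cutInner c e) d ∨
          Disjoint u (outerEdge (cutOuter c e) (cutLeaf c e) (cutInner c e) d) := by
      intro d hd u hu
      exact (hout d hd).2.2.2.imp (fun h => hu.trans h) fun h => h.mono_left hu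
    intro d hd d' hd'
    rcases (hmem d).1 hd with rfl | ⟨u, hu, rfl⟩ | ⟨u, hu, rfl⟩ <;>
    rcases (hmem d').1 hd' with h | ⟨v, hv, rfl⟩ | ⟨v, hv, rfl⟩
    · simp [h]
    · rcases hei v hv _ subset_rfl with h | h
      · exact Or.inl h
      · exact Or.inr (Or.inr h)
    · exact Or.inr (Or.inl (hinn v hv).2.2.1)
    · subst h
      rcases hei u hu _ subset_rfl with h | h
      · exact Or.inr (Or.inl h)
      · exact Or.inr (Or.inr h.symm)
    · exact (he.outerEdge_laminar (h₁.1 u hu).subset_range (h₁.1 v hv).subset_range).1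
        (h₁.2 u hu v hv)
    · rcases hei u hu _ (hinn v hv).2.2.1 with h | h
      · exact Or.inr (Or.inl h)
      · exact Or.inr (Or.inr h.symm)
    · subst h
      exact Or.inl (hinn u hu).2.2.1
    · rcases hei v hv _ (hinn u hu).2.2.1 with h | h
      · exact Or.inl h
      · exact Or.inr (Or.inr h)
    · rw [he.innerEdge_eq, he.innerEdge_eq]
      have hl := he.cutInner_spec.1
      exact image_laminar he.innerPos_injOn (hl ▸ (h₂.1 u hu).subset_range)
        (hl ▸ (h₂.1 v hv).subset_range) (h₂.2 u hu v hv)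
  · ext d
    simp only [outerPart, Finset.mem_image, Finset.mem_filter]
    constructor
    · rintro ⟨u, ⟨hu, hue⟩, rfl⟩
      rcases (hmem u).1 hu with rfl | ⟨v, hv, rfl⟩ | ⟨v, hv, rfl⟩
      · exact absurd subset_rfl hue
      · rwa [(hout v hv).2.1]
      · exact absurd (hinn v hv).2.2.1 hue
    · intro hd
      exact ⟨_, ⟨(hmem _).2 (Or.inr (Or.inl ⟨d, hd, rfl⟩)), (hout d hd).2.2.1⟩, (hout d hd).2.1⟩
  · ext d
    simp only [innerPart, Finset.mem_image, Finset.mem_filter]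
    constructor
    · rintro ⟨u, ⟨hu, hue⟩, rfl⟩
      rcases (hmem u).1 hu with rfl | ⟨v, hv, rfl⟩ | ⟨v, hv, rfl⟩
      · exact absurd subset_rfl hue.2
      · exact absurd hue.1 (hout v hv).2.2.1
      · rwa [(hinn v hv).2.1]
    · intro hd
      exact ⟨_, ⟨(hmem _).2 (Or.inr (Or.inr ⟨d, hd, rfl⟩)), (hinn d hd).2.2⟩, (hinn d hd).2.1⟩

theorem mem_graftEdges_newEdge (he : IsEdge c e) (D₁ D₂ : Finset (Finset ℕ)) :
    e ∈ graftEdges (cutOuter c e) D₁ (cutLeaf c e) (cutInner c e) D₂ := by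
  rw [graftEdges, he.newEdge_eq]
  exact Finset.mem_insert_self _ _

theorem IsEdge.cutLeaf_lt (he : IsEdge c e) : cutLeaf c e < (cutOuter c e).leaves := by
  have h1 := he.eq_arc
  have h2 := he.card_lt
  have h3 := he.two_le_card
  have h4 := (he.cutOuterPos_eq_iff h1.1).2 (by
    rw [he.mem_iff, mem_arc (by omega)]
    omega)
  rw [he.leaves_cutOuter, ← h4]
  exact he.cutOuterPos_lt h1.1

/-- Cutting a binary diagram gives binary diagrams. -/
theorem IsBinary.cut (hB : IsBinary c D) (he : e ∈ D) :
    IsBinary (cutOuter c e) (outerPart c D e) ∧ IsBinary (cutInner c e) (innerPart c D e) := by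
  have hE := hB.1.1 e he
  obtain ⟨h1, h2, -, h3⟩ := hB.1.cut he
  have h4 := (isBinary_iff.1 hB).2
  -- The upper bounds for the two parts add up to the number of edges of `D` other than `e`, so both
  -- bounds are attained.
  have h5 := h1.card_add_two_le hE.valid_cutOuter
  have h6 := h2.card_add_two_le hE.cutInner_spec.2.1
  have h7 := hE.leaves_add
  exact ⟨isBinary_iff.2 ⟨h1, by omega⟩, isBinary_iff.2 ⟨h2, by omega⟩⟩

theorem IsEdge.graft_isBinary (he : IsEdge c e) {D₁ D₂ : Finset (Finset ℕ)}
    (h₁ : IsBinary (cutOuter c e) D₁) (h₂ : IsBinary (cutInner c e) D₂) :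
    IsBinary c (graftEdges (cutOuter c e) D₁ (cutLeaf c e) (cutInner c e) D₂) := by
  obtain ⟨h3, h4, h5⟩ := he.graft_isDiagram h₁.1 h₂.1
  have h6 := (h3.cut (mem_graftEdges_newEdge he D₁ D₂)).2.2.2
  rw [h4, h5] at h6
  have h7 := he.leaves_add
  have h8 := (isBinary_iff.1 h₁).2
  have h9 := (isBinary_iff.1 h₂).2
  exact isBinary_iff.2 ⟨h3, by omega⟩

/-- The inner labels fill the leaves in `e` and the outer labels fill the others. So `cutPerm`,
defined as an inverse, really is one. -/
theorem graftLabels_perm (he : IsEdge c e) :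
    (graftLabels (cutOuter c e) (canonical (cutOuter c e)) (cutLeaf c e) (cutInner c e)
      (canonical (cutInner c e))).Perm (List.range c.leaves) := by
  have ha := he.cutLeaf_lt
  have hcd := he.cutData
  have hN := he.leaves_cutOuter
  have hget : (canonical (cutOuter c e)).getD (cutLeaf c e) 0 = cutLeaf c e := by
    simp [canonical, List.getD_eq_getElem?_getD, ha]
  have hinner : ∀ b, b < e.card → ∀ p, p < (cutOuter c e).leaves → p ≠ cutLeaf c e →
      innerPos c.leaves (cutLeaf c e) (cutRotation c e) b ≠
        outerPos c.leaves e.card (cutLeaf c e) (cutRotation c e) p := by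
    intro b hb p hp hpa h
    have h1 := hcd.innerPos_mem hb
    rw [h] at h1
    exact (hcd.outerPos_eq (hN ▸ hp) hpa).2.1 h1
  have houter : ∀ p, p < (cutOuter c e).leaves → p ≠ cutLeaf c e →
      ∀ p', p' < (cutOuter c e).leaves → p' ≠ cutLeaf c e →
      outerPos c.leaves e.card (cutLeaf c e) (cutRotation c e) p =
        outerPos c.leaves e.card (cutLeaf c e) (cutRotation c e) p' → p = p' := by
    intro p hp hpa p' hp' hpa' h
    rw [← (hcd.outerPos_eq (hN ▸ hp) hpa).2.2, h, (hcd.outerPos_eq (hN ▸ hp') hpa').2.2]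
  have htake : ∀ p, p ∈ (canonical (cutOuter c e)).take (cutLeaf c e) ↔ p < cutLeaf c e := by
    intro p
    rw [canonical, List.take_range, List.mem_range]
    omega
  have hdrop : ∀ p, p ∈ (canonical (cutOuter c e)).drop (cutLeaf c e + 1) ↔
      cutLeaf c e < p ∧ p < (cutOuter c e).leaves := by
    intro p
    rw [canonical, List.range_eq_range', List.drop_range', List.mem_range'_1]
    omega
  have hcan : ∀ b, b ∈ canonical (cutInner c e) ↔ b < e.card := by
    intro b
    rw [canonical, he.cutInner_spec.1, List.mem_range]
  unfold graftLabels
  simp only [hget, he.leaves_add, he.rotation_eq]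
  rw [he.cutInner_spec.1]
  rw [List.perm_ext_iff_of_nodup _ List.nodup_range]
  · intro x
    simp only [List.mem_append, List.mem_map, htake, hdrop, hcan, List.mem_range]
    constructor
    · rintro ((⟨p, hp, rfl⟩ | ⟨b, hb, rfl⟩) | ⟨p, hp, rfl⟩)
      · exact (hcd.outerPos_eq (by omega) (by omega)).1
      · exact (hcd.innerPos_eq hb).1
      · exact (hcd.outerPos_eq (by omega) (by omega)).1
    · intro hx
      by_cases hxe : x ∈ e
      · exact Or.inl (Or.inr ⟨_, hcd.cutPos_lt (he.mem_iff.1 hxe),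
          hcd.innerPos_cutPos (he.mem_iff.1 hxe)⟩)
      · have hp := he.cutOuterPos_lt hx
        have hpa := mt (he.cutOuterPos_eq_iff hx).1 hxe
        obtain ⟨h1, h2, h3⟩ := hcd.outerPos_eq hp hpa
        have h4 := hcd.collapsePos_inj h1 hx h2 h3
        rcases lt_or_gt_of_ne hpa with h | h
        · exact Or.inl (Or.inl ⟨_, h, h4⟩)
        · exact Or.inr ⟨_, ⟨h, by omega⟩, h4⟩
  · have hnd : (canonical (cutOuter c e)).Nodup := List.nodup_range
    rw [List.nodup_append, List.nodup_append]
    refine ⟨⟨?_, ?_, ?_⟩, ?_, ?_⟩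
    · refine List.Nodup.map_on ?_ (hnd.sublist (List.take_sublist _ _))
      intro p hp p' hp' h
      rw [htake] at hp hp'
      exact houter p (by omega) (by omega) p' (by omega) (by omega) h
    · refine List.Nodup.map_on ?_ List.nodup_range
      intro b hb b' hb' h
      rw [hcan] at hb hb'
      exact he.innerPos_injOn (by simpa using hb) (by simpa using hb') h
    · intro x hx y hy
      obtain ⟨p, hp, rfl⟩ := List.mem_map.1 hx
      obtain ⟨b, hb, rfl⟩ := List.mem_map.1 hy
      rw [htake] at hp
      rw [hcan] at hb
      exact (hinner b hb p (by omega) (by omega)).symm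
    · refine List.Nodup.map_on ?_ (hnd.sublist (List.drop_sublist _ _))
      intro p hp p' hp' h
      rw [hdrop] at hp hp'
      exact houter p (by omega) (by omega) p' (by omega) (by omega) h
    · intro x hx y hy
      obtain ⟨p, hp, rfl⟩ := List.mem_map.1 hy
      rw [hdrop] at hp
      rcases List.mem_append.1 hx with hx | hx
      · obtain ⟨p', hp', rfl⟩ := List.mem_map.1 hx
        rw [htake] at hp'
        intro h
        have := houter p' (by omega) (by omega) p (by omega) (by omega) h
        omega
      · obtain ⟨b, hb, rfl⟩ := List.mem_map.1 hx
        rw [hcan] at hb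
        exact hinner b hb p (by omega) (by omega)

theorem composeLabels_inversePerm {n : ℕ} {f : List ℕ} (hf : f.Perm (List.range n)) :
    composeLabels f (inversePerm f) = List.range n ∧
      (inversePerm f).Perm (List.range n) := by
  have hlen : f.length = n := by simpa using hf.length_eq
  have hidx : ∀ x < n, f.idxOf x < n ∧ f.getD (f.idxOf x) 0 = x := by
    intro x hx
    have hmem : x ∈ f := hf.mem_iff.2 (List.mem_range.2 hx)
    have hlt := List.idxOf_lt_length_of_mem hmem
    exact ⟨hlen ▸ hlt, by rw [List.getD_eq_getElem _ _ hlt, List.getElem_idxOf]⟩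
  constructor
  · rw [composeLabels, inversePerm, List.map_map, hlen]
    conv_rhs => rw [← List.map_id (List.range n)]
    exact List.map_congr_left fun x hx => (hidx x (List.mem_range.1 hx)).2
  · have hnd : (inversePerm f).Nodup := by
      rw [inversePerm, hlen]
      refine List.Nodup.map_on ?_ List.nodup_range
      intro x hx y hy h
      rw [← (hidx x (List.mem_range.1 hx)).2, h, (hidx y (List.mem_range.1 hy)).2]
    refine (List.subperm_of_subset hnd ?_).perm_of_length_le (by simp [inversePerm, hlen])
    intro x hx
    rw [inversePerm, hlen] at hx
    obtain ⟨y, hy, rfl⟩ := List.mem_map.1 hx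
    exact List.mem_range.2 (hidx y (List.mem_range.1 hy)).1

theorem composeLabels_range {n : ℕ} {f : List ℕ} (hf : f.Perm (List.range n)) :
    composeLabels (List.range n) f = f := by
  rw [composeLabels]
  conv_rhs => rw [← List.map_id f]
  refine List.map_congr_left fun x hx => ?_
  have := List.mem_range.1 (hf.mem_iff.1 hx)
  simp [List.getD_eq_getElem?_getD, this]

end Cutting

/-! ### Basis vectors up to sign -/

section Signs

variable {R M N : Type*} [CommRing R] [AddCommGroup M] [Module R M] [AddCommGroup N] [Module R N]

theorem map_units_smul (f : M →ₗ[R] N) (u : ℤˣ) (x : M) : f (u • x) = u • f x := by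
  rw [Units.smul_def, map_zsmul, ← Units.smul_def]

theorem units_smul_tmul (u v : ℤˣ) (x : M) (y : N) :
    (u • x) ⊗ₜ[R] (v • y) = (u * v) • (x ⊗ₜ[R] y) := by
  rcases Int.units_eq_one_or u with rfl | rfl <;> rcases Int.units_eq_one_or v with rfl | rfl <;>
    simp [Units.neg_smul, TensorProduct.neg_tmul, TensorProduct.tmul_neg]

end Signs

variable (R : Type*) [CommRing R] {c : Corolla}

theorem sign_one_nil : Orientation.sign (1, []) = 1 := by
  simp [Orientation.sign, inversionSign]

theorem compC_units_smul (i : ℕ) (u v : ℤˣ) (x y : CA R) :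
    compC R i (u • x) (v • y) = (u * v) • compC R i x y := by
  rcases Int.units_eq_one_or u with rfl | rfl <;> rcases Int.units_eq_one_or v with rfl | rfl <;>
    simp [Units.neg_smul]

/-- The orientation enters `mkC` only through its sign. Therefore `(1, [])`, of sign `1`, serves as
a uniform name for the basis vector of any `D`, although it is an orientation of `D` only when `D`
is empty. -/
theorem mkC_eq (c : Corolla) (D : Finset (Finset ℕ)) (f : List ℕ) (ω : Orientation) :
    mkC R c D f ω = ω.sign • mkC R c D f (1, []) := by
  unfold mkC
  split_ifs
  · rw [sign_one_nil, one_smul]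
  · rw [smul_zero]

theorem mkQ_eq (c : Corolla) (D N : Finset (Finset ℕ)) (f : List ℕ) (ω : Orientation) :
    mkQ R c D N f ω = ω.sign • mkQ R c D N f (1, []) := by
  unfold mkQ
  split_ifs
  · rw [sign_one_nil, one_smul]
  · rw [smul_zero]

theorem mkC_one {D : Finset (Finset ℕ)} {f : List ℕ} (hc : c.Valid) (hD : IsDiagram c D)
    (hf : f.Perm (List.range c.leaves)) :
    mkC R c D f (1, []) = Finsupp.single (Sum.inr ⟨c, hc, D, hD, f, hf⟩) 1 := by
  rw [mkC, dif_pos ⟨hc, hD, hf⟩, sign_one_nil, one_smul]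

theorem mkQ_one {D N : Finset (Finset ℕ)} {f : List ℕ} (hc : c.Valid) (hD : IsDiagram c D)
    (hN : N ⊆ D) (hf : f.Perm (List.range c.leaves)) :
    mkQ R c D N f (1, []) = Finsupp.single (Sum.inr ⟨c, hc, D, hD, N, hN, f, hf⟩) 1 := by
  rw [mkQ, dif_pos ⟨hc, hD, hN, hf⟩, sign_one_nil, one_smul]

theorem actC_mkC {D : Finset (Finset ℕ)} {f σ : List ℕ} (hc : c.Valid) (hD : IsDiagram c D)
    (hf : f.Perm (List.range c.leaves)) (hσ : σ.Perm (List.range c.leaves)) :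
    ∃ u : ℤˣ, actC R σ (mkC R c D f (1, [])) = u • mkC R c D (composeLabels f σ) (1, []) := by
  rw [mkC_one R hc hD hf, actC, Finsupp.linearCombination_single, one_smul]
  simp only [if_pos hσ]
  rw [mkC_eq, smul_smul]
  exact ⟨_, rfl⟩

theorem actQ_mkQ {D N : Finset (Finset ℕ)} {f σ : List ℕ} (hc : c.Valid) (hD : IsDiagram c D)
    (hN : N ⊆ D) (hf : f.Perm (List.range c.leaves)) (hσ : σ.Perm (List.range c.leaves)) :
    ∃ u : ℤˣ, actQ R σ (mkQ R c D N f (1, [])) = u • mkQ R c D N (composeLabels f σ) (1, []) := by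
  rw [mkQ_one R hc hD hN hf, actQ, Finsupp.linearCombination_single, one_smul]
  simp only [if_pos hσ]
  rw [mkQ_eq]
  exact ⟨_, rfl⟩

theorem compC_mkC {c c' : Corolla} {D D' : Finset (Finset ℕ)} {f f' : List ℕ} (hc : c.Valid)
    (hc' : c'.Valid) (hD : IsDiagram c D) (hD' : IsDiagram c' D')
    (hf : f.Perm (List.range c.leaves)) (hf' : f'.Perm (List.range c'.leaves)) {i : ℕ}
    (hi : i < c.leaves) (hcol : c.leafColor (f.getD i 0) = c'.rootColor) :
    ∃ u : ℤˣ, compC R i (mkC R c D f (1, [])) (mkC R c' D' f' (1, [])) =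
      u • mkC R (c.graft (f.getD i 0) c') (graftEdges c D (f.getD i 0) c' D')
        (graftLabels c f i c' f') (1, []) := by
  rw [mkC_one R hc hD hf, mkC_one R hc' hD' hf', compC, Finsupp.linearCombination_single, one_smul,
    Finsupp.linearCombination_single, one_smul]
  simp only [compGenC]
  rw [if_pos ⟨hi, hcol⟩, mkC_eq, smul_smul]
  exact ⟨_, rfl⟩

theorem isDiagram_empty (c : Corolla) : IsDiagram c ∅ := by
  simp [IsDiagram]

theorem canonical_perm (c : Corolla) : (canonical c).Perm (List.range c.leaves) := List.Perm.refl _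

theorem mem_diagrams {D : Finset (Finset ℕ)} : D ∈ diagrams c ↔ IsDiagram c D := by
  simp only [diagrams, Finset.mem_filter, Finset.mem_powerset, and_iff_right_iff_imp]
  intro h e he
  exact Finset.mem_powerset.2 (h.1 e he).subset_range

/-- The graft of the parts of `T`, relabeled, is `T`. -/
theorem actC_compC_cut {T : Finset (Finset ℕ)} {e : Finset ℕ}
    (hT : IsDiagram c T) (he : e ∈ T) :
    ∃ u : ℤˣ, actC R (cutPerm c e) (compC R (cutLeaf c e)
        (mkC R (cutOuter c e) (outerPart c T e) (canonical (cutOuter c e)) (1, []))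
        (mkC R (cutInner c e) (innerPart c T e) (canonical (cutInner c e)) (1, []))) =
      u • mkC R c T (canonical c) (1, []) := by
  have hE := hT.1 e he
  obtain ⟨h1, h2, h3, -⟩ := hT.cut he
  have hget : (canonical (cutOuter c e)).getD (cutLeaf c e) 0 = cutLeaf c e := by
    simp [canonical, List.getD_eq_getElem?_getD, hE.cutLeaf_lt]
  have hc : c.Valid := by
    have := hE.card_lt
    have := hE.two_le_card
    cases c <;> simp only [Corolla.leaves, Corolla.Valid] at * <;> omega
  obtain ⟨u, hu⟩ := compC_mkC R hE.valid_cutOuter hE.cutInner_spec.2.1 h1 h2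
    (canonical_perm _) (canonical_perm _) hE.cutLeaf_lt (by rw [hget]; exact hE.leafColor_cutLeaf)
  rw [hget, hE.graft_eq, h3] at hu
  have hL := graftLabels_perm hE
  obtain ⟨hL1, hL2⟩ := composeLabels_inversePerm hL
  obtain ⟨v, hv⟩ := actC_mkC R hc hT hL hL2
  rw [hL1] at hv
  exact ⟨u * v, by rw [hu, map_units_smul, cutPerm, hv, smul_smul]; rfl⟩

/-! ### Values of `p` on refinements with non-metric edges -/

/-- With `n` leaves, `B` has `n - 2` edges, and the only diagram of degree `n - 2` is the corolla.
Its maximum is `topDiagram c`, and nothing but `topDiagram c` lies above that. -/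
theorem pMetric_of_isBinary (hc : c.Valid) {B : Finset (Finset ℕ)} (hB : IsBinary c B)
    (ω : Orientation) :
    (B = topDiagram c → ∃ u : ℤˣ, pMetric R c B ω = u • mkC R c ∅ (canonical c) (1, [])) ∧
      (B ≠ topDiagram c → pMetric R c B ω = 0) := by
  classical
  have hfil : ∀ S, S ∈ (diagrams c).filter
      (fun S => degree c S = B.card ∧ Le c (maxOf c S) (minOf c B)) ↔
        S = ∅ ∧ B = topDiagram c := by
    intro S
    rw [Finset.mem_filter, mem_diagrams, hB.minOf_eq]
    have hcard := (isBinary_iff.1 hB).2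
    constructor
    · rintro ⟨hS, hdeg, hle⟩
      have hS0 : S = ∅ := by
        rw [← Finset.card_eq_zero]
        unfold degree at hdeg
        omega
      rw [hS0, maxOf_empty hc] at hle
      exact ⟨hS0, eq_of_topDiagram_le hc hle⟩
    · rintro ⟨rfl, rfl⟩
      refine ⟨isDiagram_empty c, ?_, ?_⟩
      · rw [degree, Finset.card_empty]
        omega
      · rw [maxOf_empty hc]
        exact Relation.ReflTransGen.refl
  constructor
  · intro h
    have : (diagrams c).filter
        (fun S => degree c S = B.card ∧ Le c (maxOf c S) (minOf c B)) = {∅} := by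
      ext S
      rw [hfil, Finset.mem_singleton]
      exact and_iff_left h
    rw [pMetric, this, Finset.sum_singleton, mkC_eq]
    exact ⟨_, rfl⟩
  · intro h
    have : (diagrams c).filter
        (fun S => degree c S = B.card ∧ Le c (maxOf c S) (minOf c B)) = ∅ := by
      refine Finset.eq_empty_of_forall_notMem fun S hS => h ((hfil S).1 hS).2
    rw [pMetric, this, Finset.sum_empty]

theorem code_lt_code {d e : Finset ℕ} (h : d ⊂ e) : code d < code e := by
  obtain ⟨x, hx, hx'⟩ := Finset.exists_of_ssubset h
  exact Finset.sum_lt_sum_of_subset h.1 hx hx' (by positivity) fun _ _ _ => by positivity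

/-- `code` is strictly monotone with respect to inclusion, so an edge of least code contains no
other edge. -/
theorem innerPart_innermost (c : Corolla) {T : Finset (Finset ℕ)} (h : T.Nonempty) :
    innerPart c T (innermost T h) = ∅ := by
  rw [innerPart, Finset.image_eq_empty, Finset.filter_eq_empty_iff]
  intro d hd hlt
  have := (T.exists_min_image code h).choose_spec.2 d hd
  exact absurd (code_lt_code hlt) (not_lt.2 this)

theorem graftEdges_mono {a : ℕ} {c' : Corolla} {D₁ D₁' D₂ D₂' : Finset (Finset ℕ)}
    (h₁ : D₁ ⊆ D₁') (h₂ : D₂ ⊆ D₂') : graftEdges c D₁ a c' D₂ ⊆ graftEdges c D₁' a c' D₂' :=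
  Finset.insert_subset_insert _ (Finset.union_subset_union (Finset.image_subset_image h₁)
    (Finset.image_subset_image h₂))

/-- Every diagram `T` has exactly one binary refinement `B` on which `p` does not vanish when the
edges in `T` are non-metric and the other edges are metric; the value is then `± T`. -/
theorem exists_pDiagram_eq (hc : c.Valid) {T : Finset (Finset ℕ)} (hT : IsDiagram c T) :
    ∃ B₀, IsBinary c B₀ ∧ T ⊆ B₀ ∧
      (∀ ω, ∃ u : ℤˣ, pDiagram R c B₀ T ω = u • mkC R c T (canonical c) (1, [])) ∧
      ∀ B, IsBinary c B → T ⊆ B → B ≠ B₀ → ∀ ω, pDiagram R c B T ω = 0 := by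
  induction hn : T.card generalizing c T with
  | zero =>
    obtain rfl := Finset.card_eq_zero.1 hn
    have h0 : ∀ B ω, pDiagram R c B ∅ ω = pMetric R c B ω := fun B ω => by
      rw [pDiagram, dif_neg Finset.not_nonempty_empty]
    refine ⟨topDiagram c, isBinary_topDiagram hc, Finset.empty_subset _, fun ω => ?_,
      fun B hB _ hne ω => ?_⟩
    · rw [h0]
      exact (pMetric_of_isBinary R hc (isBinary_topDiagram hc) ω).1 rfl
    · rw [h0]
      exact (pMetric_of_isBinary R hc hB ω).2 hne
  | succ n ih =>
    have hne : T.Nonempty := Finset.card_pos.1 (by omega)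
    have heT := innermost_mem T hne
    have hT2 := innerPart_innermost c hne
    -- One step of the recursion for all `B` at once. The edge depends only on `T`; the sign and the
    -- two orientations are irrelevant and left unspecified.
    have hunfold : ∀ B ω, ∃ (v : ℤˣ) (ω' ω'' : Orientation), pDiagram R c B T ω =
        v • actC R (cutPerm c (innermost T hne)) (compC R (cutLeaf c (innermost T hne))
          (pDiagram R (cutOuter c (innermost T hne)) (outerPart c B (innermost T hne))
            (outerPart c T (innermost T hne)) ω')
          (pMetric R (cutInner c (innermost T hne)) (innerPart c B (innermost T hne)) ω'')) := by
      intro B ω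
      rw [pDiagram, dif_pos hne]
      exact ⟨_, _, _, rfl⟩
    generalize innermost T hne = e at *
    have hE := hT.1 e heT
    obtain ⟨hT1, -, hgraft, hcard⟩ := hT.cut heT
    have hinnerV := hE.cutInner_spec.2.1
    obtain ⟨B₁, hB₁, hsub, hval, hzero⟩ := ih hE.valid_cutOuter hT1 (by
      rw [hT2, Finset.card_empty] at hcard
      omega)
    have htop := isBinary_topDiagram hinnerV
    obtain ⟨-, hcut1, hcut2⟩ := hE.graft_isDiagram hB₁.1 htop.1
    -- The cut-off inner corolla is refined by its greatest binary diagram, the outer part by the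
    -- diagram from the induction hypothesis. Altogether every vertex of `T` receives its greatest
    -- refinement.
    refine ⟨graftEdges (cutOuter c e) B₁ (cutLeaf c e) (cutInner c e) (topDiagram (cutInner c e)),
      hE.graft_isBinary hB₁ htop, ?_, ?_, ?_⟩
    · rw [hT2] at hgraft
      rw [← hgraft]
      exact graftEdges_mono hsub (Finset.empty_subset _)
    · intro ω
      obtain ⟨v, ω', ω'', h⟩ := hunfold _ ω
      rw [h, hcut1, hcut2]
      obtain ⟨u₁, hu₁⟩ := hval ω'
      obtain ⟨u₂, hu₂⟩ := (pMetric_of_isBinary R hinnerV htop ω'').1 rfl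
      obtain ⟨u₃, hu₃⟩ := actC_compC_cut R hT heT
      rw [hT2] at hu₃
      refine ⟨v * (u₁ * u₂ * u₃), ?_⟩
      rw [hu₁, hu₂, compC_units_smul, map_units_smul, hu₃, smul_smul, smul_smul, mul_assoc v]
    · intro B hB hTB hBne ω
      obtain ⟨v, ω', ω'', h⟩ := hunfold B ω
      obtain ⟨hBo, hBi⟩ := hB.cut (hTB heT)
      have hBgraft := (hB.1.cut (hTB heT)).2.2.1
      rw [h]
      -- `B` is the graft of its two parts, so it differs from the distinguished diagram in at least
      -- one of them, and the corresponding factor vanishes.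
      by_cases h1 : outerPart c B e = B₁
      · have h2 : innerPart c B e ≠ topDiagram (cutInner c e) := by
          intro h2
          rw [h1, h2] at hBgraft
          exact hBne hBgraft.symm
        rw [(pMetric_of_isBinary R hinnerV hBi ω'').2 h2, map_zero, map_zero, smul_zero]
      · have hsub' : outerPart c T e ⊆ outerPart c B e :=
          Finset.image_subset_image (Finset.filter_subset_filter _ hTB)
        rw [hzero _ hBo hsub' h1 ω', map_zero, LinearMap.zero_apply, map_zero, smul_zero]

/-! ### Assembling the diagonal -/

theorem exists_sum_units_smul {ι M : Type*} [AddCommGroup M] {s : Finset ι} {F G : ι → M}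
    (h : ∀ i ∈ s, ∃ u : ℤˣ, F i = u • G i) :
    ∃ u : ι → ℤˣ, ∑ i ∈ s, F i = ∑ i ∈ s, u i • G i := by
  choose! u hu using h
  exact ⟨u, Finset.sum_congr rfl hu⟩

theorem deltaQ_units_smul (u : ℤˣ) (x : QA R) : deltaQ R (u • x) = u • deltaQ R x := by
  rcases Int.units_eq_one_or u with rfl | rfl <;> simp [Units.neg_smul]

theorem map_p_units_smul (u : ℤˣ) (x : QA R ⊗[R] QA R) :
    TensorProduct.map (p R) (p R) (u • x) = u • TensorProduct.map (p R) (p R) x := by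
  rcases Int.units_eq_one_or u with rfl | rfl <;> simp [Units.neg_smul]

open Classical in
theorem q_mkC_empty (hc : c.Valid) {f : List ℕ} (hf : f.Perm (List.range c.leaves)) :
    ∃ u : Finset (Finset ℕ) → ℤˣ, q R (mkC R c ∅ f (1, [])) =
      ∑ B ∈ (diagrams c).filter (IsBinary c), u B • mkQ R c B ∅ f (1, []) := by
  rw [mkC_one R hc (isDiagram_empty c) hf, q, Finsupp.linearCombination_single, one_smul]
  simp only
  rw [qDiagram, dif_neg Finset.not_nonempty_empty, qCorolla, map_units_smul, smul_smul, map_sum,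
    Finset.smul_sum]
  refine exists_sum_units_smul fun B hB => ?_
  obtain ⟨u, hu⟩ := actQ_mkQ R hc (Finset.mem_filter.1 hB).2.1 (Finset.empty_subset _)
    (canonical_perm c) hf
  rw [canonical, composeLabels_range hf] at hu
  rw [mkQ_eq, map_units_smul, canonical, hu, smul_smul, smul_smul]
  exact ⟨_, rfl⟩

/-- The sum over contracted sets `X` is reindexed by the complement `T = B \ X`, which is both the
diagram of the left factor and the set of non-metric edges of the right factor. -/
theorem deltaQ_mkQ (hc : c.Valid) {B : Finset (Finset ℕ)} (hB : IsDiagram c B) {f : List ℕ}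
    (hf : f.Perm (List.range c.leaves)) :
    ∃ u : Finset (Finset ℕ) → ℤˣ, deltaQ R (mkQ R c B ∅ f (1, [])) =
      ∑ T ∈ B.powerset, u T • (mkQ R c T ∅ f (1, []) ⊗ₜ[R] mkQ R c B T f (1, [])) := by
  rw [mkQ_one R hc hB (Finset.empty_subset _) hf, deltaQ, Finsupp.linearCombination_single,
    one_smul]
  simp only [Finset.sdiff_empty, Finset.empty_union]
  have hsum : ∀ F : Finset (Finset ℕ) → QA R ⊗[R] QA R,
      ∑ X ∈ B.powerset, F X = ∑ T ∈ B.powerset, F (B \ T) := fun F =>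
    Finset.sum_nbij' (fun X => B \ X) (fun T => B \ T)
      (fun X _ => Finset.mem_powerset.2 Finset.sdiff_subset)
      (fun X _ => Finset.mem_powerset.2 Finset.sdiff_subset)
      (fun X hX => Finset.sdiff_sdiff_eq_self (Finset.mem_powerset.1 hX))
      (fun X hX => Finset.sdiff_sdiff_eq_self (Finset.mem_powerset.1 hX))
      (fun X hX => by rw [Finset.sdiff_sdiff_eq_self (Finset.mem_powerset.1 hX)])
  rw [hsum]
  refine exists_sum_units_smul (M := QA R ⊗[R] QA R) fun T hT => ?_
  rw [Finset.sdiff_sdiff_eq_self (Finset.mem_powerset.1 hT), mkQ_eq, mkQ_eq R c B,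
    units_smul_tmul, smul_smul]
  exact ⟨_, rfl⟩

open scoped Classical in
/-- The diagrams `S` that occur in the value of `p` on the fully metric diagram `T`. -/
def metricTerms (c : Corolla) (T : Finset (Finset ℕ)) : Finset (Finset (Finset ℕ)) :=
  (diagrams c).filter fun S => degree c S = T.card ∧ Le c (maxOf c S) (minOf c T)

theorem p_mkQ_metric (hc : c.Valid) {T : Finset (Finset ℕ)} (hT : IsDiagram c T) {f : List ℕ}
    (hf : f.Perm (List.range c.leaves)) :
    ∃ u : Finset (Finset ℕ) → ℤˣ, p R (mkQ R c T ∅ f (1, [])) =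
      ∑ S ∈ metricTerms c T, u S • mkC R c S f (1, []) := by
  classical
  rw [mkQ_one R hc hT (Finset.empty_subset _) hf, p, Finsupp.linearCombination_single, one_smul]
  simp only
  rw [pDiagram, dif_neg Finset.not_nonempty_empty, pMetric, map_sum, metricTerms]
  refine exists_sum_units_smul fun S hS => ?_
  obtain ⟨u, hu⟩ := actC_mkC R hc (mem_diagrams.1 (Finset.mem_filter.1 hS).1)
    (canonical_perm c) hf
  rw [canonical, composeLabels_range hf] at hu
  rw [mkC_eq, map_units_smul, canonical, hu, smul_smul]
  exact ⟨_, rfl⟩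

theorem exists_p_mkQ_eq (hc : c.Valid) {T : Finset (Finset ℕ)} (hT : IsDiagram c T) {f : List ℕ}
    (hf : f.Perm (List.range c.leaves)) :
    ∃ B₀, IsBinary c B₀ ∧ T ⊆ B₀ ∧
      (∃ u : ℤˣ, p R (mkQ R c B₀ T f (1, [])) = u • mkC R c T f (1, [])) ∧
      ∀ B, IsBinary c B → T ⊆ B → B ≠ B₀ → p R (mkQ R c B T f (1, [])) = 0 := by
  obtain ⟨B₀, h1, h2, h3, h4⟩ := exists_pDiagram_eq R hc hT
  refine ⟨B₀, h1, h2, ?_, fun B hB hTB hne => ?_⟩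
  · rw [mkQ_one R hc h1.1 h2 hf, p, Finsupp.linearCombination_single, one_smul]
    simp only
    obtain ⟨u, hu⟩ := h3 (refOrientation (B₀ \ T))
    obtain ⟨v, hv⟩ := actC_mkC R hc hT (canonical_perm c) hf
    rw [canonical, composeLabels_range hf] at hv
    rw [hu, map_units_smul, canonical, hv, smul_smul]
    exact ⟨_, rfl⟩
  · rw [mkQ_one R hc hB.1 hTB hf, p, Finsupp.linearCombination_single, one_smul]
    simp only
    rw [h4 B hB hTB hne, map_zero]

theorem exists_p_tmul_p_eq (hc : c.Valid) {T : Finset (Finset ℕ)} (hT : IsDiagram c T)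
    {f : List ℕ} (hf : f.Perm (List.range c.leaves)) :
    ∃ (B₀ : Finset (Finset ℕ)) (u : Finset (Finset ℕ) → ℤˣ), IsBinary c B₀ ∧ T ⊆ B₀ ∧
      p R (mkQ R c T ∅ f (1, [])) ⊗ₜ[R] p R (mkQ R c B₀ T f (1, [])) =
        ∑ S ∈ metricTerms c T, u S • (mkC R c S f (1, []) ⊗ₜ[R] mkC R c T f (1, [])) ∧
      ∀ B, IsBinary c B → T ⊆ B → B ≠ B₀ → p R (mkQ R c B T f (1, [])) = 0 := by
  obtain ⟨B₀, h1, h2, ⟨v, hv⟩, h4⟩ := exists_p_mkQ_eq R hc hT hf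
  obtain ⟨u, hu⟩ := p_mkQ_metric R hc hT hf
  refine ⟨B₀, fun S => u S * v, h1, h2, ?_, h4⟩
  rw [hu, hv, TensorProduct.sum_tmul]
  exact Finset.sum_congr rfl fun S _ => units_smul_tmul _ _ _ _

/-- The diagonal on a corolla, up to signs. -/
theorem exists_deltaC_eq (hc : c.Valid) {f : List ℕ} (hf : f.Perm (List.range c.leaves)) :
    ∃ ε : Finset (Finset ℕ) → Finset (Finset ℕ) → ℤˣ, deltaC R (mkC R c ∅ f (1, [])) =
      ∑ T ∈ diagrams c, ∑ S ∈ metricTerms c T,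
        ε S T • (mkC R c S f (1, []) ⊗ₜ[R] mkC R c T f (1, [])) := by
  classical
  obtain ⟨u, hu⟩ := q_mkC_empty R hc hf
  have hv := fun B (hB : B ∈ (diagrams c).filter (IsBinary c)) =>
    deltaQ_mkQ R hc (mem_diagrams.1 (Finset.mem_filter.1 hB).1) hf
  choose! v hv using hv
  have hw := fun T (hT : T ∈ diagrams c) => exists_p_tmul_p_eq R hc (mem_diagrams.1 hT) hf
  choose! B₀ w hB₀ hT hw hzero using hw
  have h1 : deltaC R (mkC R c ∅ f (1, [])) = ∑ B ∈ (diagrams c).filter (IsBinary c),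
      ∑ T ∈ B.powerset, (u B * v B T) •
        (p R (mkQ R c T ∅ f (1, [])) ⊗ₜ[R] p R (mkQ R c B T f (1, []))) := by
    rw [deltaC, LinearMap.comp_apply, LinearMap.comp_apply, hu, map_sum, map_sum]
    refine Finset.sum_congr rfl fun B hB => ?_
    rw [deltaQ_units_smul, map_p_units_smul, hv B hB, map_sum,
      Finset.smul_sum]
    refine Finset.sum_congr rfl fun T _ => ?_
    rw [map_p_units_smul, TensorProduct.map_tmul, smul_smul]
  refine ⟨fun S T => u (B₀ T) * v (B₀ T) T * w T S, ?_⟩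
  -- After interchanging the sums, the inner sum is over the binary refinements `B` of a fixed `T`,
  -- and only `B₀ T` contributes.
  rw [h1, Finset.sum_comm' (t' := diagrams c)
    (s' := fun T => ((diagrams c).filter (IsBinary c)).filter (T ⊆ ·))]
  · refine Finset.sum_congr rfl fun T hTd => ?_
    rw [Finset.sum_eq_single (B₀ T)]
    · rw [hw T hTd, Finset.smul_sum]
      exact Finset.sum_congr rfl fun S _ => smul_smul _ _ _
    · intro B hB hne
      obtain ⟨hB, hTB⟩ := Finset.mem_filter.1 hB
      rw [hzero T hTd B (Finset.mem_filter.1 hB).2 hTB hne, TensorProduct.tmul_zero, smul_zero]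
    · intro h
      exact absurd (Finset.mem_filter.2 ⟨Finset.mem_filter.2 ⟨mem_diagrams.2 (hB₀ T hTd).1,
        hB₀ T hTd⟩, hT T hTd⟩) h
  · intro B T
    simp only [Finset.mem_filter, Finset.mem_powerset, mem_diagrams]
    constructor
    · rintro ⟨⟨hB, hBb⟩, hTB⟩
      exact ⟨⟨⟨hB, hBb⟩, hTB⟩, fun e he => hB.1 e (hTB he),
        fun e he e' he' => hB.2 e (hTB he) e' (hTB he')⟩
    · exact fun h => h.1

end Pairahedra

end

/-- The diagonal on a corolla of degree `k` with an arbitrary labeling `f` of its leaves and with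
arbitrary orientations `ω D` of the diagrams. -/
theorem propositionP (R : Type*) [CommRing R] (c : Pairahedra.Corolla) (hc : c.Valid)
    (k : ℤ) (hk : Pairahedra.degree c ∅ = k)
    (f : List ℕ) (hf : f.Perm (List.range c.leaves))
    (ω : Finset (Finset ℕ) → Pairahedra.Orientation)
    (hω : ∀ D ∈ Pairahedra.diagrams c, (ω D).IsOrientationOf D) :
    ∃ ε : Finset (Finset ℕ) → Finset (Finset ℕ) → ℤˣ,
      Pairahedra.deltaC R (Pairahedra.mkC R c ∅ f (1, [])) =
        ∑ x ∈ Pairahedra.matchingPairs c k,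
          ε x.1 x.2 • (Pairahedra.mkC R c x.1 f (ω x.1) ⊗ₜ[R] Pairahedra.mkC R c x.2 f (ω x.2)) := by
  classical
  obtain ⟨ε, hε⟩ := Pairahedra.exists_deltaC_eq R hc hf
  -- The extra factors cancel the signs of the chosen orientations, since every sign is its own
  -- inverse.
  refine ⟨fun S T => ε S T * ((ω S).sign * (ω T).sign), ?_⟩
  rw [hε, Pairahedra.matchingPairs, Finset.sum_filter, Finset.sum_product_right]
  refine Finset.sum_congr rfl fun T _ => ?_
  rw [Pairahedra.metricTerms, Finset.sum_filter]
  refine Finset.sum_congr rfl fun S _ => ?_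
  -- The degree of `T` is `k` minus the number of its edges.
  have hdeg : Pairahedra.degree c S = T.card ↔
      Pairahedra.degree c S + Pairahedra.degree c T = k := by
    rw [← hk]
    simp only [Pairahedra.degree, Finset.card_empty]
    omega
  by_cases h : Pairahedra.degree c S + Pairahedra.degree c T = k ∧
      Pairahedra.Le c (Pairahedra.maxOf c S) (Pairahedra.minOf c T)
  · rw [if_pos (by rwa [hdeg]), if_pos h, Pairahedra.mkC_eq R c S f (ω S),
      Pairahedra.mkC_eq R c T f (ω T), Pairahedra.units_smul_tmul, smul_smul, mul_assoc,
      Int.units_mul_self, mul_one]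
  · rw [if_neg (by rwa [hdeg]), if_neg h]
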